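/- Let $q\ge 1$, let $\chi$ be a primitive Dirichlet character mod $q$, let $s=\sigma+it$ with $0\le\sigma\le1$ and $t\ge0$, let $X>0$ be arbitrary, define $y\ge0$ by $2\pi\frac{X}{q}y=t$, and let $0<\eta<1$. Write $e(u)=e^{2\pi iu}$, $\psi(u)=u-[u]-\frac12$ and $\tau(\chi)=\sum_{a=1}^q\chi(a)e(a/q)$. Define $E_1(s,X,\chi)$ by $$L(s,\chi)=\sum_{n\le X}\chi(n)n^{-s}+iq^{-s}(2\pi)^{s-1}\Gamma(1-s)e^{-\pi is/2}\chi(-1)\tau(\chi)\sum_{n\le y}\bar\chi(n)n^{s-1}+E_1(s,X,\chi),$$ where an empty second sum contributes $0$. Put $$K_1(\chi)=X^{-s}\sum_{a=1}^q\chi(a)\Big(\psi\big(\tfrac{X-a}q\big)+\sum_{1\le\nu\le y}\frac{e(\nu\frac{X-a}q)}{2\pi i\nu}\Big)+\tau(\chi)\sum_{\nu\ge y+\eta}\frac{\bar\chi(-\nu)\,s}{2\pi i\nu}\int_{X/q}^\infty\frac{e(\nu u)}{q^su^{s+1}}du$$ $$\qquad-\tau(\chi)\sum_{1\le\nu\le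 y-\eta}\bar\chi(-\nu)\int_0^{X/q}\frac{e(\nu u)}{(qu)^s}du-\tau(\chi)\sum_{\nu\ge1}\frac{\bar\chi(\nu)\,s}{2\pi i\nu}\int_{X/q}^\infty\frac{e(-\nu u)}{q^su^{s+1}}du,$$ $$K_2(\chi)=\tau(\chi)\sum_{y<\nu<y+\eta}\frac{\bar\chi(-\nu)\,s}{2\pi i\nu}\int_{X/q}^\infty\frac{e(\nu u)}{q^su^{s+1}}du-\tau(\chi)\sum_{\substack{y-\eta<\nu\le y\\ \nu\ge1}}\bar\chi(-\nu)\int_0^{X/q}\frac{e(\nu u)}{(qu)^s}du.$$ Here $\int_{X/q}^\infty$ is $\lim_{R\to\infty}\int_{X/q}^R$. The integrals $\int_0^{X/q}$ converge absolutely if $\sigma<1$; for $\sigma=1$ they denote the limit, as $\delta\to0^+$, of the same integrals with $s-\delta$ in place of $s$. All these limits exist for the integrals that occur, and the two infinite series over $\nu$ converge absolutely. Then $E_1(s,X,\chi)=K_1(\chi)+K_2(\chi)$ if $q>1$; if $q=1$ and $s\ne1$, then $E_1(s,X,\chi)-\frac{X^{1-s}}{s-1}=K_1(\chi)+K_2(\chi)$.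 If $y=\nu_0\ge1$ is an integer, then $K_2(\chi)=-\tau(\chi)\bar\chi(-\nu_0)\int_0^{X/q}\frac{e(\nu_0u)}{(qu)^s}du$. Moreover, for every $c>0$: if $X\ge c$ and $y\ge c$, then $K_1(\chi)\ll q^{1/2}X^{-\sigma}\log\big(q(t+2)\big)$ with a constant depending only on $c$ and $\eta$; if in addition $t\ge c$, then $K_2(\chi)\ll\frac{X^{1-\sigma}}{\sqrt{qt}}$ with a constant depending only on $c$. -/

import Mathlib

noncomputable section

namespace LApprox

/-- The sawtooth function `ψ(u) = u - [u] - 1/2`. -/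
def sawtooth (u : ℝ) : ℝ := u - (⌊u⌋ : ℝ) - 1 / 2

/-- `e(u) = exp(2πiu)`. -/
def e (u : ℝ) : ℂ := Complex.exp (2 * (Real.pi : ℂ) * Complex.I * (u : ℂ))

/-- The Gauss sum `τ(χ) = ∑_{a mod q} χ(a) exp(2πia/q)`. -/
def tau {q : ℕ} [NeZero q] (χ : DirichletCharacter ℂ q) : ℂ :=
  gaussSum χ ZMod.stdAddChar

/-- The truncated integral `∫_x^R e(mu) / (q^s u^(s+1)) du`. -/
def tailTrunc (q : ℕ) (m : ℤ) (x : ℝ) (s : ℂ) (R : ℝ) : ℂ :=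
  ∫ u in x..R, e ((m : ℝ) * u) / ((q : ℂ) ^ s * (u : ℂ) ^ (s + 1))

/-- The improper integral `∫_x^∞ e(mu) / (q^s u^(s+1)) du`, the limit of the truncated
integrals (for `Re s = 0` it converges only conditionally). -/
def tailIntegral (q : ℕ) (m : ℤ) (x : ℝ) (s : ℂ) : ℂ :=
  Filter.limUnder Filter.atTop (tailTrunc q m x s)

/-- The integrand `e(νu) / (qu)^s`. -/
def headIntegrand (q ν : ℕ) (s : ℂ) (u : ℝ) : ℂ :=
  e ((ν : ℝ) * u) / ((q : ℂ) * (u : ℂ)) ^ s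

/-- `∫_0^x e(νu) / (qu)^s du`. For `Re s < 1` this is an absolutely convergent integral.
On the line `Re s = 1`, where the integral has no limit at `0`, it denotes the limit of
the integrals for `s - δ` as `δ → 0+`. -/
def headIntegral (q ν : ℕ) (x : ℝ) (s : ℂ) : ℂ :=
  if s.re < 1 then ∫ u in (0 : ℝ)..x, headIntegrand q ν s u
  else Filter.limUnder (nhdsWithin (0 : ℝ) (Set.Ioi 0))
    (fun δ : ℝ => ∫ u in (0 : ℝ)..x, headIntegrand q ν (s - (δ : ℂ)) u)

section

variable {q : ℕ} [NeZero q]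

/-- The term `conj χ(-ν) · s/(2πiν) · ∫_{X/q}^∞ e(νu) / (q^s u^(s+1)) du`. -/
def posTerm (χ : DirichletCharacter ℂ q) (s : ℂ) (X : ℝ) (ν : ℕ) : ℂ :=
  (starRingEnd ℂ) (χ (-(ν : ZMod q))) * (s / (2 * (Real.pi : ℂ) * Complex.I * (ν : ℂ)))
    * tailIntegral q (ν : ℤ) (X / q) s

/-- The term `conj χ(ν) · s/(2πiν) · ∫_{X/q}^∞ e(-νu) / (q^s u^(s+1)) du`. -/
def negTerm (χ : DirichletCharacter ℂ q) (s : ℂ) (X : ℝ) (ν : ℕ) : ℂ :=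
  (starRingEnd ℂ) (χ (ν : ZMod q)) * (s / (2 * (Real.pi : ℂ) * Complex.I * (ν : ℂ)))
    * tailIntegral q (-(ν : ℤ)) (X / q) s

/-- The term `conj χ(-ν) · ∫_0^{X/q} e(νu) / (qu)^s du`. -/
def headTerm (χ : DirichletCharacter ℂ q) (s : ℂ) (X : ℝ) (ν : ℕ) : ℂ :=
  (starRingEnd ℂ) (χ (-(ν : ZMod q))) * headIntegral q ν (X / q) s

/-- The first part `K₁(χ)` of the remainder. -/
def K₁ (χ : DirichletCharacter ℂ q) (s : ℂ) (X y η : ℝ) : ℂ :=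
  (X : ℂ) ^ (-s) * ∑ a ∈ Finset.Icc 1 q, χ (a : ZMod q) *
      ((sawtooth ((X - a) / q) : ℂ) + ∑ ν ∈ Finset.Icc 1 ⌊y⌋₊,
        e ((ν : ℝ) * ((X - a) / q)) / (2 * (Real.pi : ℂ) * Complex.I * (ν : ℂ)))
    + tau χ * ∑' ν : {ν : ℕ // y + η ≤ (ν : ℝ)}, posTerm χ s X ν
    - tau χ * ∑ ν ∈ Finset.Icc 1 ⌊y - η⌋₊, headTerm χ s X ν
    - tau χ * ∑' ν : ℕ+, negTerm χ s X ν

/-- The second part `K₂(χ)` of the remainder. -/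
def K₂ (χ : DirichletCharacter ℂ q) (s : ℂ) (X y η : ℝ) : ℂ :=
  tau χ * ∑ ν ∈ (Finset.Icc 1 ⌈y + η⌉₊).filter (fun ν : ℕ => y < (ν : ℝ) ∧ (ν : ℝ) < y + η),
      posTerm χ s X ν
    - tau χ * ∑ ν ∈ (Finset.Icc 1 ⌊y⌋₊).filter (fun ν : ℕ => y - η < (ν : ℝ)),
      headTerm χ s X ν

/-- The remainder `E₁(s, X, χ)`: the difference between `L(s, χ)` and the two finite sums. -/
def E₁ (χ : DirichletCharacter ℂ q) (s : ℂ) (X y : ℝ) : ℂ :=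
  DirichletCharacter.LFunction χ s
    - (∑ n ∈ Finset.Icc 1 ⌊X⌋₊, χ (n : ZMod q) * (n : ℂ) ^ (-s)
      + Complex.I * (q : ℂ) ^ (-s) * (2 * (Real.pi : ℂ)) ^ (s - 1) * Complex.Gamma (1 - s)
        * Complex.exp (-((Real.pi : ℂ) * Complex.I * s / 2)) * χ (-1) * tau χ
        * ∑ n ∈ Finset.Icc 1 ⌊y⌋₊, (starRingEnd ℂ) (χ (n : ZMod q)) * (n : ℂ) ^ (s - 1))

end

end LApprox

end

/-!
Why the approximate functional equation holds with this remainder.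

**The identity.** Since `χ` is primitive, its partial sums are, up to sign, a constant and the linear
term for `q = 1`, the sawtooth sums `charSawtooth χ u = ∑_a χ(a) ψ((u - a)/q)`. Euler–Maclaurin summation
to second order, with the kernel `charKernel` built from `-B₂({v})/2`, expresses
`L(s, χ) - ∑_{n ≤ X} χ(n) n^(-s)` by boundary terms at `X` and an integral over `(X, ∞)` that
converges absolutely for `Re s > -1`. The formula holds for `Re s > 1` by summation and in the larger
half plane (without the pole, for `q = 1`) by analytic continuation (`LFunction_eq`). Working to
second order has two benefits: the closed strip `0 ≤ Re s ≤ 1` is interior to the domain, and the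
Fourier series of the kernel converges absolutely, so that it may be integrated term by term. One
integration by parts in each term turns the result into the two series over `ν` with the
conditionally convergent integrals `tailIntegral`, of absolutely convergent terms
(`LFunction_eq_add_tsum`). The Gauss sum enters through `∑_a χ(a) e(m(u - a/q))`
(`sum_char_mul_e_sub`).

For `1 ≤ ν ≤ y` the integral over `(X/q, ∞)` is traded for `∫_0^∞ - ∫_0^{X/q}`. The complete
integral `∫_0^∞ u^(-s) e(νu) du` is a Gamma integral on the imaginary axis, reached from the right
half plane (`integral_cpow_mul_cexp_eq_Gamma`, `integral_split`), and yields the term `ν` of the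
second sum of the approximate functional equation (`tau_mul_posTerm`); the boundary term of the
integration by parts is the term `ν` of the finite sum in `K₁`. The line `Re s = 1` is reached
through a closed form of the integral over `(0, X/q)` that stays continuous there
(`headClosed`, `tendsto_integral_headIntegrand`). What remains, sorted by the position of `ν`
relative to `y`, is `K₁ + K₂` (`remainder_eq`).

**The estimates.** The phase of `u^(-it) e(νu)` is `2πνu - t log u`, whose only stationary point
`u = t/(2πν)` lies to the left of `X/q` for `ν > y` and to the right of it for `ν < y`. So no
integral contains a stationary point in its interior, and the first derivative test
(`norm_integral_cpow_mul_e_le`) bounds it by `≪ X^(-σ) / ((X/q) |ν - y|)`. After multiplication by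
`s ≪ σ + t` with `t = 2π(X/q)y`, and division by `ν`, the terms of `K₁` are
`≪ X^(-σ) / |ν - y|` near `y` and decay quadratically in `ν` far from it; since `|ν - y| ≥ η`, they
sum to a logarithm. The sawtooth sum contributes `√q log q` by the Pólya–Vinogradov inequality
(`norm_charSawtooth_le`). In `K₂` there is at most one `ν` in each sum; the stationary point may be
the end point `X/q` itself, and removing a neighbourhood of length about `(X/q)/√t`, which is
estimated trivially, leaves an integral to which the first derivative test applies
(`norm_tailIntegral_le_sqrt`, `norm_headIntegral_le_sqrt`).
-/

namespace LApprox

open Filter Topology MeasureTheory Set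

/-! ### Exponentials, Gauss sums and the Pólya–Vinogradov inequality -/

lemma e_eq_exp (u : ℝ) : e u = Complex.exp (((2 * Real.pi * u : ℝ) : ℂ) * Complex.I) := by
  rw [e]; congr 1; push_cast; ring

lemma norm_e (u : ℝ) : ‖e u‖ = 1 := by
  rw [e_eq_exp, Complex.norm_exp_ofReal_mul_I]

lemma e_add (u v : ℝ) : e (u + v) = e u * e v := by
  simp only [e, ← Complex.exp_add]; congr 1; push_cast; ring

lemma e_nat_mul (n : ℕ) (u : ℝ) : e (n * u) = e u ^ n := by
  simp only [e, ← Complex.exp_nat_mul]; congr 1; push_cast; ring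

lemma continuous_e : Continuous e := by unfold e; fun_prop

lemma stdAddChar_intCast_eq_e {q : ℕ} [NeZero q] (k : ℤ) :
    ZMod.stdAddChar (k : ZMod q) = e ((k : ℝ) / q) := by
  rw [ZMod.stdAddChar_coe, e]; congr 1; push_cast; ring

section Characters

variable {q : ℕ} [NeZero q]

/-- The integers `1, …, q` form a complete residue system mod `q`. -/
lemma sum_Icc_natCast_zmod {M : Type*} [AddCommMonoid M] (f : ZMod q → M) :
    ∑ a ∈ Finset.Icc 1 q, f (a : ZMod q) = ∑ a, f a := by
  have hq : 0 < q := NeZero.pos q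
  refine Finset.sum_bij' (fun a _ => (a : ZMod q))
    (fun b _ => if b.val = 0 then q else b.val) (by simp) ?_ ?_ ?_ (by simp)
  · intro b _
    have := ZMod.val_lt b
    split_ifs <;> simp [Finset.mem_Icc] <;> omega
  · intro a ha
    rw [Finset.mem_Icc] at ha
    rcases ha.2.lt_or_eq with h | h
    · rw [ZMod.val_natCast, Nat.mod_eq_of_lt h, if_neg (by omega)]
    · simp [h]
  · intro b _
    split_ifs with h
    · rw [ZMod.natCast_self, (ZMod.val_eq_zero b).1 h]
    · simp

/-- For a primitive character the twisted Gauss sum is `conj χ(m) τ(χ)`, for every `m`. -/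
lemma sum_char_mul_e {χ : DirichletCharacter ℂ q} (hχ : χ.IsPrimitive) (m : ℤ) :
    ∑ a ∈ Finset.Icc 1 q, χ (a : ZMod q) * e (m * ((a : ℝ) / q))
      = (starRingEnd ℂ) (χ (m : ZMod q)) * tau χ := by
  have h := gaussSum_mulShift_of_isPrimitive (e := ZMod.stdAddChar) hχ (m : ZMod q)
  rw [tau, starRingEnd_apply, MulChar.star_apply', ← h, gaussSum,
    ← sum_Icc_natCast_zmod]
  refine Finset.sum_congr rfl fun a _ => ?_
  rw [AddChar.mulShift_apply]
  have := stdAddChar_intCast_eq_e (q := q) (m * a)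
  push_cast at this
  rw [this, mul_div_assoc]

/-- The twisted Gauss sum with the frequency `m` shifted by `u`. -/
lemma sum_char_mul_e_sub {χ : DirichletCharacter ℂ q} (hχ : χ.IsPrimitive) (m : ℤ) (u : ℝ) :
    ∑ a ∈ Finset.Icc 1 q, χ (a : ZMod q) * e (m * (u - (a : ℝ) / q))
      = (starRingEnd ℂ) (χ (-m : ZMod q)) * tau χ * e (m * u) := by
  have h := sum_char_mul_e hχ (-m)
  push_cast at h
  rw [← h, Finset.sum_mul]
  refine Finset.sum_congr rfl fun a _ => ?_
  rw [mul_assoc, ← e_add]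
  congr 2; ring

lemma norm_tau {χ : DirichletCharacter ℂ q} (hχ : χ.IsPrimitive) : ‖tau χ‖ = Real.sqrt q := by
  classical
  have key : tau χ * (starRingEnd ℂ) (tau χ) = q := by
    have h1 : (starRingEnd ℂ) (tau χ) =
        ∑ a : ZMod q, χ⁻¹ a * ZMod.stdAddChar (-a) := by
      rw [tau, gaussSum, map_sum]
      refine Finset.sum_congr rfl fun a _ => ?_
      rw [map_mul, starRingEnd_apply, MulChar.star_apply', AddChar.map_neg_eq_conj]
    have h2 (a : ZMod q) : χ⁻¹ a * tau χ = ∑ b, χ b * ZMod.stdAddChar (a * b) := by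
      rw [tau, ← gaussSum_mulShift_of_isPrimitive ZMod.stdAddChar hχ, gaussSum]
      simp [AddChar.mulShift_apply]
    calc tau χ * (starRingEnd ℂ) (tau χ)
        = ∑ a : ZMod q, (χ⁻¹ a * tau χ) * ZMod.stdAddChar (-a) := by
          rw [h1, Finset.mul_sum]
          exact Finset.sum_congr rfl fun a _ => by ring
      _ = ∑ a : ZMod q, ∑ b, χ b * ZMod.stdAddChar (a * (b - 1)) := by
          refine Finset.sum_congr rfl fun a _ => ?_
          rw [h2, Finset.sum_mul]
          refine Finset.sum_congr rfl fun b _ => ?_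
          rw [mul_assoc, ← AddChar.map_add_eq_mul]; congr 2; ring
      _ = ∑ b : ZMod q, χ b * ((if b - 1 = 0 then Fintype.card (ZMod q) else 0 : ℕ) : ℂ) := by
          rw [Finset.sum_comm]
          refine Finset.sum_congr rfl fun b _ => ?_
          rw [← Finset.mul_sum, AddChar.sum_mulShift _ (ZMod.isPrimitive_stdAddChar q)]
      _ = q := by
          rw [Finset.sum_eq_single 1]
          · simp [ZMod.card]
          · intro b _ hb; simp [sub_eq_zero, hb]
          · simp
  rw [Complex.mul_conj, Complex.normSq_eq_norm_sq] at key
  rw [eq_comm, Real.sqrt_eq_iff_eq_sq (by positivity) (by positivity)]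
  exact_mod_cast key.symm

lemma ne_one_of_isPrimitive {χ : DirichletCharacter ℂ q} (hχ : χ.IsPrimitive) (hq : q ≠ 1) :
    χ ≠ 1 := by
  rintro rfl
  exact hq ((DirichletCharacter.isPrimitive_def _).1 hχ ▸ DirichletCharacter.conductor_one)

lemma sum_char_eq {χ : DirichletCharacter ℂ q} (hχ : χ.IsPrimitive) :
    ∑ a ∈ Finset.Icc 1 q, χ (a : ZMod q) = if q = 1 then 1 else 0 := by
  split_ifs with h
  · subst h
    rw [Finset.Icc_self, Finset.sum_singleton, Nat.cast_one, map_one]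
  · rw [sum_Icc_natCast_zmod (fun a => χ a),
      MulChar.sum_eq_zero_of_ne_one (ne_one_of_isPrimitive hχ h)]

end Characters

lemma norm_e_sub_one {θ : ℝ} (h0 : 0 ≤ θ) (h1 : θ ≤ 1) : 4 * (θ * (1 - θ)) ≤ ‖e θ - 1‖ := by
  have hs : 2 * (θ * (1 - θ)) ≤ Real.sin (Real.pi * θ) := by
    have hpi := Real.pi_pos
    rcases le_total θ (1 / 2) with h | h
    · have := Real.mul_le_sin (x := Real.pi * θ) (by positivity) (by nlinarith)
      have h2 : 2 / Real.pi * (Real.pi * θ) = 2 * θ := by field_simp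
      nlinarith
    · have := Real.mul_le_sin (x := Real.pi * (1 - θ)) (mul_nonneg hpi.le (by linarith))
        (by nlinarith)
      have h2 : 2 / Real.pi * (Real.pi * (1 - θ)) = 2 * (1 - θ) := by field_simp
      have h3 : Real.sin (Real.pi * (1 - θ)) = Real.sin (Real.pi * θ) := by
        rw [mul_sub, mul_one, Real.sin_pi_sub]
      nlinarith
  have : e θ = Complex.exp (Complex.I * ((2 * Real.pi * θ : ℝ) : ℂ)) := by
    rw [e_eq_exp, mul_comm]
  rw [this, Complex.norm_exp_I_mul_ofReal_sub_one, show 2 * Real.pi * θ / 2 = Real.pi * θ by ring,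
    norm_mul, Real.norm_eq_abs, Real.norm_eq_abs]
  have := le_abs_self (Real.sin (Real.pi * θ))
  norm_num; linarith

/-- A geometric sum of `e(nθ)` is at most `2 / |e(θ) - 1|`, hence of size `1 / min(θ, 1 - θ)`. -/
lemma norm_sum_e_le {θ : ℝ} (h0 : 0 < θ) (h1 : θ < 1) (N : ℕ) :
    ‖∑ n ∈ Finset.Icc 1 N, e (n * θ)‖ ≤ (1 / 2) * (1 / θ + 1 / (1 - θ)) := by
  have h1' : 0 < 1 - θ := by linarith
  have hpos : 0 < 4 * (θ * (1 - θ)) := by positivity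
  have hle := norm_e_sub_one h0.le h1.le
  have hne : e θ ≠ 1 := by
    intro h; rw [h] at hle; simp at hle; linarith
  have hsum : ∑ n ∈ Finset.Icc 1 N, e (n * θ) = e θ * ((e θ ^ N - 1) / (e θ - 1)) := by
    rw [← geom_sum_eq hne]
    clear * -
    induction N with
    | zero => simp
    | succ N ih =>
      rw [Finset.sum_Icc_succ_top (by omega), ih, Finset.sum_range_succ, e_nat_mul]
      ring
  rw [hsum, norm_mul, norm_e, one_mul, norm_div]
  have h2 : ‖e θ ^ N - 1‖ ≤ 2 := by
    refine (norm_sub_le _ _).trans ?_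
    rw [norm_pow, norm_e]; norm_num
  calc ‖e θ ^ N - 1‖ / ‖e θ - 1‖ ≤ 2 / (4 * (θ * (1 - θ))) := by gcongr
    _ = (1 / 2) * (1 / θ + 1 / (1 - θ)) := by field_simp; ring

lemma sum_Icc_inv_le (N : ℕ) : ∑ n ∈ Finset.Icc 1 N, ((n : ℝ))⁻¹ ≤ 1 + Real.log N := by
  have h := harmonic_le_one_add_log N
  rw [harmonic_eq_sum_Icc] at h
  push_cast at h
  exact h

section PolyaVinogradov

variable {q : ℕ} [NeZero q]

/-- The Pólya–Vinogradov inequality: complete the sum by means of the Gauss sums. -/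
lemma norm_sum_char_le {χ : DirichletCharacter ℂ q} (hχ : χ.IsPrimitive) (hq : q ≠ 1) (N : ℕ) :
    ‖∑ n ∈ Finset.Icc 1 N, χ (n : ZMod q)‖ ≤ Real.sqrt q * (1 + Real.log q) := by
  have hq1 : 1 < q := lt_of_le_of_ne (NeZero.pos q) (Ne.symm hq)
  have hqR : (0 : ℝ) < q := by exact_mod_cast NeZero.pos q
  set S := ∑ n ∈ Finset.Icc 1 N, χ (n : ZMod q) with hS
  have h1 : (starRingEnd ℂ) S * tau χ =
      ∑ a ∈ Finset.Icc 1 q, χ (a : ZMod q) * ∑ n ∈ Finset.Icc 1 N, e (n * ((a : ℝ) / q)) := by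
    rw [hS, map_sum, Finset.sum_mul]
    simp_rw [Finset.mul_sum]
    rw [Finset.sum_comm]
    refine Finset.sum_congr rfl fun n _ => ?_
    have := sum_char_mul_e hχ n
    push_cast at this
    exact this.symm
  have hIcc : Finset.Icc 1 q = insert q (Finset.Icc 1 (q - 1)) := by
    ext; simp; omega
  have h2 : ‖(starRingEnd ℂ) S * tau χ‖ ≤
      ∑ a ∈ Finset.Icc 1 (q - 1), (1 / 2) * (1 / ((a : ℝ) / q) + 1 / (1 - (a : ℝ) / q)) := by
    rw [h1, hIcc, Finset.sum_insert (by simp; omega), ZMod.natCast_self,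
      MulChar.map_nonunit χ (by
        have : Fact (1 < q) := ⟨hq1⟩
        exact not_isUnit_zero), zero_mul, zero_add]
    refine (norm_sum_le _ _).trans (Finset.sum_le_sum fun a ha => ?_)
    rw [Finset.mem_Icc] at ha
    rw [norm_mul]
    have ha1 : (0 : ℝ) < a := by exact_mod_cast ha.1
    have ha2 : (a : ℝ) < q := by exact_mod_cast (by omega : a < q)
    calc _ ≤ 1 * ‖∑ n ∈ Finset.Icc 1 N, e (n * ((a : ℝ) / q))‖ := by
          gcongr; exact χ.norm_le_one _
      _ ≤ _ := by
          rw [one_mul]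
          exact norm_sum_e_le (by positivity) ((div_lt_one hqR).2 ha2) N
  have h3 : ∑ a ∈ Finset.Icc 1 (q - 1), (1 / 2) * (1 / ((a : ℝ) / q) + 1 / (1 - (a : ℝ) / q))
      = q * ∑ a ∈ Finset.Icc 1 (q - 1), ((a : ℝ))⁻¹ := by
    have hrefl : ∑ a ∈ Finset.Icc 1 (q - 1), (((q : ℝ) - a))⁻¹
        = ∑ a ∈ Finset.Icc 1 (q - 1), ((a : ℝ))⁻¹ := by
      refine Finset.sum_bij' (fun a _ => q - a) (fun a _ => q - a) ?_ ?_ ?_ ?_ ?_ <;>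
        intro a ha <;> rw [Finset.mem_Icc] at ha <;> try (rw [Finset.mem_Icc]; omega)
      · omega
      · omega
      rw [Nat.cast_sub (by omega)]
    calc _ = ∑ a ∈ Finset.Icc 1 (q - 1), ((q / 2 : ℝ) * (a : ℝ)⁻¹ + (q / 2) * ((q : ℝ) - a)⁻¹) := by
          refine Finset.sum_congr rfl fun a ha => ?_
          rw [Finset.mem_Icc] at ha
          have ha1 : (0 : ℝ) < a := by exact_mod_cast ha.1
          have ha2 : (a : ℝ) < q := by exact_mod_cast (by omega : a < q)
          have : (q : ℝ) - a ≠ 0 := by linarith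
          field_simp
      _ = _ := by
          rw [Finset.sum_add_distrib, ← Finset.mul_sum, ← Finset.mul_sum, hrefl]; ring
  have h4 : ∑ a ∈ Finset.Icc 1 (q - 1), ((a : ℝ))⁻¹ ≤ 1 + Real.log q := by
    refine (sum_Icc_inv_le _).trans ?_
    gcongr
    · exact_mod_cast (by omega : 0 < q - 1)
    · omega
  rw [norm_mul, norm_tau hχ, RCLike.norm_conj, h3] at h2
  have hs : 0 < Real.sqrt q := Real.sqrt_pos.2 hqR
  have h5 : ‖S‖ * Real.sqrt q ≤ Real.sqrt q * (1 + Real.log q) * Real.sqrt q := by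
    refine h2.trans ?_
    calc (q : ℝ) * ∑ a ∈ Finset.Icc 1 (q - 1), ((a : ℝ))⁻¹ ≤ q * (1 + Real.log q) := by gcongr
      _ = (Real.sqrt q * Real.sqrt q) * (1 + Real.log q) := by rw [Real.mul_self_sqrt hqR.le]
      _ = _ := by ring
  exact le_of_mul_le_mul_right h5 hs

/-- The sawtooth sum `∑_a χ(a) ψ((u - a)/q)`. -/
noncomputable def charSawtooth (χ : DirichletCharacter ℂ q) (u : ℝ) : ℂ :=
  ∑ a ∈ Finset.Icc 1 q, χ (a : ZMod q) * (sawtooth ((u - a) / q) : ℂ)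

/-- The constant term in the expression of `∑_{n ≤ u} χ(n)` by sawtooth functions. -/
noncomputable def charMean (χ : DirichletCharacter ℂ q) : ℂ :=
  ∑ a ∈ Finset.Icc 1 q, χ (a : ZMod q) * (1 / 2 - (a : ℂ) / q)

lemma int_succ_ediv (m : ℤ) {q : ℤ} (hq : 0 < q) :
    (m + 1) / q = m / q + if q ∣ m + 1 then 1 else 0 := by
  split_ifs with h
  · obtain ⟨k, hk⟩ := h
    have h1 : m / q = k - 1 := by
      rw [Int.ediv_eq_iff_of_pos hq]; constructor <;> nlinarith
    rw [h1, hk, Int.mul_ediv_cancel_left _ hq.ne']; ring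
  · have h1 := Int.emod_add_mul_ediv m q
    have h2 := Int.emod_lt_of_pos m hq
    have h3 := Int.emod_nonneg m hq.ne'
    have h4 : m % q + 1 ≠ q := fun h4 => h ⟨m / q + 1, by rw [mul_add]; linarith⟩
    rw [add_zero, Int.ediv_eq_iff_of_pos hq]
    have h5 : m % q + 1 < q := lt_of_le_of_ne h2 h4
    constructor <;> nlinarith

/-- Counting the integers `n ≤ N` by residue classes. -/
lemma sum_char_eq_sum_floor (χ : DirichletCharacter ℂ q) (N : ℕ) :
    ∑ n ∈ Finset.Icc 1 N, χ (n : ZMod q)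
      = ∑ a ∈ Finset.Icc 1 q, χ (a : ZMod q) * ((((N : ℤ) - a) / q + 1 : ℤ) : ℂ) := by
  have hq : 0 < q := NeZero.pos q
  induction N with
  | zero =>
    symm
    simp only [Finset.Icc_eq_empty_of_lt zero_lt_one, Finset.sum_empty]
    refine Finset.sum_eq_zero fun a ha => ?_
    rw [Finset.mem_Icc] at ha
    have : (((0 : ℕ) : ℤ) - a) / q = -1 := by
      rw [Int.ediv_eq_iff_of_pos (by omega)]; constructor <;> push_cast <;> nlinarith
    rw [this]; simp
  | succ N ih =>
    rw [Finset.sum_Icc_succ_top (by omega), ih]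
    have hstep (a : ℕ) : ((((N + 1 : ℕ) : ℤ) - a) / q : ℤ)
        = ((N : ℤ) - a) / q + if ((N + 1 : ℕ) : ZMod q) = a then 1 else 0 := by
      have hiff : ((N + 1 : ℕ) : ZMod q) = a ↔ (q : ℤ) ∣ (N + 1 : ℤ) - a := by
        rw [← ZMod.intCast_zmod_eq_zero_iff_dvd]
        push_cast
        rw [sub_eq_zero]
      rw [show (((N + 1 : ℕ) : ℤ) - a) = ((N : ℤ) - a) + 1 by push_cast; ring,
        int_succ_ediv _ (by exact_mod_cast hq)]
      simp only [hiff, show (N + 1 : ℤ) - a = (N : ℤ) - a + 1 by ring]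
    have hres : χ ((N + 1 : ℕ) : ZMod q) = ∑ a ∈ Finset.Icc 1 q,
        if ((N + 1 : ℕ) : ZMod q) = a then χ (a : ZMod q) else 0 := by
      rw [sum_Icc_natCast_zmod fun a : ZMod q => if ((N + 1 : ℕ) : ZMod q) = a then χ a else 0]
      simp
    rw [hres, ← Finset.sum_add_distrib]
    refine Finset.sum_congr rfl fun a _ => ?_
    rw [hstep]
    split_ifs <;> push_cast <;> ring

/-- The partial sums of `χ` in terms of the sawtooth sum; the linear term is present only for
`q = 1`. -/
lemma sum_char_eq_charSawtooth {χ : DirichletCharacter ℂ q} (hχ : χ.IsPrimitive) {u : ℝ}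
    (hu : 0 ≤ u) :
    ∑ n ∈ Finset.Icc 1 ⌊u⌋₊, χ (n : ZMod q)
      = (if q = 1 then (u : ℂ) else 0) + charMean χ - charSawtooth χ u := by
  have hqR : (q : ℝ) ≠ 0 := by exact_mod_cast NeZero.ne q
  have hlin : (if q = 1 then (u : ℂ) else 0) = ∑ a ∈ Finset.Icc 1 q, χ (a : ZMod q) * (u / q) := by
    rw [← Finset.sum_mul, sum_char_eq hχ]
    split_ifs with h <;> simp [h]
  rw [sum_char_eq_sum_floor, hlin, charMean, charSawtooth, ← Finset.sum_add_distrib,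
    ← Finset.sum_sub_distrib]
  refine Finset.sum_congr rfl fun a _ => ?_
  have hfl : ⌊(u - a) / q⌋ = ((⌊u⌋₊ : ℤ) - a) / q := by
    rw [Int.floor_div_natCast, Int.floor_sub_natCast, Int.natCast_floor_eq_floor hu]
  rw [sawtooth, hfl]
  push_cast
  ring

lemma card_mul_charMean {χ : DirichletCharacter ℂ q} (hχ : χ.IsPrimitive) (hq : q ≠ 1) :
    (q : ℂ) * charMean χ = ∑ N ∈ Finset.range q, ∑ n ∈ Finset.Icc 1 N, χ (n : ZMod q) := by
  have hqC : (q : ℂ) ≠ 0 := by exact_mod_cast NeZero.ne q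
  have hswap (Q : ℕ) : ∑ N ∈ Finset.range Q, ∑ n ∈ Finset.Icc 1 N, χ (n : ZMod q)
      = ∑ n ∈ Finset.Icc 1 Q, χ (n : ZMod q) * ((Q : ℂ) - n) := by
    induction Q with
    | zero => simp
    | succ Q ih =>
      rw [Finset.sum_range_succ, ih, Finset.sum_Icc_succ_top (by omega), sub_self, mul_zero,
        add_zero, ← Finset.sum_add_distrib]
      refine Finset.sum_congr rfl fun n _ => ?_
      push_cast; ring
  have h0 : ∑ a ∈ Finset.Icc 1 q, χ (a : ZMod q) = 0 := by rw [sum_char_eq hχ, if_neg hq]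
  have h1 : (q : ℂ) * charMean χ = ∑ n ∈ Finset.Icc 1 q, χ (n : ZMod q) * ((q : ℂ) - n)
      - q / 2 * ∑ n ∈ Finset.Icc 1 q, χ (n : ZMod q) := by
    rw [charMean, Finset.mul_sum, Finset.mul_sum, ← Finset.sum_sub_distrib]
    refine Finset.sum_congr rfl fun n _ => ?_
    field_simp; ring
  rw [hswap, h1, h0, mul_zero, sub_zero]

lemma abs_sawtooth_le (u : ℝ) : |sawtooth u| ≤ 1 / 2 := by
  have h1 := Int.floor_le u
  have h2 := Int.lt_floor_add_one u
  rw [sawtooth, abs_le]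
  constructor <;> linarith

/-- The sawtooth sum obeys the Pólya–Vinogradov bound. -/
lemma norm_charSawtooth_le {χ : DirichletCharacter ℂ q} (hχ : χ.IsPrimitive) {u : ℝ}
    (hu : 0 ≤ u) : ‖charSawtooth χ u‖ ≤ 2 * (Real.sqrt q * (1 + Real.log q)) := by
  by_cases hq : q = 1
  · subst hq
    have : charSawtooth χ u = sawtooth (u - 1) := by
      have h1 : χ ((1 : ℕ) : ZMod 1) = 1 := by rw [Nat.cast_one, map_one]
      rw [charSawtooth, Finset.Icc_self, Finset.sum_singleton, h1]; simp
    rw [this, Complex.norm_real, Real.norm_eq_abs]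
    have := abs_sawtooth_le (u - 1)
    norm_num; linarith
  · have hqR : (0 : ℝ) < q := by exact_mod_cast NeZero.pos q
    have h1 : ‖charMean χ‖ ≤ Real.sqrt q * (1 + Real.log q) := by
      have h2 : ‖(q : ℂ) * charMean χ‖ ≤ q * (Real.sqrt q * (1 + Real.log q)) := by
        rw [card_mul_charMean hχ hq]
        refine (norm_sum_le_of_le _ fun N _ => norm_sum_char_le hχ hq N).trans ?_
        simp
      rw [norm_mul, Complex.norm_natCast] at h2
      exact le_of_mul_le_mul_left h2 hqR
    have h3 := sum_char_eq_charSawtooth hχ hu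
    rw [if_neg hq, zero_add] at h3
    have h4 : charSawtooth χ u = charMean χ - ∑ n ∈ Finset.Icc 1 ⌊u⌋₊, χ (n : ZMod q) := by
      rw [h3]; ring
    rw [h4]
    refine (norm_sub_le _ _).trans ?_
    have := norm_sum_char_le hχ hq ⌊u⌋₊
    linarith

end PolyaVinogradov

/-! ### The improper integrals over `(x, ∞)` -/

lemma hasDerivAt_ofReal_cpow_of_pos (c : ℂ) {u : ℝ} (hu : 0 < u) :
    HasDerivAt (fun v : ℝ => (v : ℂ) ^ c) (c * (u : ℂ) ^ (c - 1)) u := by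
  have h := ((hasDerivAt_id (u : ℂ)).cpow_const (c := c)
    (Complex.ofReal_mem_slitPlane.2 hu)).comp_ofReal
  simpa using h

lemma continuousOn_ofReal_cpow (c : ℂ) : ContinuousOn (fun v : ℝ => (v : ℂ) ^ c) (Ioi 0) :=
  fun _ hu => (hasDerivAt_ofReal_cpow_of_pos c hu).continuousAt.continuousWithinAt

lemma hasDerivAt_e_mul (m u : ℝ) :
    HasDerivAt (fun v : ℝ => e (m * v)) (2 * Real.pi * Complex.I * m * e (m * u)) u := by
  have h : HasDerivAt (fun v : ℂ => Complex.exp (2 * Real.pi * Complex.I * m * v))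
      (Complex.exp (2 * Real.pi * Complex.I * m * u) * (2 * Real.pi * Complex.I * m)) (u : ℂ) := by
    simpa using ((hasDerivAt_id (u : ℂ)).const_mul (2 * Real.pi * Complex.I * m : ℂ)).cexp
  have h2 := h.comp_ofReal
  have h3 (v : ℝ) : e (m * v) = Complex.exp (2 * Real.pi * Complex.I * m * v) := by
    rw [e]; congr 1; push_cast; ring
  simp_rw [h3]
  convert h2 using 1; ring

lemma integrableOn_Ioi_mul_cpow {f : ℝ → ℂ} (hf : Continuous f) {C : ℝ} (hC : ∀ u, ‖f u‖ ≤ C)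
    {x : ℝ} (hx : 0 < x) {s : ℂ} (hs : -1 < s.re) :
    IntegrableOn (fun u : ℝ => f u * (u : ℂ) ^ (-s - 2)) (Ioi x) := by
  have h := integrableOn_Ioi_cpow_of_lt (a := -s - 2) (c := x) (by simp; linarith) hx
  exact h.bdd_mul hf.aestronglyMeasurable.restrict (ae_of_all _ hC)

/-- The truncated Mellin transform of a bounded function is holomorphic in `Re s > -1`. -/
lemma differentiableAt_integral_Ioi_mul_cpow {f : ℝ → ℂ} (hf : Continuous f) {C : ℝ}
    (hC : ∀ u, ‖f u‖ ≤ C) {x : ℝ} (hx : 0 < x) {s : ℂ} (hs : -1 < s.re) :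
    DifferentiableAt ℂ (fun s : ℂ => ∫ u in Ioi x, f u * (u : ℂ) ^ (-s - 2)) s := by
  set F : ℝ → ℂ := indicator (Ioi x) f with hF
  have heq (s : ℂ) : ∫ u in Ioi x, f u * (u : ℂ) ^ (-s - 2) = mellin F (-s - 1) := by
    rw [mellin]
    have : ∀ t : ℝ, (t : ℂ) ^ (-s - 1 - 1) • F t
        = indicator (Ioi x) (fun u : ℝ => f u * (u : ℂ) ^ (-s - 2)) t := by
      intro t
      by_cases ht : t ∈ Ioi x
      · rw [hF, indicator_of_mem ht, indicator_of_mem ht, smul_eq_mul, mul_comm]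
        congr 2; ring
      · rw [hF, indicator_of_notMem ht, indicator_of_notMem ht, smul_zero]
    simp_rw [this]
    rw [setIntegral_indicator measurableSet_Ioi, Ioi_inter_Ioi, sup_eq_right.2 hx.le]
  have hmel : DifferentiableAt ℂ (mellin F) (-s - 1) := by
    refine mellin_differentiableAt_of_isBigO_rpow (a := 0) (b := (-s - 1).re - 1) ?_ ?_
      (by simp; linarith) ?_ (by linarith)
    · exact (hf.locallyIntegrable.indicator measurableSet_Ioi).locallyIntegrableOn _
    · refine Asymptotics.IsBigO.of_bound C (Eventually.of_forall fun u => ?_)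
      rw [neg_zero, Real.rpow_zero, norm_one, mul_one]
      exact (norm_indicator_le_norm_self _ _).trans (hC u)
    · refine Asymptotics.IsBigO.of_bound 0 ?_
      filter_upwards [Ioo_mem_nhdsGT hx] with u hu
      rw [hF, indicator_of_notMem (by simpa using hu.2.le)]; simp
  simp_rw [heq]
  exact DifferentiableAt.comp s (f := fun s : ℂ => -s - 1) hmel (by fun_prop)

/-- The value of the improper integral `∫_x^∞ e(mu) / (q^s u^(s+1)) du` after one integration by
parts, which makes it absolutely convergent for `Re s > -1`. -/
noncomputable def tailClosed (q : ℕ) (m : ℤ) (x : ℝ) (s : ℂ) : ℂ :=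
  (q : ℂ) ^ (-s) * ((s + 1) / (2 * Real.pi * Complex.I * m)
      * (∫ u in Ioi x, e ((m : ℝ) * u) * (u : ℂ) ^ (-s - 2))
    - e ((m : ℝ) * x) * (x : ℂ) ^ (-s - 1) / (2 * Real.pi * Complex.I * m))

lemma continuous_e_mul (m : ℝ) : Continuous fun u : ℝ => e (m * u) :=
  continuous_e.comp (continuous_const.mul continuous_id)

lemma tailTrunc_eq_mul_integral {q : ℕ} (m : ℤ) {x R : ℝ} (hx : 0 < x) (hR : x ≤ R) (s : ℂ) :
    tailTrunc q m x s R
      = (q : ℂ) ^ (-s) * ∫ u in x..R, (u : ℂ) ^ (-s - 1) * e ((m : ℝ) * u) := by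
  rw [tailTrunc, ← intervalIntegral.integral_const_mul]
  refine intervalIntegral.integral_congr fun u hu => ?_
  rw [uIcc_of_le hR] at hu
  have : (u : ℂ) ≠ 0 := by exact_mod_cast (hx.trans_le hu.1).ne'
  rw [show -s - 1 = -(s + 1) by ring, Complex.cpow_neg, Complex.cpow_neg]
  rw [div_eq_mul_inv, mul_inv]; ring

lemma tailTrunc_eq {q : ℕ} {m : ℤ} (hm : m ≠ 0) {x R : ℝ} (hx : 0 < x) (hR : x ≤ R) (s : ℂ) :
    tailTrunc q m x s R = (q : ℂ) ^ (-s) * ((s + 1) / (2 * Real.pi * Complex.I * m)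
        * (∫ u in x..R, e ((m : ℝ) * u) * (u : ℂ) ^ (-s - 2))
      + (e ((m : ℝ) * R) * (R : ℂ) ^ (-s - 1) / (2 * Real.pi * Complex.I * m)
        - e ((m : ℝ) * x) * (x : ℂ) ^ (-s - 1) / (2 * Real.pi * Complex.I * m))) := by
  have hmC : (2 * Real.pi * Complex.I * m : ℂ) ≠ 0 := by
    have : (m : ℂ) ≠ 0 := by exact_mod_cast hm
    have := Real.pi_ne_zero
    simp [*]
  have hpos : ∀ u ∈ uIcc x R, 0 < u := fun u hu => by
    rw [uIcc_of_le hR] at hu; exact hx.trans_le hu.1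
  have hcont (c : ℂ) : ContinuousOn (fun v : ℝ => (v : ℂ) ^ c) (uIcc x R) :=
    (continuousOn_ofReal_cpow c).mono hpos
  have hparts := intervalIntegral.integral_mul_deriv_eq_deriv_mul (a := x) (b := R)
    (u := fun v : ℝ => (v : ℂ) ^ (-s - 1)) (u' := fun v : ℝ => (-s - 1) * (v : ℂ) ^ (-s - 1 - 1))
    (v := fun v : ℝ => e ((m : ℝ) * v) / (2 * Real.pi * Complex.I * m))
    (v' := fun v : ℝ => e ((m : ℝ) * v))
    (fun u hu => hasDerivAt_ofReal_cpow_of_pos _ (hpos u hu))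
    (fun u _ => by
      have := (hasDerivAt_e_mul m u).div_const (2 * Real.pi * Complex.I * m : ℂ)
      convert this using 1
      push_cast
      field_simp)
    ((continuousOn_const.mul (hcont _)).intervalIntegrable)
    ((continuous_e_mul m).intervalIntegrable _ _)
  have h2 : ∫ u in x..R, (-s - 1) * (u : ℂ) ^ (-s - 1 - 1)
        * (e ((m : ℝ) * u) / (2 * Real.pi * Complex.I * m))
      = -((s + 1) / (2 * Real.pi * Complex.I * m))
        * ∫ u in x..R, e ((m : ℝ) * u) * (u : ℂ) ^ (-s - 2) := by
    rw [← intervalIntegral.integral_const_mul]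
    refine intervalIntegral.integral_congr fun u _ => ?_
    rw [show -s - 1 - 1 = -s - 2 by ring]; ring
  rw [tailTrunc_eq_mul_integral m hx hR s, hparts, h2]
  ring

lemma tendsto_ofReal_cpow_atTop {c : ℂ} (hc : c.re < 0) :
    Tendsto (fun R : ℝ => (R : ℂ) ^ c) atTop (𝓝 0) := by
  rw [tendsto_zero_iff_norm_tendsto_zero]
  have h := tendsto_rpow_neg_atTop (y := -c.re) (by linarith)
  refine h.congr' ?_
  filter_upwards [eventually_gt_atTop 0] with R hR
  rw [Complex.norm_cpow_eq_rpow_re_of_pos hR, neg_neg]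

lemma tendsto_tailTrunc {q : ℕ} {m : ℤ} (hm : m ≠ 0) {x : ℝ} (hx : 0 < x) {s : ℂ}
    (hs : -1 < s.re) :
    Tendsto (tailTrunc q m x s) atTop (𝓝 (tailClosed q m x s)) := by
  have h1 : Tendsto (fun R : ℝ => ∫ u in x..R, e ((m : ℝ) * u) * (u : ℂ) ^ (-s - 2)) atTop
      (𝓝 (∫ u in Ioi x, e ((m : ℝ) * u) * (u : ℂ) ^ (-s - 2))) :=
    intervalIntegral_tendsto_integral_Ioi x
      (integrableOn_Ioi_mul_cpow (continuous_e_mul m) (fun u => (norm_e _).le) hx hs) tendsto_id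
  have h2 : Tendsto (fun R : ℝ => e ((m : ℝ) * R) * (R : ℂ) ^ (-s - 1)
      / (2 * Real.pi * Complex.I * m)) atTop (𝓝 0) := by
    have h3 : Tendsto (fun R : ℝ => e ((m : ℝ) * R) * (R : ℂ) ^ (-s - 1)) atTop (𝓝 0) := by
      rw [tendsto_zero_iff_norm_tendsto_zero]
      have := (tendsto_ofReal_cpow_atTop (c := -s - 1) (by simp; linarith)).norm
      simpa [norm_e] using this
    simpa using h3.div_const (2 * Real.pi * Complex.I * m : ℂ)
  have h4 := ((h1.const_mul ((s + 1) / (2 * Real.pi * Complex.I * m))).add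
    (h2.sub_const (e ((m : ℝ) * x) * (x : ℂ) ^ (-s - 1) / (2 * Real.pi * Complex.I * m)))).const_mul
      ((q : ℂ) ^ (-s))
  rw [zero_sub, ← sub_eq_add_neg] at h4
  refine h4.congr' ?_
  filter_upwards [eventually_ge_atTop x] with R hR
  rw [tailTrunc_eq hm hx hR]

lemma tailIntegral_eq {q : ℕ} {m : ℤ} (hm : m ≠ 0) {x : ℝ} (hx : 0 < x) {s : ℂ}
    (hs : -1 < s.re) : tailIntegral q m x s = tailClosed q m x s :=
  (tendsto_tailTrunc hm hx hs).limUnder_eq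

lemma differentiableAt_natCast_cpow_neg {q : ℕ} (hq : q ≠ 0) (s : ℂ) :
    DifferentiableAt ℂ (fun s : ℂ => (q : ℂ) ^ (-s)) s :=
  (differentiableAt_id.neg).const_cpow (Or.inl (by exact_mod_cast hq))

lemma continuousAt_tailClosed {q : ℕ} (hq : q ≠ 0) (m : ℤ) {x : ℝ} (hx : 0 < x) {s : ℂ}
    (hs : -1 < s.re) : ContinuousAt (tailClosed q m x) s := by
  have h1 := (differentiableAt_integral_Ioi_mul_cpow (continuous_e_mul m)
    (fun u => (norm_e _).le) hx hs).continuousAt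
  have h2 : ContinuousAt (fun s : ℂ => (x : ℂ) ^ (-s - 1)) s :=
    (DifferentiableAt.const_cpow (by fun_prop) (Or.inl (by exact_mod_cast hx.ne'))).continuousAt
  have h3 := (differentiableAt_natCast_cpow_neg hq s).continuousAt
  unfold tailClosed
  fun_prop

/-- `|∫_x^∞ e(mu) / (q^s u^(s+1)) du| ≪ 1 / |m|`, with an explicit constant depending on `s`. -/
lemma norm_tailClosed_le (q : ℕ) (m : ℤ) (x : ℝ) (s : ℂ) :
    ‖tailClosed q m x s‖ ≤ ‖(q : ℂ) ^ (-s)‖ * (‖s + 1‖ / (2 * Real.pi)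
      * (∫ u in Ioi x, ‖(u : ℂ) ^ (-s - 2)‖) + ‖(x : ℂ) ^ (-s - 1)‖ / (2 * Real.pi)) / |(m : ℝ)| := by
  have hn : ‖(2 * Real.pi * Complex.I * m : ℂ)‖ = 2 * Real.pi * |(m : ℝ)| := by
    simp [abs_of_pos Real.pi_pos]
  have h1 : ‖∫ u in Ioi x, e ((m : ℝ) * u) * (u : ℂ) ^ (-s - 2)‖
      ≤ ∫ u in Ioi x, ‖(u : ℂ) ^ (-s - 2)‖ := by
    refine (norm_integral_le_integral_norm _).trans_eq ?_
    simp [norm_e]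
  rw [tailClosed, norm_mul]
  refine (mul_le_mul_of_nonneg_left ?_ (norm_nonneg _)).trans_eq (mul_div_assoc _ _ _).symm
  refine (norm_sub_le _ _).trans ?_
  rw [norm_mul, norm_div, norm_div, hn, norm_mul (e _), norm_e, one_mul, add_div]
  refine add_le_add ?_ (le_of_eq (by rw [div_div]))
  rw [mul_div_right_comm, div_div]
  gcongr

/-! ### The Gamma integral with a complex parameter -/

lemma norm_cexp_neg_mul (r : ℂ) (u : ℝ) : ‖Complex.exp (-(r * u))‖ = Real.exp (-r.re * u) := by
  rw [Complex.norm_exp]; simp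

lemma continuousOn_cpow_mul_cexp (c r : ℂ) :
    ContinuousOn (fun u : ℝ => (u : ℂ) ^ c * Complex.exp (-(r * u))) (Ioi 0) :=
  (continuousOn_ofReal_cpow c).mul (by fun_prop)

lemma norm_cpow_mul_cexp (c r : ℂ) {u : ℝ} (hu : 0 < u) :
    ‖(u : ℂ) ^ c * Complex.exp (-(r * u))‖ = u ^ c.re * Real.exp (-r.re * u) := by
  rw [norm_mul, norm_cexp_neg_mul, Complex.norm_cpow_eq_rpow_re_of_pos hu]

lemma integrableOn_Ioi_zero_rpow_mul_exp {p b : ℝ} (hp : -1 < p) (hb : 0 < b) :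
    IntegrableOn (fun u : ℝ => u ^ p * Real.exp (-b * u)) (Ioi 0) := by
  simpa using integrableOn_rpow_mul_exp_neg_mul_rpow hp zero_lt_one hb

lemma integrableOn_Ioi_zero_cpow_mul_cexp {c r : ℂ} (hc : -1 < c.re) (hr : 0 < r.re) :
    IntegrableOn (fun u : ℝ => (u : ℂ) ^ c * Complex.exp (-(r * u))) (Ioi 0) := by
  refine Integrable.mono' (integrableOn_Ioi_zero_rpow_mul_exp hc hr)
    ((continuousOn_cpow_mul_cexp c r).aestronglyMeasurable measurableSet_Ioi) ?_
  filter_upwards [ae_restrict_mem measurableSet_Ioi] with u hu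
  exact (norm_cpow_mul_cexp c r hu).le

lemma hasDerivAt_integral_cpow_mul_cexp {c r : ℂ} (hc : -1 < c.re) (hr : 0 < r.re) :
    HasDerivAt (fun r : ℂ => ∫ u in Ioi (0 : ℝ), (u : ℂ) ^ c * Complex.exp (-(r * u)))
      (∫ u in Ioi (0 : ℝ), (u : ℂ) ^ c * (-u * Complex.exp (-(r * u)))) r := by
  have hball : {z : ℂ | r.re / 2 < z.re} ∈ 𝓝 r :=
    (isOpen_lt continuous_const Complex.continuous_re).mem_nhds (by simp; linarith)
  refine (hasDerivAt_integral_of_dominated_loc_of_deriv_le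
    (F' := fun (z : ℂ) (u : ℝ) => (u : ℂ) ^ c * (-u * Complex.exp (-(z * u))))
    (bound := fun u => u ^ (c.re + 1) * Real.exp (-(r.re / 2) * u)) hball
    (Eventually.of_forall fun z =>
      (continuousOn_cpow_mul_cexp c z).aestronglyMeasurable measurableSet_Ioi)
    (integrableOn_Ioi_zero_cpow_mul_cexp hc hr) ?_ ?_
    (integrableOn_Ioi_zero_rpow_mul_exp (by linarith) (by linarith)) ?_).2
  · exact ((continuousOn_ofReal_cpow c).mul (by fun_prop)).aestronglyMeasurable measurableSet_Ioi
  · filter_upwards [ae_restrict_mem measurableSet_Ioi] with u hu z hz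
    have hu : 0 < u := hu
    rw [norm_mul, norm_mul, norm_cexp_neg_mul, Complex.norm_cpow_eq_rpow_re_of_pos hu, norm_neg,
      Complex.norm_real, Real.norm_of_nonneg hu.le, Real.rpow_add_one hu.ne', ← mul_assoc]
    have hz : r.re / 2 < z.re := hz
    gcongr
  · refine ae_of_all _ fun u z _ => ?_
    have h := ((hasDerivAt_id z).mul_const (u : ℂ)).neg.cexp.const_mul ((u : ℂ) ^ c)
    refine h.congr_deriv ?_
    simp only [id, one_mul, Pi.neg_apply]
    ring

/-- The Gamma integral `∫_0^∞ u^(a-1) e^(-ru) du = r^(-a) Γ(a)` for complex `r` with `Re r > 0`,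
by analytic continuation from `r > 0`. -/
lemma integral_cpow_mul_cexp_eq_Gamma {a r : ℂ} (ha : 0 < a.re) (hr : 0 < r.re) :
    ∫ u in Ioi (0 : ℝ), (u : ℂ) ^ (a - 1) * Complex.exp (-(r * u))
      = r ^ (-a) * Complex.Gamma a := by
  set U : Set ℂ := {z | 0 < z.re} with hU
  have hUo : IsOpen U := isOpen_lt continuous_const Complex.continuous_re
  have h1 : AnalyticOnNhd ℂ
      (fun r : ℂ => ∫ u in Ioi (0 : ℝ), (u : ℂ) ^ (a - 1) * Complex.exp (-(r * u))) U :=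
    DifferentiableOn.analyticOnNhd (fun z hz =>
      (hasDerivAt_integral_cpow_mul_cexp (by simp; exact ha) hz).differentiableAt
        |>.differentiableWithinAt) hUo
  have h2 : AnalyticOnNhd ℂ (fun r : ℂ => r ^ (-a) * Complex.Gamma a) U :=
    DifferentiableOn.analyticOnNhd (fun z hz =>
      ((differentiableAt_id.cpow_const (Or.inl hz)).mul_const _).differentiableWithinAt) hUo
  refine h1.eqOn_of_preconnected_of_frequently_eq (z₀ := 1) h2
    (convex_halfSpace_re_gt 0).isPreconnected (by simp [hU]) ?_ hr
  have ht : Tendsto (fun n : ℕ => (1 + 1 / ((n : ℂ) + 1) : ℂ)) atTop (𝓝[≠] 1) := by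
    rw [tendsto_nhdsWithin_iff]
    refine ⟨?_, Eventually.of_forall fun n => ?_⟩
    · simpa using (tendsto_one_div_add_atTop_nhds_zero_nat (𝕜 := ℂ)).const_add 1
    · have : ((n : ℂ) + 1) ≠ 0 := by exact_mod_cast n.succ_ne_zero
      simp [this]
  refine ht.frequently (Frequently.of_forall fun n => ?_)
  set ρ : ℝ := 1 + 1 / ((n : ℝ) + 1) with hρ
  have hρ0 : 0 < ρ := by positivity
  have hc : (1 + 1 / ((n : ℂ) + 1) : ℂ) = (ρ : ℂ) := by rw [hρ]; push_cast; ring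
  rw [hc]
  have := Complex.integral_cpow_mul_exp_neg_mul_Ioi ha hρ0
  rw [this, one_div, Complex.inv_cpow _ _ (by
    rw [Complex.arg_ofReal_of_nonneg hρ0.le]; exact Real.pi_ne_zero.symm), Complex.cpow_neg]

/-! ### The integrals over `(0, x)` -/

lemma isLittleO_rpow_mul_exp (p : ℝ) {b : ℝ} (hb : 0 < b) :
    (fun u : ℝ => u ^ p * Real.exp (-b * u)) =o[atTop] fun u => Real.exp (-(b / 2) * u) := by
  have h := (isLittleO_rpow_exp_pos_mul_atTop p (half_pos hb)).mul_isBigO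
    (Asymptotics.isBigO_refl (fun u : ℝ => Real.exp (-b * u)) atTop)
  refine h.congr_right fun u => ?_
  rw [← Real.exp_add]; congr 1; ring

lemma integrableOn_Ioi_cpow_mul_cexp (c : ℂ) {r : ℂ} (hr : 0 < r.re) {x : ℝ} (hx : 0 < x) :
    IntegrableOn (fun u : ℝ => (u : ℂ) ^ c * Complex.exp (-(r * u))) (Ioi x) := by
  have hsub : Ioi x ⊆ Ioi 0 := Ioi_subset_Ioi hx.le
  refine Integrable.mono' (g := fun u => u ^ c.re * Real.exp (-r.re * u)) ?_
    (((continuousOn_cpow_mul_cexp c r).mono hsub).aestronglyMeasurable measurableSet_Ioi) ?_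
  · refine integrable_of_isBigO_exp_neg (half_pos hr) ?_ (isLittleO_rpow_mul_exp _ hr).isBigO
    exact fun u hu => ((Real.continuousAt_rpow_const _ _ (Or.inl (hx.trans_le hu).ne')).mul
      (by fun_prop)).continuousWithinAt
  · filter_upwards [ae_restrict_mem measurableSet_Ioi] with u hu
    exact (norm_cpow_mul_cexp c r (hsub hu)).le

lemma integral_Ioi_cpow_mul_cexp (c : ℂ) {r : ℂ} (hr : 0 < r.re) {x : ℝ} (hx : 0 < x) :
    ∫ u in Ioi x, (u : ℂ) ^ c * Complex.exp (-(r * u))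
      = (x : ℂ) ^ c * Complex.exp (-(r * x)) / r
        + c / r * ∫ u in Ioi x, (u : ℂ) ^ (c - 1) * Complex.exp (-(r * u)) := by
  have hr0 : r ≠ 0 := by rintro rfl; simp at hr
  have hderiv (u : ℝ) (hu : 0 < u) :
      HasDerivAt (fun u : ℝ => (u : ℂ) ^ c * Complex.exp (-(r * u)))
        (c * ((u : ℂ) ^ (c - 1) * Complex.exp (-(r * u)))
          - r * ((u : ℂ) ^ c * Complex.exp (-(r * u)))) u := by
    have h1 : HasDerivAt (fun v : ℝ => Complex.exp (-(r * v)))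
        (Complex.exp (-(r * u)) * -r) u := by
      simpa using ((hasDerivAt_id (u : ℂ)).const_mul r).neg.cexp.comp_ofReal
    exact ((hasDerivAt_ofReal_cpow_of_pos c hu).mul h1).congr_deriv (by ring)
  have hI1 := (integrableOn_Ioi_cpow_mul_cexp (c - 1) hr hx).const_mul c
  have hI2 := (integrableOn_Ioi_cpow_mul_cexp c hr hx).const_mul r
  have hlim : Tendsto (fun u : ℝ => (u : ℂ) ^ c * Complex.exp (-(r * u))) atTop (𝓝 0) := by
    rw [tendsto_zero_iff_norm_tendsto_zero]
    have h1 : Tendsto (fun u : ℝ => Real.exp (-(r.re / 2) * u)) atTop (𝓝 0) :=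
      Real.tendsto_exp_atBot.comp (tendsto_id.const_mul_atTop_of_neg (by linarith))
    refine ((isLittleO_rpow_mul_exp c.re hr).trans_tendsto h1).congr' ?_
    filter_upwards [eventually_gt_atTop 0] with u hu
    exact (norm_cpow_mul_cexp c r hu).symm
  have h := integral_Ioi_of_hasDerivAt_of_tendsto
    (hderiv x hx).continuousAt.continuousWithinAt (fun u hu => hderiv u (hx.trans hu))
    (hI1.sub hI2) hlim
  rw [integral_sub hI1 hI2, integral_const_mul, integral_const_mul] at h
  field_simp
  linear_combination -h

/-- The functional-equation integral split at `x`, with damping factor `e^(-ru)`, `Re r > 0`; the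
part over `(x, ∞)` is integrated by parts twice, so that it survives the limit `Re r → 0`. -/
lemma integral_split_damped {s r : ℂ} (hs1 : s.re < 1) (hr : 0 < r.re) {x : ℝ} (hx : 0 < x) :
    (∫ u in (0 : ℝ)..x, (u : ℂ) ^ (-s) * Complex.exp (-(r * u)))
      + ((x : ℂ) ^ (-s) * Complex.exp (-(r * x)) / r
        + -s / r * ((x : ℂ) ^ (-s - 1) * Complex.exp (-(r * x)) / r
          + (-s - 1) / r * ∫ u in Ioi x, (u : ℂ) ^ (-s - 2) * Complex.exp (-(r * u))))
      = r ^ (s - 1) * Complex.Gamma (1 - s) := by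
  have h0 := integral_cpow_mul_cexp_eq_Gamma (a := 1 - s) (r := r) (by simp; linarith) hr
  rw [show 1 - s - 1 = -s by ring, show -(1 - s) = s - 1 by ring] at h0
  have h1 := integral_Ioi_cpow_mul_cexp (-s) hr hx
  have h2 := integral_Ioi_cpow_mul_cexp (-s - 1) hr hx
  rw [show -s - 1 - 1 = -s - 2 by ring] at h2
  rw [← h2, ← h1, ← h0]
  exact intervalIntegral.integral_interval_add_Ioi
    (integrableOn_Ioi_zero_cpow_mul_cexp (by simp; linarith) hr)
    (integrableOn_Ioi_cpow_mul_cexp _ hr hx)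

/-- The preceding identity in the limit `r → -2πiν`. -/
lemma integral_split {s : ℂ} (hs0 : -1 < s.re) (hs1 : s.re < 1) {x : ℝ} (hx : 0 < x) {ν : ℝ}
    (hν : 0 < ν) {r : ℂ} (hr : r = -(2 * Real.pi * Complex.I * ν)) :
    (∫ u in (0 : ℝ)..x, (u : ℂ) ^ (-s) * e (ν * u))
      + ((x : ℂ) ^ (-s) * e (ν * x) / r
        + -s / r * ((x : ℂ) ^ (-s - 1) * e (ν * x) / r
          + (-s - 1) / r * ∫ u in Ioi x, (u : ℂ) ^ (-s - 2) * e (ν * u)))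
      = r ^ (s - 1) * Complex.Gamma (1 - s) := by
  have he (u : ℝ) : e (ν * u) = Complex.exp (-(r * u)) := by
    rw [e, hr]; congr 1; push_cast; ring
  have hνpi : 0 < 2 * Real.pi * ν := by positivity
  have hrim : r.im = -(2 * Real.pi * ν) := by simp [hr]
  have hrre : r.re = 0 := by simp [hr]
  have hr0 : r ≠ 0 := fun h => by rw [h] at hrim; simp at hrim; linarith [hrim, hνpi, Real.pi_pos]
  simp_rw [he]
  have hρ : Tendsto (fun ε : ℝ => r + ε) (𝓝[>] 0) (𝓝 r) := by
    have : Continuous fun ε : ℝ => r + ε := by fun_prop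
    simpa using (this.tendsto 0).mono_left nhdsWithin_le_nhds
  have hre (ε : ℝ) : (r + ε).re = ε := by simp [hrre]
  have hle {ε u : ℝ} (hε : 0 < ε) (hu : 0 < u) (c : ℂ) :
      ‖(u : ℂ) ^ c * Complex.exp (-((r + ε) * u))‖ ≤ u ^ c.re := by
    rw [norm_cpow_mul_cexp _ _ hu, hre]
    have : Real.exp (-ε * u) ≤ 1 := Real.exp_le_one_iff.2 (by nlinarith)
    have := Real.rpow_nonneg hu.le c.re
    nlinarith
  have hpt (c : ℂ) (u : ℝ) : Tendsto (fun ε : ℝ => (u : ℂ) ^ c * Complex.exp (-((r + ε) * u)))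
      (𝓝[>] 0) (𝓝 ((u : ℂ) ^ c * Complex.exp (-(r * u)))) :=
    (((hρ.mul_const (u : ℂ)).neg).cexp).const_mul _
  have hA : Tendsto (fun ε : ℝ => ∫ u in (0 : ℝ)..x, (u : ℂ) ^ (-s) * Complex.exp (-((r + ε) * u)))
      (𝓝[>] 0) (𝓝 (∫ u in (0 : ℝ)..x, (u : ℂ) ^ (-s) * Complex.exp (-(r * u)))) := by
    refine intervalIntegral.tendsto_integral_filter_of_dominated_convergence
      (fun u => u ^ (-s).re) ?_ ?_ (intervalIntegral.intervalIntegrable_rpow' (by simp; linarith)) ?_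
    · refine Eventually.of_forall fun ε => ?_
      rw [uIoc_of_le hx.le]
      exact ((continuousOn_cpow_mul_cexp _ _).mono Ioc_subset_Ioi_self).aestronglyMeasurable
        measurableSet_Ioc
    · filter_upwards [self_mem_nhdsWithin] with ε hε
      refine ae_of_all _ fun u hu => ?_
      rw [uIoc_of_le hx.le] at hu
      exact hle hε hu.1 _
    · exact ae_of_all _ fun u _ => hpt _ u
  have hB : Tendsto (fun ε : ℝ => ∫ u in Ioi x, (u : ℂ) ^ (-s - 2) * Complex.exp (-((r + ε) * u)))
      (𝓝[>] 0) (𝓝 (∫ u in Ioi x, (u : ℂ) ^ (-s - 2) * Complex.exp (-(r * u)))) := by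
    refine tendsto_integral_filter_of_dominated_convergence
      (fun u => u ^ (-s - 2).re) ?_ ?_ (integrableOn_Ioi_rpow_of_lt (by simp; linarith) hx) ?_
    · exact Eventually.of_forall fun ε => ((continuousOn_cpow_mul_cexp _ _).mono
        (Ioi_subset_Ioi hx.le)).aestronglyMeasurable measurableSet_Ioi
    · filter_upwards [self_mem_nhdsWithin] with ε hε
      filter_upwards [ae_restrict_mem measurableSet_Ioi] with u hu
      exact hle hε (hx.trans hu) _
    · exact ae_of_all _ fun u => hpt _ u
  have hR : Tendsto (fun ε : ℝ => (r + ε) ^ (s - 1) * Complex.Gamma (1 - s)) (𝓝[>] 0)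
      (𝓝 (r ^ (s - 1) * Complex.Gamma (1 - s))) := by
    have : ContinuousAt (fun z : ℂ => z ^ (s - 1)) r :=
      (differentiableAt_id.cpow_const (Or.inr (by simp [hrim]; positivity))).continuousAt
    exact (this.tendsto.comp hρ).mul_const _
  refine tendsto_nhds_unique ?_ hR
  have hL := hA.add ((((hpt (-s) x).div hρ hr0)).add
    (((tendsto_const_nhds (x := -s)).div hρ hr0).mul (((hpt (-s - 1) x).div hρ hr0).add
      (((tendsto_const_nhds (x := -s - 1)).div hρ hr0).mul hB))))
  refine hL.congr' ?_
  filter_upwards [self_mem_nhdsWithin] with ε hε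
  exact integral_split_damped hs1 (by rw [hre]; exact hε) hx

/-- The closed form of `∫_0^x e(νu) / (qu)^s du`, in which the integral over `(x, ∞)` has been
integrated by parts; it makes sense, and is continuous, also on the line `Re s = 1`. -/
noncomputable def headClosed (q ν : ℕ) (x : ℝ) (s : ℂ) : ℂ :=
  ((q * x : ℝ) : ℂ) ^ (-s) * e (ν * x) / (2 * Real.pi * Complex.I * ν)
    + Complex.I * (q : ℂ) ^ (-s) * (2 * Real.pi * ν) ^ (s - 1) * Complex.Gamma (1 - s)
      * Complex.exp (-(Real.pi * Complex.I * s / 2))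
    - s / (2 * Real.pi * Complex.I * ν) * tailClosed q ν x s

lemma headIntegrand_eq (q ν : ℕ) (s : ℂ) {u : ℝ} (hu : 0 ≤ u) :
    headIntegrand q ν s u = (q : ℂ) ^ (-s) * ((u : ℂ) ^ (-s) * e (ν * u)) := by
  have := Complex.mul_cpow_ofReal_nonneg (Nat.cast_nonneg q) hu s
  rw [Complex.ofReal_natCast] at this
  rw [headIntegrand, this, Complex.cpow_neg, Complex.cpow_neg, div_eq_mul_inv, mul_inv]
  ring

lemma neg_I_mul_cpow {w : ℝ} (hw : 0 < w) (s : ℂ) :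
    (-(w * Complex.I)) ^ (s - 1)
      = Complex.I * (w : ℂ) ^ (s - 1) * Complex.exp (-(Real.pi * Complex.I * s / 2)) := by
  have hw0 : (w : ℂ) ≠ 0 := by exact_mod_cast hw.ne'
  have hI : Complex.exp (Real.pi / 2 * Complex.I) = Complex.I := Complex.exp_pi_div_two_mul_I
  rw [show -(w * Complex.I) = (w : ℂ) * (-Complex.I) by ring,
    Complex.cpow_def_of_ne_zero (mul_ne_zero hw0 (neg_ne_zero.2 Complex.I_ne_zero)),
    Complex.log_ofReal_mul hw (neg_ne_zero.2 Complex.I_ne_zero), Complex.log_neg_I,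
    Complex.cpow_def_of_ne_zero hw0, ← Complex.ofReal_log hw.le]
  conv_rhs => rw [mul_assoc]; lhs; rw [← hI]
  rw [← Complex.exp_add, ← Complex.exp_add]
  congr 1
  ring

lemma intervalIntegrable_headIntegrand (q ν : ℕ) {x : ℝ} (hx : 0 < x) {s : ℂ} (hs : s.re < 1) :
    IntervalIntegrable (headIntegrand q ν s) volume 0 x := by
  have h := (((intervalIntegral.intervalIntegrable_cpow' (a := 0) (b := x) (r := -s)
    (by simp; linarith)).mul_continuousOn (continuous_e_mul ν).continuousOn).const_mul
      ((q : ℂ) ^ (-s)))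
  refine h.congr fun u hu => ?_
  rw [uIoc_of_le hx.le] at hu
  exact (headIntegrand_eq q ν s hu.1.le).symm

lemma integral_headIntegrand {q ν : ℕ} (hν : 1 ≤ ν) {x : ℝ} (hx : 0 < x)
    {s : ℂ} (hs0 : -1 < s.re) (hs1 : s.re < 1) :
    ∫ u in (0 : ℝ)..x, headIntegrand q ν s u = headClosed q ν x s := by
  have hνR : (0 : ℝ) < ν := by exact_mod_cast hν
  have h1 : ∫ u in (0 : ℝ)..x, headIntegrand q ν s u
      = (q : ℂ) ^ (-s) * ∫ u in (0 : ℝ)..x, (u : ℂ) ^ (-s) * e (ν * u) := by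
    rw [← intervalIntegral.integral_const_mul]
    refine intervalIntegral.integral_congr fun u hu => ?_
    rw [uIcc_of_le hx.le] at hu
    exact headIntegrand_eq q ν s hu.1
  have h2 := integral_split hs0 hs1 hx hνR rfl
  have h3 : (-(2 * Real.pi * Complex.I * (ν : ℝ)) : ℂ) ^ (s - 1) = _ :=
    (by rw [show (-(2 * Real.pi * Complex.I * (ν : ℝ)) : ℂ)
          = -(((2 * Real.pi * ν : ℝ) : ℂ) * Complex.I) by push_cast; ring] : _ = _).trans
      (neg_I_mul_cpow (w := 2 * Real.pi * ν) (by positivity) s)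
  rw [h3] at h2
  have hqx : ((q * x : ℝ) : ℂ) ^ (-s) = (q : ℂ) ^ (-s) * (x : ℂ) ^ (-s) := by
    have := Complex.mul_cpow_ofReal_nonneg (Nat.cast_nonneg q) hx.le (-s)
    rw [Complex.ofReal_natCast] at this
    rw [← this]; push_cast; rfl
  have hcomm : ∫ u in Ioi x, e (((ν : ℤ) : ℝ) * u) * (u : ℂ) ^ (-s - 2)
      = ∫ u in Ioi x, (u : ℂ) ^ (-s - 2) * e (ν * u) := by
    congr 1; funext u; rw [mul_comm, Int.cast_natCast]
  rw [h1, headClosed, hqx, tailClosed, hcomm]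
  push_cast at h2 ⊢
  have hνC : (ν : ℂ) ≠ 0 := by exact_mod_cast hνR.ne'
  have hpi : (Real.pi : ℂ) ≠ 0 := by exact_mod_cast Real.pi_ne_zero
  linear_combination (q : ℂ) ^ (-s) * h2

lemma continuousAt_headClosed {q ν : ℕ} (hq : q ≠ 0) (hν : 1 ≤ ν) {x : ℝ} (hx : 0 < x) {s : ℂ}
    (hs : -1 < s.re) (him : s.im ≠ 0) : ContinuousAt (headClosed q ν x) s := by
  have h1 : ContinuousAt (fun s : ℂ => ((q * x : ℝ) : ℂ) ^ (-s)) s :=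
    (DifferentiableAt.const_cpow (by fun_prop) (Or.inl (by
      have : (q : ℝ) * x ≠ 0 := by positivity
      exact_mod_cast this))).continuousAt
  have h2 : ContinuousAt (fun s : ℂ => (2 * Real.pi * ν : ℂ) ^ (s - 1)) s :=
    (DifferentiableAt.const_cpow (by fun_prop) (Or.inl (by
      have : (2 * Real.pi * ν : ℝ) ≠ 0 := by positivity
      exact_mod_cast this))).continuousAt
  have h3 := (differentiableAt_natCast_cpow_neg hq s).continuousAt
  have h4 : ContinuousAt (fun s : ℂ => Complex.Gamma (1 - s)) s := by
    refine ContinuousAt.comp (g := Complex.Gamma) (f := fun s : ℂ => 1 - s)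
      (Complex.differentiableAt_Gamma _ fun m hm => him ?_).continuousAt (by fun_prop)
    simpa using congrArg Complex.im hm
  have h5 := continuousAt_tailClosed hq ν hx hs
  unfold headClosed
  fun_prop

/-- The regularized head integrals converge, as `δ → 0+`, to the closed form. -/
lemma tendsto_integral_headIntegrand {q ν : ℕ} (hq : q ≠ 0) (hν : 1 ≤ ν) {x : ℝ} (hx : 0 < x)
    {s : ℂ} (hs0 : 0 ≤ s.re) (hs1 : s.re ≤ 1) (him : s.im ≠ 0) :
    Tendsto (fun δ : ℝ => ∫ u in (0 : ℝ)..x, headIntegrand q ν (s - (δ : ℂ)) u) (𝓝[>] 0)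
      (𝓝 (headClosed q ν x s)) := by
  have h1 := continuousAt_headClosed hq hν hx (show -1 < s.re by linarith) him
  have h2 : Tendsto (fun δ : ℝ => s - (δ : ℂ)) (𝓝[>] 0) (𝓝 s) := by
    have : Continuous fun δ : ℝ => s - (δ : ℂ) := by fun_prop
    simpa using (this.tendsto 0).mono_left nhdsWithin_le_nhds
  refine (h1.tendsto.comp h2).congr' ?_
  filter_upwards [Ioo_mem_nhdsGT zero_lt_one] with δ hδ
  refine (integral_headIntegrand hν hx ?_ ?_).symm
  · simp; linarith [hδ.2]
  · simp; linarith [hδ.1]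

lemma headIntegral_eq {q ν : ℕ} (hq : q ≠ 0) (hν : 1 ≤ ν) {x : ℝ} (hx : 0 < x)
    {s : ℂ} (hs0 : 0 ≤ s.re) (hs1 : s.re ≤ 1) (him : s.im ≠ 0) :
    headIntegral q ν x s = headClosed q ν x s := by
  rw [headIntegral]
  split_ifs with h
  · exact integral_headIntegrand hν hx (by linarith) h
  · exact (tendsto_integral_headIntegrand hq hν hx hs0 hs1 him).limUnder_eq

/-! ### The periodic Bernoulli kernel -/

/-- The periodic function `-B₂({v})/2`, an antiderivative of `-ψ`. -/
noncomputable def kernel (v : ℝ) : ℝ := -(Int.fract v ^ 2 - Int.fract v + 1 / 6) / 2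

lemma continuous_kernel : Continuous kernel := by
  have h : ContinuousOn (fun v : ℝ => -(v ^ 2 - v + 1 / 6) / 2) (Icc 0 1) := by fun_prop
  exact h.comp_fract'' (by norm_num)

lemma abs_kernel_le (v : ℝ) : |kernel v| ≤ 1 := by
  have h0 := Int.fract_nonneg v
  have h1 := (Int.fract_lt_one v).le
  rw [kernel, abs_le]
  constructor <;> nlinarith

/-- The kernel has right derivative `-ψ` everywhere, including the integers. -/
lemma hasDerivWithinAt_kernel (v : ℝ) : HasDerivWithinAt kernel (-sawtooth v) (Ioi v) v := by
  have h : HasDerivAt (fun u : ℝ => -((u - ⌊v⌋) ^ 2 - (u - ⌊v⌋) + 1 / 6) / 2) (-sawtooth v) v := by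
    have h1 := (hasDerivAt_id v).sub_const (⌊v⌋ : ℝ)
    have h2 := ((((h1.pow 2).sub h1).add_const (1 / 6 : ℝ)).neg).div_const 2
    refine h2.congr_deriv ?_
    simp [sawtooth]; ring
  refine (h.hasDerivWithinAt (s := Ioi v)).congr_of_eventuallyEq ?_ rfl
  filter_upwards [Ioo_mem_nhdsGT (Int.lt_floor_add_one v)] with u hu
  have hfl : ⌊u⌋ = ⌊v⌋ := Int.floor_eq_iff.2 ⟨(Int.floor_le v).trans hu.1.le, hu.2⟩
  rw [kernel, Int.fract, hfl]

lemma e_int (k : ℤ) : e k = 1 := by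
  rw [e, Complex.exp_eq_one_iff]
  exact ⟨k, by push_cast; ring⟩

lemma e_mul_fract (n : ℤ) (v : ℝ) : e (n * Int.fract v) = e (n * v) := by
  have h : (n : ℝ) * v = n * Int.fract v + ((n * ⌊v⌋ : ℤ) : ℝ) := by
    conv_lhs => rw [← Int.fract_add_floor v]
    push_cast; ring
  rw [h, e_add, e_int, mul_one]

/-- The Fourier series of the kernel. The term `n = 0` vanishes, being divided by zero. -/
lemma hasSum_kernel (v : ℝ) :
    HasSum (fun n : ℕ => (e ((n : ℤ) * v) + e ((-n : ℤ) * v)) / (2 * Real.pi * Complex.I * n) ^ 2)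
      (kernel v : ℂ) := by
  have h := (hasSum_one_div_nat_pow_mul_fourier (k := 2) le_rfl
    ⟨Int.fract_nonneg v, (Int.fract_lt_one v).le⟩).mul_left ((1 : ℂ) / (2 * Real.pi * Complex.I) ^ 2)
  have hpi : (2 * Real.pi * Complex.I : ℂ) ≠ 0 := by simp [Real.pi_ne_zero]
  have hf (n : ℤ) : (fourier n ((Int.fract v : ℝ) : UnitAddCircle) : ℂ) = e (n * v) := by
    rw [← e_mul_fract, fourier_coe_apply, e]; congr 1; push_cast; ring
  convert! h using 1
  · funext n
    rw [hf, hf]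
    push_cast
    rcases eq_or_ne n 0 with rfl | hn
    · simp
    · have : (n : ℂ) ≠ 0 := by exact_mod_cast hn
      field_simp
  · rw [bernoulliFun_two, kernel]
    push_cast
    simp only [Nat.factorial]
    field_simp
    push_cast; ring

section CharKernel

variable {q : ℕ}

/-- The kernel averaged against a character; `q * charKernel χ (u / q)` is an antiderivative of
`-charSawtooth χ u`. -/
noncomputable def charKernel (χ : DirichletCharacter ℂ q) (v : ℝ) : ℂ :=
  ∑ a ∈ Finset.Icc 1 q, χ (a : ZMod q) * (kernel (v - (a : ℝ) / q) : ℂ)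

lemma continuous_charKernel (χ : DirichletCharacter ℂ q) : Continuous (charKernel χ) := by
  unfold charKernel
  have := continuous_kernel
  fun_prop

lemma norm_charKernel_le (χ : DirichletCharacter ℂ q) (v : ℝ) : ‖charKernel χ v‖ ≤ q := by
  refine (norm_sum_le_of_le (f := fun a : ℕ => χ (a : ZMod q) * (kernel (v - (a : ℝ) / q) : ℂ))
    (n := fun _ => 1) _ fun a _ => ?_).trans (by simp)
  rw [norm_mul, Complex.norm_real, Real.norm_eq_abs]
  exact mul_le_one₀ (χ.norm_le_one _) (abs_nonneg _) (abs_kernel_le _)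

lemma hasDerivWithinAt_charKernel [NeZero q] (χ : DirichletCharacter ℂ q) (u : ℝ) :
    HasDerivWithinAt (fun u : ℝ => q * charKernel χ (u / q)) (-charSawtooth χ u) (Ioi u) u := by
  have hq : (0 : ℝ) < q := by exact_mod_cast NeZero.pos q
  have hqC : (q : ℂ) ≠ 0 := by exact_mod_cast NeZero.ne q
  have h1 (a : ℕ) : HasDerivWithinAt (fun u : ℝ => kernel (u / q - (a : ℝ) / q))
      (-sawtooth (u / q - (a : ℝ) / q) * (1 / q)) (Ioi u) u := by
    have hin : HasDerivWithinAt (fun u : ℝ => u / q - (a : ℝ) / q) (1 / q) (Ioi u) u :=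
      (((hasDerivAt_id u).div_const (q : ℝ)).sub_const _).hasDerivWithinAt
    refine (hasDerivWithinAt_kernel _).comp u hin fun w hw => ?_
    have hw : u < w := hw
    simp only [mem_Ioi]
    gcongr
  have h2 : HasDerivWithinAt (fun u : ℝ => q * charKernel χ (u / q))
      (q * ∑ a ∈ Finset.Icc 1 q, χ (a : ZMod q)
        * ((-sawtooth (u / q - (a : ℝ) / q) * (1 / q) : ℝ) : ℂ)) (Ioi u) u :=
    (HasDerivWithinAt.fun_sum fun a _ => ((h1 a).ofReal_comp).const_mul _).const_mul _
  refine h2.congr_deriv ?_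
  rw [charSawtooth, Finset.mul_sum, ← Finset.sum_neg_distrib]
  refine Finset.sum_congr rfl fun a _ => ?_
  rw [sub_div]
  push_cast
  field_simp

/-- The Fourier series of the averaged kernel, by the evaluation of twisted Gauss sums. -/
lemma hasSum_charKernel [NeZero q] {χ : DirichletCharacter ℂ q} (hχ : χ.IsPrimitive) (v : ℝ) :
    HasSum (fun n : ℕ => tau χ * ((starRingEnd ℂ) (χ (-(n : ZMod q))) * e ((n : ℤ) * v)
        + (starRingEnd ℂ) (χ (n : ZMod q)) * e ((-n : ℤ) * v)) / (2 * Real.pi * Complex.I * n) ^ 2)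
      (charKernel χ v) := by
  have h := hasSum_sum (s := Finset.Icc 1 q) fun a _ =>
    (hasSum_kernel (v - (a : ℝ) / q)).mul_left (χ (a : ZMod q))
  convert! h using 1
  funext n
  have h1 := sum_char_mul_e_sub hχ n v
  have h2 := sum_char_mul_e_sub hχ (-n) v
  simp only [Int.cast_neg, Int.cast_natCast, neg_neg] at h1 h2 ⊢
  simp only [mul_div_assoc', mul_add, ← Finset.sum_div, Finset.sum_add_distrib]
  rw [h1, h2]
  ring

end CharKernel

lemma norm_charSawtooth_le_card {q : ℕ} (χ : DirichletCharacter ℂ q) (u : ℝ) : ‖charSawtooth χ u‖ ≤ q := by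
  refine (norm_sum_le_of_le (f := fun a : ℕ => χ (a : ZMod q) * (sawtooth ((u - a) / q) : ℂ))
    (n := fun _ => 1) _ fun a _ => ?_).trans (by simp)
  rw [norm_mul, Complex.norm_real, Real.norm_eq_abs]
  exact mul_le_one₀ (χ.norm_le_one _) (abs_nonneg _) ((abs_sawtooth_le _).trans (by norm_num))

/-! ### The approximate formula for `L(s, χ)` by Euler–Maclaurin summation -/

section Formula

variable {q : ℕ}

/-- The boundary term in the Euler–Maclaurin formula for `∑ χ(n) n^(-s)`. -/
noncomputable def boundary (χ : DirichletCharacter ℂ q) (s : ℂ) (u : ℝ) : ℂ :=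
  (if q = 1 then (u : ℂ) ^ (1 - s) / (1 - s) else 0) - charSawtooth χ u * (u : ℂ) ^ (-s)
    + s * ((u : ℂ) ^ (-s - 1) * (q * charKernel χ (u / q)))

/-- Euler–Maclaurin summation over a finite range, to second order. -/
lemma sum_Ioc_char_cpow [NeZero q] {χ : DirichletCharacter ℂ q} (hχ : χ.IsPrimitive) {s : ℂ}
    (hs : s ≠ 1) {X R : ℝ} (hX : 0 < X) (hR : X ≤ R) :
    ∑ n ∈ Finset.Ioc ⌊X⌋₊ ⌊R⌋₊, χ (n : ZMod q) * (n : ℂ) ^ (-s)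
      = boundary χ s R - boundary χ s X
        + s * (s + 1) * ∫ u in X..R, q * charKernel χ (u / q) * (u : ℂ) ^ (-s - 2) := by
  have hq : (0 : ℝ) < q := by exact_mod_cast NeZero.pos q
  set c : ℕ → ℂ := fun n => if n = 0 then 0 else χ (n : ZMod q) with hc
  have hcsum (N : ℕ) : ∑ k ∈ Finset.Icc 0 N, c k = ∑ k ∈ Finset.Icc 1 N, χ (k : ZMod q) := by
    rw [← Finset.add_sum_Ioc_eq_sum_Icc (Nat.zero_le N)]
    simp only [hc, if_true, zero_add]
    refine Finset.sum_congr rfl fun k hk => ?_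
    rw [if_neg (by rw [Finset.mem_Icc] at hk; omega)]
  have hpos {t : ℝ} (ht : t ∈ Icc X R) : 0 < t := hX.trans_le ht.1
  have hderiv {t : ℝ} (ht : 0 < t) : deriv (fun t : ℝ => (t : ℂ) ^ (-s)) t
      = -s * (t : ℂ) ^ (-s - 1) := (hasDerivAt_ofReal_cpow_of_pos _ ht).deriv
  have hcontpow (c : ℂ) : ContinuousOn (fun t : ℝ => (t : ℂ) ^ c) (Icc X R) :=
    (continuousOn_ofReal_cpow c).mono fun t ht => hpos ht
  have hint : IntegrableOn (fun t : ℝ => -s * (t : ℂ) ^ (-s - 1)) (Icc X R) :=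
    (continuousOn_const.mul (hcontpow _)).integrableOn_Icc
  have habel := sum_mul_eq_sub_sub_integral_mul c (f := fun t : ℝ => (t : ℂ) ^ (-s)) hX.le hR
    (fun t ht => (hasDerivAt_ofReal_cpow_of_pos _ (hpos ht)).differentiableAt)
    (hint.congr_fun (fun t ht => (hderiv (hpos ht)).symm) measurableSet_Icc)
  have hsum : ∑ n ∈ Finset.Ioc ⌊X⌋₊ ⌊R⌋₊, χ (n : ZMod q) * (n : ℂ) ^ (-s)
      = ∑ k ∈ Finset.Ioc ⌊X⌋₊ ⌊R⌋₊, (((k : ℝ)) : ℂ) ^ (-s) * c k := by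
    refine Finset.sum_congr rfl fun k hk => ?_
    rw [hc]
    simp only
    rw [if_neg (by rw [Finset.mem_Ioc] at hk; omega), mul_comm, Complex.ofReal_natCast]
  set S : ℝ → ℂ := fun t => ∑ k ∈ Finset.Icc 0 ⌊t⌋₊, c k with hS
  have hSeq {t : ℝ} (ht : 0 ≤ t) :
      S t = (if q = 1 then (t : ℂ) else 0) + charMean χ - charSawtooth χ t := by
    rw [hS]; simp only; rw [hcsum, sum_char_eq_charSawtooth hχ ht]
  have hIabel : ∫ t in Ioc X R, deriv (fun t : ℝ => (t : ℂ) ^ (-s)) t * S t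
      = ∫ t in X..R, -s * (t : ℂ) ^ (-s - 1) * S t := by
    rw [intervalIntegral.integral_of_le hR]
    refine setIntegral_congr_fun measurableSet_Ioc fun t ht => ?_
    rw [hderiv (hX.trans ht.1)]
  have hKcont : ContinuousOn (fun u : ℝ => q * charKernel χ (u / q) * (u : ℂ) ^ (-s - 2))
      (uIcc X R) := by
    rw [uIcc_of_le hR]
    exact (continuous_const.mul ((continuous_charKernel χ).comp
      (continuous_id.div_const _))).continuousOn.mul (hcontpow _)
  have hSint : IntervalIntegrable (fun t : ℝ => -s * (t : ℂ) ^ (-s - 1) * S t) volume X R := by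
    rw [intervalIntegrable_iff_integrableOn_Icc_of_le hR]
    exact integrableOn_mul_sum_Icc c hX.le hint
  -- the right derivative of this function is the difference of the two integrands
  set G : ℝ → ℂ := fun u => (if q = 1 then s * ((u : ℂ) ^ (1 - s) / (1 - s)) else 0)
    - charMean χ * (u : ℂ) ^ (-s) + s * ((u : ℂ) ^ (-s - 1) * (q * charKernel χ (u / q))) with hG
  have hftc : ∫ u in X..R, (-(-s * (u : ℂ) ^ (-s - 1) * S u)
        - s * (s + 1) * (q * charKernel χ (u / q) * (u : ℂ) ^ (-s - 2))) = G R - G X := by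
    refine intervalIntegral.integral_eq_sub_of_hasDeriv_right ?_ ?_
      (hSint.neg.sub (hKcont.intervalIntegrable.const_mul _))
    · rw [uIcc_of_le hR, hG]
      refine ((?_ : ContinuousOn _ _).sub (continuousOn_const.mul (hcontpow _))).add
        (continuousOn_const.mul ((hcontpow _).mul (continuous_const.mul
          ((continuous_charKernel χ).comp (continuous_id.div_const _))).continuousOn))
      split_ifs
      · exact continuousOn_const.mul ((hcontpow _).div_const _)
      · exact continuousOn_const
    · intro u hu
      rw [min_eq_left hR, max_eq_right hR] at hu
      have hu0 : 0 < u := hX.trans hu.1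
      have huC : (u : ℂ) ≠ 0 := by exact_mod_cast hu0.ne'
      have h1s : (1 - s) ≠ 0 := sub_ne_zero.2 hs.symm
      have d1 : HasDerivWithinAt (fun u : ℝ => if q = 1 then s * ((u : ℂ) ^ (1 - s) / (1 - s)) else 0)
          (if q = 1 then s * (u : ℂ) ^ (-s) else 0) (Ioi u) u := by
        split_ifs
        · have := (((hasDerivAt_ofReal_cpow_of_pos (1 - s) hu0).div_const (1 - s)).const_mul
            s).hasDerivWithinAt (s := Ioi u)
          refine this.congr_deriv ?_
          rw [show 1 - s - 1 = -s by ring]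
          field_simp
        · exact hasDerivWithinAt_const _ _ _
      have d2 := ((hasDerivAt_ofReal_cpow_of_pos (-s) hu0).const_mul
        (charMean χ)).hasDerivWithinAt (s := Ioi u)
      have d3 := (((hasDerivAt_ofReal_cpow_of_pos (-s - 1) hu0).hasDerivWithinAt (s := Ioi u)).mul
        (hasDerivWithinAt_charKernel χ u)).const_mul s
      refine ((d1.sub d2).add d3).congr_deriv ?_
      rw [hSeq hu0.le, show -s - 1 - 1 = -s - 2 by ring,
        show (u : ℂ) ^ (-s) = (u : ℂ) ^ (-s - 1) * u by
          rw [Complex.cpow_sub _ _ huC, Complex.cpow_one]; field_simp]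
      split_ifs <;> ring
  rw [intervalIntegral.integral_sub (by exact hSint.neg) (hKcont.intervalIntegrable.const_mul _),
    intervalIntegral.integral_neg, intervalIntegral.integral_const_mul] at hftc
  have hB {u : ℝ} (hu : 0 < u) : (u : ℂ) ^ (-s) * S u + G u = boundary χ s u := by
    have huC : (u : ℂ) ≠ 0 := by exact_mod_cast hu.ne'
    have h1s : (1 - s) ≠ 0 := sub_ne_zero.2 hs.symm
    rw [hSeq hu.le, hG, boundary]
    simp only
    split_ifs
    · rw [show (u : ℂ) ^ (1 - s) = (u : ℂ) ^ (-s) * u by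
        rw [show 1 - s = -s + 1 by ring, Complex.cpow_add _ _ huC, Complex.cpow_one]]
      field_simp
      ring
    · ring
  rw [hsum, habel, hIabel]
  have hBR := hB (hX.trans_le hR)
  have hBX := hB hX
  simp only [hS] at hBR hBX hftc ⊢
  linear_combination hftc + hBR - hBX

lemma tendsto_boundary (χ : DirichletCharacter ℂ q) {s : ℂ} (hs : 1 < s.re) :
    Tendsto (boundary χ s) atTop (𝓝 0) := by
  have h1 : Tendsto (fun u : ℝ => if q = 1 then (u : ℂ) ^ (1 - s) / (1 - s) else 0) atTop (𝓝 0) := by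
    split_ifs
    · simpa using (tendsto_ofReal_cpow_atTop (c := 1 - s) (by simp; linarith)).div_const (1 - s)
    · exact tendsto_const_nhds
  have h2 : Tendsto (fun u : ℝ => charSawtooth χ u * (u : ℂ) ^ (-s)) atTop (𝓝 0) :=
    (tendsto_ofReal_cpow_atTop (c := -s) (by simp; linarith)).zero_mul_isBoundedUnder_le
      (isBoundedUnder_of ⟨q, norm_charSawtooth_le_card χ⟩) |>.congr fun u => mul_comm _ _
  have h3 : Tendsto (fun u : ℝ => (u : ℂ) ^ (-s - 1) * (q * charKernel χ (u / q))) atTop (𝓝 0) :=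
    (tendsto_ofReal_cpow_atTop (c := -s - 1) (by simp; linarith)).zero_mul_isBoundedUnder_le
      (isBoundedUnder_of ⟨q * q, fun u => by
        simp only [Function.comp, norm_mul, Complex.norm_natCast]
        gcongr; exact norm_charKernel_le χ _⟩)
  simpa using! (h1.sub h2).add (h3.const_mul s)

lemma integrableOn_charKernel (χ : DirichletCharacter ℂ q) {X : ℝ} (hX : 0 < X) {s : ℂ}
    (hs : -1 < s.re) :
    IntegrableOn (fun u : ℝ => q * charKernel χ (u / q) * (u : ℂ) ^ (-s - 2)) (Ioi X) :=
  integrableOn_Ioi_mul_cpow (f := fun u => q * charKernel χ (u / q)) (C := q * q)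
    (continuous_const.mul ((continuous_charKernel χ).comp (continuous_id.div_const _)))
    (fun u => by
      rw [norm_mul, Complex.norm_natCast]; gcongr; exact norm_charKernel_le χ _) hX hs

/-- `L(s, χ) - ∑_{n ≤ X} χ(n) n^(-s)` according to the Euler–Maclaurin formula. -/
noncomputable def eulerMaclaurin (χ : DirichletCharacter ℂ q) (X : ℝ) (s : ℂ) : ℂ :=
  s * (s + 1) * (∫ u in Ioi X, q * charKernel χ (u / q) * (u : ℂ) ^ (-s - 2)) - boundary χ s X

lemma LFunction_eq_of_one_lt_re [NeZero q] {χ : DirichletCharacter ℂ q} (hχ : χ.IsPrimitive) {s : ℂ}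
    (hs : 1 < s.re) {X : ℝ} (hX : 0 < X) :
    DirichletCharacter.LFunction χ s
      = ∑ n ∈ Finset.Icc 1 ⌊X⌋₊, χ (n : ZMod q) * (n : ℂ) ^ (-s) + eulerMaclaurin χ X s := by
  have hs1 : s ≠ 1 := by rintro rfl; simp at hs
  have hL : Tendsto (fun N : ℕ => ∑ n ∈ Finset.Icc 1 N, χ (n : ZMod q) * (n : ℂ) ^ (-s)) atTop
      (𝓝 (DirichletCharacter.LFunction χ s)) := by
    rw [DirichletCharacter.LFunction_eq_LSeries χ hs]
    have h := (DirichletCharacter.LSeriesSummable_of_one_lt_re χ hs).hasSum.tendsto_sum_nat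
    refine ((tendsto_add_atTop_iff_nat 1).2 h).congr fun N => ?_
    rw [Finset.sum_range_eq_add_Ico _ N.succ_pos, LSeries.term_zero, zero_add]
    refine Finset.sum_congr rfl fun n hn => ?_
    rw [LSeries.term_of_ne_zero (by rw [Finset.mem_Icc] at hn; omega), Complex.cpow_neg,
      div_eq_mul_inv]
  refine tendsto_nhds_unique hL ?_
  have hB := (tendsto_boundary χ hs).comp (tendsto_natCast_atTop_atTop (R := ℝ))
  have hI := (intervalIntegral_tendsto_integral_Ioi X
    (integrableOn_charKernel χ hX (s := s) (by linarith)) tendsto_id).comp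
      (tendsto_natCast_atTop_atTop (R := ℝ))
  have h := ((hB.sub_const (boundary χ s X)).add (hI.const_mul (s * (s + 1)))).const_add
    (∑ n ∈ Finset.Icc 1 ⌊X⌋₊, χ (n : ZMod q) * (n : ℂ) ^ (-s))
  rw [eulerMaclaurin, sub_eq_neg_add, ← zero_sub (boundary χ s X)]
  refine h.congr' ?_
  filter_upwards [eventually_ge_atTop ⌈X⌉₊] with N hN
  have hXN : X ≤ N := Nat.ceil_le.1 hN
  have hfin := sum_Ioc_char_cpow hχ hs1 hX hXN
  simp only [Function.comp, id]
  rw [← hfin, Nat.floor_natCast]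
  have hfl : ⌊X⌋₊ ≤ N := by simpa using Nat.floor_le_floor hXN
  have hdis : Disjoint (Finset.Icc 1 ⌊X⌋₊) (Finset.Ioc ⌊X⌋₊ N) := by
    rw [Finset.disjoint_left]; intro n h1 h2
    rw [Finset.mem_Icc] at h1; rw [Finset.mem_Ioc] at h2; omega
  rw [← Finset.sum_union hdis]
  congr 1
  ext n; simp only [Finset.mem_union, Finset.mem_Icc, Finset.mem_Ioc]; omega

/-- The half plane `Re s > -1`, without the point `1` if `q = 1`. -/
def continuationDomain (q : ℕ) : Set ℂ := {s | -1 < s.re ∧ (q = 1 → s ≠ 1)}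

lemma isOpen_continuationDomain (q : ℕ) : IsOpen (continuationDomain q) := by
  have h0 : IsOpen {s : ℂ | -1 < s.re} := isOpen_lt continuous_const Complex.continuous_re
  by_cases h : q = 1
  · have : continuationDomain q = {s : ℂ | -1 < s.re} ∩ {1}ᶜ := by
      ext s; simp [continuationDomain, h]
    rw [this]
    exact h0.inter isOpen_compl_singleton
  · simpa [continuationDomain, h] using h0

lemma isPreconnected_continuationDomain (q : ℕ) : IsPreconnected (continuationDomain q) := by
  by_cases h : q = 1
  · -- a union of four convex sets, each of which meets its predecessors
    have hU : continuationDomain q = (({s : ℂ | 1 < s.re} ∪ {s | 0 < s.im} ∩ {s | -1 < s.re})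
        ∪ {s | s.im < 0} ∩ {s | -1 < s.re}) ∪ {s | -1 < s.re} ∩ {s | s.re < 1} := by
      ext s
      simp only [continuationDomain, mem_ofPred_eq, mem_union, mem_inter_iff]
      constructor
      · rintro ⟨h1, h2⟩
        by_contra! hcon
        obtain ⟨⟨⟨c1, c2⟩, c3⟩, c4⟩ := hcon
        refine h2 h (Complex.ext ?_ ?_)
        · simp; linarith [c4 h1]
        · simp only [Complex.one_im]
          refine le_antisymm ?_ ?_
          · by_contra! hh; linarith [c2 hh]
          · by_contra! hh; linarith [c3 hh]
      · rintro (((h1 | ⟨h1, h2⟩) | ⟨h1, h2⟩) | ⟨h1, h2⟩) <;>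
          refine ⟨by linarith, fun _ => ?_⟩ <;> rintro rfl <;> norm_num at *
    have hc1 := (convex_halfSpace_re_gt 1).isPreconnected
    have hc2 := ((convex_halfSpace_im_gt 0).inter (convex_halfSpace_re_gt (-1))).isPreconnected
    have hc3 := ((convex_halfSpace_im_lt 0).inter (convex_halfSpace_re_gt (-1))).isPreconnected
    have hc4 := ((convex_halfSpace_re_gt (-1)).inter (convex_halfSpace_re_lt 1)).isPreconnected
    rw [hU]
    refine IsPreconnected.union (Complex.I) ?_ ?_ (IsPreconnected.union (2 - Complex.I) ?_ ?_
      (IsPreconnected.union (2 + Complex.I) ?_ ?_ hc1 hc2) hc3) hc4 <;> norm_num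
  · have : continuationDomain q = {s : ℂ | -1 < s.re} := by simp [continuationDomain, h]
    rw [this]
    exact (convex_halfSpace_re_gt _).isPreconnected

lemma differentiableAt_ofReal_cpow_affine {X : ℝ} (hX : 0 < X) {f : ℂ → ℂ} {s : ℂ}
    (hf : DifferentiableAt ℂ f s) : DifferentiableAt ℂ (fun s : ℂ => (X : ℂ) ^ f s) s :=
  DifferentiableAt.const_cpow hf (Or.inl (by exact_mod_cast hX.ne'))

lemma differentiableAt_eulerMaclaurin (χ : DirichletCharacter ℂ q) {X : ℝ} (hX : 0 < X) {s : ℂ}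
    (hs : s ∈ continuationDomain q) : DifferentiableAt ℂ (eulerMaclaurin χ X) s := by
  have h1 := differentiableAt_integral_Ioi_mul_cpow
    (f := fun u => q * charKernel χ (u / q)) (C := q * q)
    (continuous_const.mul ((continuous_charKernel χ).comp (continuous_id.div_const _)))
    (fun u => by
      rw [norm_mul, Complex.norm_natCast]; gcongr; exact norm_charKernel_le χ _) hX hs.1
  have h2 : DifferentiableAt ℂ
      (fun s : ℂ => if q = 1 then (X : ℂ) ^ (1 - s) / (1 - s) else 0) s := by
    split_ifs with h
    · exact (differentiableAt_ofReal_cpow_affine hX (by fun_prop)).div (by fun_prop)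
        (sub_ne_zero.2 (hs.2 h).symm)
    · exact differentiableAt_const _
  have h3 := differentiableAt_ofReal_cpow_affine hX (f := fun s => -s) (s := s) (by fun_prop)
  have h4 := differentiableAt_ofReal_cpow_affine hX (f := fun s => -s - 1) (s := s) (by fun_prop)
  unfold eulerMaclaurin boundary
  fun_prop

/-- The Euler–Maclaurin formula for `L(s, χ)` in the half plane `Re s > -1`. -/
lemma LFunction_eq [NeZero q] {χ : DirichletCharacter ℂ q} (hχ : χ.IsPrimitive) {s : ℂ}
    (hs : s ∈ continuationDomain q) {X : ℝ} (hX : 0 < X) :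
    DirichletCharacter.LFunction χ s
      = ∑ n ∈ Finset.Icc 1 ⌊X⌋₊, χ (n : ZMod q) * (n : ℂ) ^ (-s) + eulerMaclaurin χ X s := by
  have hU := isOpen_continuationDomain q
  have h1 : AnalyticOnNhd ℂ (DirichletCharacter.LFunction χ) (continuationDomain q) := by
    refine DifferentiableOn.analyticOnNhd (fun s hs => ?_) hU
    refine (DirichletCharacter.differentiableAt_LFunction χ s ?_).differentiableWithinAt
    by_cases h : q = 1
    · exact Or.inl (hs.2 h)
    · exact Or.inr (ne_one_of_isPrimitive hχ h)
  have h2 : AnalyticOnNhd ℂ (fun s => ∑ n ∈ Finset.Icc 1 ⌊X⌋₊, χ (n : ZMod q) * (n : ℂ) ^ (-s)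
      + eulerMaclaurin χ X s) (continuationDomain q) := by
    refine DifferentiableOn.analyticOnNhd (fun s hs => DifferentiableAt.differentiableWithinAt ?_) hU
    refine DifferentiableAt.add (DifferentiableAt.fun_sum fun n hn => ?_)
      (differentiableAt_eulerMaclaurin χ hX hs)
    rw [Finset.mem_Icc] at hn
    exact (differentiableAt_natCast_cpow_neg (by omega) s).const_mul _
  refine h1.eqOn_of_preconnected_of_eventuallyEq h2 (isPreconnected_continuationDomain q)
    (z₀ := 2) ⟨by norm_num, fun _ => by norm_num⟩ ?_ hs
  filter_upwards [(isOpen_lt continuous_const Complex.continuous_re).mem_nhds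
    (show (1 : ℝ) < (2 : ℂ).re by norm_num)] with z hz
  exact LFunction_eq_of_one_lt_re hχ hz hX

end Formula

/-! ### Expansion of the remainder in a Fourier series -/

section Fourier

variable {q : ℕ} [NeZero q]

lemma posTerm_eq (χ : DirichletCharacter ℂ q) {s : ℂ} (hs : -1 < s.re) {X : ℝ} (hX : 0 < X)
    {n : ℕ} (hn : n ≠ 0) :
    posTerm χ s X n = (starRingEnd ℂ) (χ (-(n : ZMod q)))
      * (s / (2 * (Real.pi : ℂ) * Complex.I * (n : ℂ))) * tailClosed q n (X / q) s := by
  have hq : (0 : ℝ) < q := by exact_mod_cast NeZero.pos q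
  rw [posTerm, tailIntegral_eq (by exact_mod_cast hn) (by positivity) hs]

lemma negTerm_eq (χ : DirichletCharacter ℂ q) {s : ℂ} (hs : -1 < s.re) {X : ℝ} (hX : 0 < X)
    {n : ℕ} (hn : n ≠ 0) :
    negTerm χ s X n = (starRingEnd ℂ) (χ (n : ZMod q))
      * (s / (2 * (Real.pi : ℂ) * Complex.I * (n : ℂ))) * tailClosed q (-n) (X / q) s := by
  have hq : (0 : ℝ) < q := by exact_mod_cast NeZero.pos q
  rw [negTerm, tailIntegral_eq (by simpa using hn) (by positivity) hs]

lemma posTerm_zero {q : ℕ} (χ : DirichletCharacter ℂ q) (s : ℂ) (X : ℝ) : posTerm χ s X 0 = 0 := by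
  simp [posTerm]

lemma negTerm_zero {q : ℕ} (χ : DirichletCharacter ℂ q) (s : ℂ) (X : ℝ) : negTerm χ s X 0 = 0 := by
  simp [negTerm]

/-- A product of the shape of `posTerm` and `negTerm` is `O(1/n²)` once its last factor
is `O(1/n)`. -/
lemma summable_of_norm_le_inv {a T : ℕ → ℂ} {s : ℂ} {C : ℝ} (ha : ∀ n, ‖a n‖ ≤ 1)
    (hT : ∀ n, ‖T n‖ ≤ C / n) :
    Summable fun n : ℕ => a n * (s / (2 * (Real.pi : ℂ) * Complex.I * (n : ℂ))) * T n := by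
  have hsum : Summable fun n : ℕ => (‖s‖ / (2 * Real.pi) * C) * (1 / (n : ℝ) ^ 2) :=
    (Real.summable_one_div_nat_pow.2 one_lt_two).mul_left _
  refine Summable.of_norm_bounded hsum fun n => ?_
  have h1 : ‖s / (2 * (Real.pi : ℂ) * Complex.I * (n : ℂ))‖ = ‖s‖ / (2 * Real.pi) / n := by
    simp [abs_of_pos Real.pi_pos, div_div]
  rw [norm_mul, norm_mul, h1]
  calc ‖a n‖ * (‖s‖ / (2 * Real.pi) / n) * ‖T n‖
      ≤ 1 * (‖s‖ / (2 * Real.pi) / n) * (C / n) := by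
        gcongr
        · exact ha n
        · exact hT n
    _ = _ := by rw [div_mul_eq_mul_div, one_mul]; ring

lemma norm_conj_char_le {q : ℕ} (χ : DirichletCharacter ℂ q) (a : ZMod q) :
    ‖(starRingEnd ℂ) (χ a)‖ ≤ 1 := by
  rw [RCLike.norm_conj]; exact χ.norm_le_one a

lemma summable_posTerm (χ : DirichletCharacter ℂ q) {s : ℂ} (hs : -1 < s.re) {X : ℝ}
    (hX : 0 < X) : Summable (posTerm χ s X) := by
  obtain ⟨C, hC⟩ : ∃ C : ℝ, ∀ m : ℤ, ‖tailClosed q m (X / q) s‖ ≤ C / |(m : ℝ)| :=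
    ⟨_, fun m => norm_tailClosed_le q m (X / q) s⟩
  refine (summable_of_norm_le_inv (a := fun n => (starRingEnd ℂ) (χ (-(n : ZMod q))))
    (T := fun n => tailClosed q n (X / q) s) (s := s) (fun n => norm_conj_char_le χ _)
    fun n => by simpa using hC n).congr fun n => ?_
  rcases eq_or_ne n 0 with rfl | hn
  · simp [posTerm_zero]
  · exact (posTerm_eq χ hs hX hn).symm

lemma summable_negTerm (χ : DirichletCharacter ℂ q) {s : ℂ} (hs : -1 < s.re) {X : ℝ}
    (hX : 0 < X) : Summable (negTerm χ s X) := by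
  obtain ⟨C, hC⟩ : ∃ C : ℝ, ∀ m : ℤ, ‖tailClosed q m (X / q) s‖ ≤ C / |(m : ℝ)| :=
    ⟨_, fun m => norm_tailClosed_le q m (X / q) s⟩
  refine (summable_of_norm_le_inv (a := fun n => (starRingEnd ℂ) (χ (n : ZMod q)))
    (T := fun n => tailClosed q (-n) (X / q) s) (s := s) (fun n => norm_conj_char_le χ _)
    fun n => by simpa using hC (-n)).congr fun n => ?_
  rcases eq_or_ne n 0 with rfl | hn
  · simp [negTerm_zero]
  · exact (negTerm_eq χ hs hX hn).symm

lemma integral_Ioi_charKernel_comp_div (χ : DirichletCharacter ℂ q) {X : ℝ} (s : ℂ) (hX : 0 < X) :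
    ∫ u in Ioi X, q * charKernel χ (u / q) * (u : ℂ) ^ (-s - 2)
      = (q : ℂ) ^ (-s) * ∫ v in Ioi (X / q), charKernel χ v * (v : ℂ) ^ (-s - 2) := by
  have hq : (0 : ℝ) < q := by exact_mod_cast NeZero.pos q
  have hqC : (q : ℂ) ≠ 0 := by exact_mod_cast NeZero.ne q
  have h := integral_comp_mul_left_Ioi'
    (fun u : ℝ => q * charKernel χ (u / q) * (u : ℂ) ^ (-s - 2)) (X / q) hq
  rw [mul_div_cancel₀ _ hq.ne'] at h
  rw [← h, ← integral_const_mul, ← integral_smul]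
  refine setIntegral_congr_fun measurableSet_Ioi fun v hv => ?_
  have hv0 : 0 < v := (div_pos hX hq).trans hv
  have h1 := Complex.mul_cpow_ofReal_nonneg hq.le hv0.le (-s - 2)
  rw [Complex.ofReal_natCast] at h1
  have h2 : (q : ℂ) ^ (-s - 2) = (q : ℂ) ^ (-s) / (q : ℂ) ^ 2 := by
    rw [Complex.cpow_sub _ _ hqC]; norm_cast
  simp only [Complex.ofReal_mul, Complex.ofReal_natCast, Complex.real_smul]
  rw [h1, h2, mul_div_cancel_left₀ _ hq.ne']
  field_simp

/-- The second-order remainder of the Euler–Maclaurin formula, expanded in a Fourier series. -/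
lemma hasSum_remainder {χ : DirichletCharacter ℂ q} (hχ : χ.IsPrimitive) {s : ℂ}
    (hs : -1 < s.re) {X : ℝ} (hX : 0 < X) :
    HasSum (fun n : ℕ => tau χ * (posTerm χ s X n - negTerm χ s X n))
      (s * (s + 1) * (∫ u in Ioi X, q * charKernel χ (u / q) * (u : ℂ) ^ (-s - 2))
        - s * ((X : ℂ) ^ (-s - 1) * (q * charKernel χ (X / q)))) := by
  have hq : (0 : ℝ) < q := by exact_mod_cast NeZero.pos q
  have hqC : (q : ℂ) ≠ 0 := by exact_mod_cast NeZero.ne q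
  set x : ℝ := X / q with hx
  have hx0 : 0 < x := div_pos hX hq
  set k : ℕ → ℝ → ℂ := fun n v => tau χ * ((starRingEnd ℂ) (χ (-(n : ZMod q))) * e ((n : ℤ) * v)
        + (starRingEnd ℂ) (χ (n : ZMod q)) * e ((-n : ℤ) * v)) / (2 * Real.pi * Complex.I * n) ^ 2
    with hk
  have hksum (v : ℝ) : HasSum (fun n => k n v) (charKernel χ v) := hasSum_charKernel hχ v
  have hInt (m : ℤ) : IntegrableOn (fun v : ℝ => e (m * v) * (v : ℂ) ^ (-s - 2)) (Ioi x) :=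
    integrableOn_Ioi_mul_cpow (continuous_e_mul m) (fun u => (norm_e _).le) hx0 hs
  have hkcont (n : ℕ) : Continuous (k n) := by
    have h1 := continuous_e_mul ((n : ℤ) : ℝ)
    have h2 := continuous_e_mul ((-n : ℤ) : ℝ)
    simp only [hk]
    fun_prop
  have hkbound (n : ℕ) (v : ℝ) : ‖k n v‖ ≤ ‖tau χ‖ * 2 / (2 * Real.pi) ^ 2 * (1 / (n : ℝ) ^ 2) := by
    have h1 : ‖(starRingEnd ℂ) (χ (-(n : ZMod q))) * e ((n : ℤ) * v)
        + (starRingEnd ℂ) (χ (n : ZMod q)) * e ((-n : ℤ) * v)‖ ≤ 2 := by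
      refine (norm_add_le _ _).trans ?_
      rw [norm_mul, norm_mul, norm_e, norm_e, mul_one, mul_one]
      linarith [norm_conj_char_le χ (-(n : ZMod q)), norm_conj_char_le χ (n : ZMod q)]
    simp only [hk]
    rw [norm_div, norm_mul, norm_pow, norm_mul (2 * (Real.pi : ℂ) * Complex.I), mul_pow,
      Complex.norm_natCast, show ‖(2 * (Real.pi : ℂ) * Complex.I)‖ = 2 * Real.pi by
        simp [abs_of_pos Real.pi_pos], ← div_div, div_eq_mul_one_div (_ / _)]
    gcongr
  have hkint (n : ℕ) : IntegrableOn (fun v : ℝ => k n v * (v : ℂ) ^ (-s - 2)) (Ioi x) :=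
    integrableOn_Ioi_mul_cpow (hkcont n) (hkbound n) hx0 hs
  have hswap : HasSum (fun n => ∫ v in Ioi x, k n v * (v : ℂ) ^ (-s - 2))
      (∫ v in Ioi x, charKernel χ v * (v : ℂ) ^ (-s - 2)) := by
    have h := hasSum_integral_of_summable_integral_norm (μ := volume.restrict (Ioi x)) hkint ?_
    · have heq (v : ℝ) : ∑' n, k n v * (v : ℂ) ^ (-s - 2)
          = charKernel χ v * (v : ℂ) ^ (-s - 2) := ((hksum v).mul_right _).tsum_eq
      simpa only [heq] using h
    · have hnorm : IntegrableOn (fun v : ℝ => ‖(v : ℂ) ^ (-s - 2)‖) (Ioi x) :=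
        (integrableOn_Ioi_cpow_of_lt (a := -s - 2) (by simp; linarith) hx0).norm
      refine Summable.of_nonneg_of_le (fun n => integral_nonneg fun v => norm_nonneg _) (fun n => ?_)
        ((Real.summable_one_div_nat_pow.2 one_lt_two).mul_left
          (‖tau χ‖ * 2 / (2 * Real.pi) ^ 2 * ∫ v in Ioi x, ‖(v : ℂ) ^ (-s - 2)‖))
      calc ∫ v in Ioi x, ‖k n v * (v : ℂ) ^ (-s - 2)‖
          ≤ ∫ v in Ioi x, (‖tau χ‖ * 2 / (2 * Real.pi) ^ 2 * (1 / (n : ℝ) ^ 2))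
              * ‖(v : ℂ) ^ (-s - 2)‖ := by
            refine integral_mono (hkint n).norm (hnorm.const_mul _) fun v => ?_
            simp only [norm_mul (k n v)]
            exact mul_le_mul_of_nonneg_right (hkbound n v) (norm_nonneg _)
        _ = _ := by rw [integral_const_mul]; ring
  have hfin := ((hswap.mul_left (s * (s + 1) * (q : ℂ) ^ (-s))).sub
    ((hksum x).mul_left (s * (q : ℂ) ^ (-s) * (x : ℂ) ^ (-s - 1))))
  have hqx : (X : ℂ) ^ (-s - 1) * q = (q : ℂ) ^ (-s) * (x : ℂ) ^ (-s - 1) := by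
    have h1 := Complex.mul_cpow_ofReal_nonneg hq.le hx0.le (-s - 1)
    rw [← Complex.ofReal_mul, hx, mul_div_cancel₀ _ hq.ne', Complex.ofReal_natCast] at h1
    rw [h1, Complex.cpow_sub _ _ hqC, Complex.cpow_one, ← hx]
    field_simp
  convert! hfin using 1
  · funext n
    rcases eq_or_ne n 0 with rfl | hn
    · simp [posTerm_zero, negTerm_zero, hk]
    · have hnC : (n : ℂ) ≠ 0 := by exact_mod_cast hn
      have hpi : (Real.pi : ℂ) ≠ 0 := by exact_mod_cast Real.pi_ne_zero
      have hI : ∫ v in Ioi x, k n v * (v : ℂ) ^ (-s - 2)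
          = tau χ / (2 * Real.pi * Complex.I * n) ^ 2 * ((starRingEnd ℂ) (χ (-(n : ZMod q)))
              * (∫ v in Ioi x, e ((n : ℤ) * v) * (v : ℂ) ^ (-s - 2))
            + (starRingEnd ℂ) (χ (n : ZMod q))
              * ∫ v in Ioi x, e ((-n : ℤ) * v) * (v : ℂ) ^ (-s - 2)) := by
        rw [← integral_const_mul, ← integral_const_mul,
          ← integral_add ((hInt _).const_mul _) ((hInt _).const_mul _), ← integral_const_mul]
        congr 1; funext v
        simp only [hk]; ring
      rw [posTerm_eq χ hs hX hn, negTerm_eq χ hs hX hn, hI, tailClosed, tailClosed]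
      simp only [hk, ← hx, Int.cast_neg, Int.cast_natCast]
      field_simp
      ring
  · rw [integral_Ioi_charKernel_comp_div χ s hX, ← hx, ← mul_assoc ((X : ℂ) ^ (-s - 1)), hqx]
    ring

/-- The approximate formula with the full Fourier series of the sawtooth functions. -/
lemma LFunction_eq_add_tsum {χ : DirichletCharacter ℂ q} (hχ : χ.IsPrimitive) {s : ℂ}
    (hs : s ∈ continuationDomain q) {X : ℝ} (hX : 0 < X) :
    DirichletCharacter.LFunction χ s
      = ∑ n ∈ Finset.Icc 1 ⌊X⌋₊, χ (n : ZMod q) * (n : ℂ) ^ (-s)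
        + (if q = 1 then (X : ℂ) ^ (1 - s) / (s - 1) else 0) + (X : ℂ) ^ (-s) * charSawtooth χ X
        + tau χ * ∑' n : ℕ, posTerm χ s X n - tau χ * ∑' n : ℕ, negTerm χ s X n := by
  have h := (hasSum_remainder hχ hs.1 hX).tsum_eq
  rw [tsum_mul_left, (summable_posTerm χ hs.1 hX).tsum_sub (summable_negTerm χ hs.1 hX),
    mul_sub] at h
  have hif : (if q = 1 then (X : ℂ) ^ (1 - s) / (s - 1) else 0)
      = -(if q = 1 then (X : ℂ) ^ (1 - s) / (1 - s) else 0) := by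
    split_ifs
    · rw [← neg_sub 1 s, div_neg]
    · simp
  rw [LFunction_eq hχ hs hX, eulerMaclaurin, boundary, hif]
  linear_combination -h

end Fourier

/-! ### The identities for the remainder -/

section Identity

variable {q : ℕ} [NeZero q]

lemma conj_char_neg {q : ℕ} (χ : DirichletCharacter ℂ q) (n : ZMod q) :
    (starRingEnd ℂ) (χ (-n)) = χ (-1) * (starRingEnd ℂ) (χ n) := by
  rw [neg_eq_neg_one_mul n, map_mul, map_mul]
  congr 1
  rcases χ.even_or_odd with h | h
  · rw [h]; simp
  · rw [h]; simp

/-- For `ν ≤ y` the series term is traded for the terms of the second sum of the approximate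
formula, of the finite sum in `K₁`, and of the head integrals. -/
lemma tau_mul_posTerm {χ : DirichletCharacter ℂ q} (hχ : χ.IsPrimitive) {s : ℂ}
    (hs0 : 0 ≤ s.re) (hs1 : s.re ≤ 1) (him : s.im ≠ 0) {X : ℝ} (hX : 0 < X) {ν : ℕ}
    (hν : 1 ≤ ν) :
    tau χ * posTerm χ s X ν
      = (X : ℂ) ^ (-s) * ∑ a ∈ Finset.Icc 1 q, χ (a : ZMod q)
          * (e ((ν : ℝ) * ((X - a) / q)) / (2 * (Real.pi : ℂ) * Complex.I * (ν : ℂ)))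
        + Complex.I * (q : ℂ) ^ (-s) * (2 * (Real.pi : ℂ)) ^ (s - 1) * Complex.Gamma (1 - s)
          * Complex.exp (-((Real.pi : ℂ) * Complex.I * s / 2)) * χ (-1) * tau χ
          * ((starRingEnd ℂ) (χ (ν : ZMod q)) * (ν : ℂ) ^ (s - 1))
        - tau χ * headTerm χ s X ν := by
  have hq : (0 : ℝ) < q := by exact_mod_cast NeZero.pos q
  have hx0 : 0 < X / q := div_pos hX hq
  rw [headTerm, headIntegral_eq (NeZero.ne q) hν hx0 hs0 hs1 him, headClosed,
    mul_div_cancel₀ _ hq.ne', posTerm_eq χ (by linarith) hX (by omega)]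
  have hg := sum_char_mul_e_sub hχ ν (X / q)
  have hsum : ∑ a ∈ Finset.Icc 1 q, χ (a : ZMod q)
        * (e ((ν : ℝ) * ((X - a) / q)) / (2 * (Real.pi : ℂ) * Complex.I * (ν : ℂ)))
      = (starRingEnd ℂ) (χ (-(ν : ZMod q))) * tau χ * e (ν * (X / q))
        / (2 * (Real.pi : ℂ) * Complex.I * (ν : ℂ)) := by
    simp only [Int.cast_natCast] at hg
    rw [← hg, Finset.sum_div]
    refine Finset.sum_congr rfl fun a _ => ?_
    rw [sub_div, mul_div_assoc]
  have hpow : (2 * Real.pi * ν : ℂ) ^ (s - 1) = (2 * (Real.pi : ℂ)) ^ (s - 1) * (ν : ℂ) ^ (s - 1) := by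
    have := Complex.mul_cpow_ofReal_nonneg (a := 2 * Real.pi) (b := ν) (by positivity)
      (by positivity) (s - 1)
    push_cast at this
    exact this
  rw [hsum, hpow, conj_char_neg]
  ring

lemma im_pos_of_one_le {s : ℂ} {X y : ℝ} (hX : 0 < X) (ht : 2 * Real.pi * (X / q) * y = s.im)
    (hy : 0 < y) : 0 < s.im := by
  have hq : (0 : ℝ) < q := by exact_mod_cast NeZero.pos q
  have := Real.pi_pos
  rw [← ht]; positivity

/-- The series over all `ν` split at `y` and at `y + η`. -/
lemma tsum_posTerm_split (χ : DirichletCharacter ℂ q) {s : ℂ} (hs : -1 < s.re) {X y η : ℝ}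
    (hX : 0 < X) (hy : 0 ≤ y) (hη : 0 < η) :
    ∑' n : ℕ, posTerm χ s X n
      = ∑ ν ∈ Finset.Icc 1 ⌊y⌋₊, posTerm χ s X ν
        + ∑ ν ∈ (Finset.Icc 1 ⌈y + η⌉₊).filter
            (fun ν : ℕ => y < (ν : ℝ) ∧ (ν : ℝ) < y + η), posTerm χ s X ν
        + ∑' ν : {ν : ℕ // y + η ≤ (ν : ℝ)}, posTerm χ s X ν := by
  set A := Finset.Icc 1 ⌊y⌋₊ with hA
  set B := (Finset.Icc 1 ⌈y + η⌉₊).filter (fun ν : ℕ => y < (ν : ℝ) ∧ (ν : ℝ) < y + η) with hB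
  have hAB : Disjoint A B := by
    rw [Finset.disjoint_left]
    intro n h1 h2
    rw [hA, Finset.mem_Icc] at h1
    rw [hB, Finset.mem_filter] at h2
    exact absurd ((Nat.le_floor_iff hy).1 h1.2) (not_le.2 h2.2.1)
  have h0 : 0 ∉ A ∪ B := by simp [hA, hB]
  have hset : ((insert 0 (A ∪ B) : Finset ℕ) : Set ℕ)ᶜ = {ν : ℕ | y + η ≤ (ν : ℝ)} := by
    ext n
    have hmemA : n ∈ A ↔ 1 ≤ n ∧ (n : ℝ) ≤ y := by rw [hA, Finset.mem_Icc, Nat.le_floor_iff hy]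
    have hmemB : n ∈ B ↔ y < (n : ℝ) ∧ (n : ℝ) < y + η := by
      rw [hB, Finset.mem_filter, Finset.mem_Icc]
      refine ⟨fun h => h.2, fun h => ⟨⟨?_, ?_⟩, h⟩⟩
      · have : (0 : ℝ) < n := hy.trans_lt h.1
        exact_mod_cast this
      · exact Nat.cast_le.1 (h.2.le.trans (Nat.le_ceil _))
    simp only [mem_compl_iff, Finset.mem_coe, Finset.mem_insert, Finset.mem_union, hmemA, hmemB,
      mem_ofPred_eq]
    constructor
    · intro h
      by_contra! hlt
      refine h ?_
      rcases Nat.eq_zero_or_pos n with h0 | hpos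
      · exact Or.inl h0
      · rcases le_or_gt (n : ℝ) y with hle | hgt
        · exact Or.inr (Or.inl ⟨hpos, hle⟩)
        · exact Or.inr (Or.inr ⟨hgt, hlt⟩)
    · rintro h (rfl | ⟨_, h2⟩ | ⟨_, h2⟩)
      · simp at h; linarith
      · linarith
      · linarith
  have h := (summable_posTerm χ hs hX).sum_add_tsum_compl (s := insert 0 (A ∪ B))
  rw [Finset.sum_insert h0, posTerm_zero, zero_add, Finset.sum_union hAB,
    tsum_congr_set_coe (posTerm χ s X) hset] at h
  exact h.symm

lemma tsum_negTerm_pnat (χ : DirichletCharacter ℂ q) {s : ℂ} (hs : -1 < s.re) {X : ℝ}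
    (hX : 0 < X) : ∑' ν : ℕ+, negTerm χ s X ν = ∑' n : ℕ, negTerm χ s X n := by
  rw [tsum_pnat_eq_tsum_succ (f := negTerm χ s X), (summable_negTerm χ hs hX).tsum_eq_zero_add,
    negTerm_zero, zero_add]

lemma sum_headTerm_split {q : ℕ} (χ : DirichletCharacter ℂ q) (s : ℂ) (X : ℝ) {y η : ℝ}
    (hη : 0 < η) :
    ∑ ν ∈ Finset.Icc 1 ⌊y⌋₊, headTerm χ s X ν
      = ∑ ν ∈ Finset.Icc 1 ⌊y - η⌋₊, headTerm χ s X ν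
        + ∑ ν ∈ (Finset.Icc 1 ⌊y⌋₊).filter (fun ν : ℕ => y - η < (ν : ℝ)), headTerm χ s X ν := by
  rw [← Finset.sum_filter_not_add_sum_filter (Finset.Icc 1 ⌊y⌋₊)
    (fun ν : ℕ => y - η < (ν : ℝ))]
  congr 2
  ext n
  simp only [Finset.mem_filter, Finset.mem_Icc, not_lt]
  constructor
  · rintro ⟨⟨h1, h2⟩, h3⟩
    exact ⟨h1, Nat.le_floor h3⟩
  · rintro ⟨h1, h2⟩
    have h3 := (Nat.le_floor_iff' (by omega)).1 h2
    exact ⟨⟨h1, Nat.le_floor (by linarith)⟩, h3⟩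

/-- The formula for the remainder, with the contribution of the pole for `q = 1`. -/
lemma remainder_eq {χ : DirichletCharacter ℂ q} (hχ : χ.IsPrimitive) {s : ℂ} {X y η : ℝ}
    (hs0 : 0 ≤ s.re) (hs1 : s.re ≤ 1) (hq1 : q = 1 → s ≠ 1) (hX : 0 < X) (hy : 0 ≤ y)
    (ht : 2 * Real.pi * (X / q) * y = s.im) (hη : 0 < η) :
    E₁ χ s X y = (if q = 1 then (X : ℂ) ^ (1 - s) / (s - 1) else 0)
      + (K₁ χ s X y η + K₂ χ s X y η) := by
  have hs : -1 < s.re := by linarith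
  have hL := LFunction_eq_add_tsum hχ (s := s) ⟨hs, hq1⟩ hX
  rw [tsum_posTerm_split χ hs hX hy hη] at hL
  have hpos : ∑ ν ∈ Finset.Icc 1 ⌊y⌋₊, tau χ * posTerm χ s X ν = _ :=
    Finset.sum_congr rfl fun ν hν => tau_mul_posTerm hχ hs0 hs1 (by
      rw [Finset.mem_Icc] at hν
      have h1 : (1 : ℝ) ≤ ν := by exact_mod_cast hν.1
      have h2 := (Nat.le_floor_iff hy).1 hν.2
      exact (im_pos_of_one_le hX ht (by linarith)).ne') hX (Finset.mem_Icc.1 hν).1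
  rw [Finset.sum_sub_distrib, Finset.sum_add_distrib, ← Finset.mul_sum, ← Finset.mul_sum,
    ← Finset.mul_sum, ← Finset.mul_sum, Finset.sum_comm, sum_headTerm_split χ s X hη] at hpos
  have hsaw : ∑ a ∈ Finset.Icc 1 q, χ (a : ZMod q) *
      ((sawtooth ((X - a) / q) : ℂ) + ∑ ν ∈ Finset.Icc 1 ⌊y⌋₊,
        e ((ν : ℝ) * ((X - a) / q)) / (2 * (Real.pi : ℂ) * Complex.I * (ν : ℂ)))
      = charSawtooth χ X + ∑ a ∈ Finset.Icc 1 q, ∑ ν ∈ Finset.Icc 1 ⌊y⌋₊, χ (a : ZMod q)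
          * (e ((ν : ℝ) * ((X - a) / q)) / (2 * (Real.pi : ℂ) * Complex.I * (ν : ℂ))) := by
    simp only [mul_add, Finset.sum_add_distrib, Finset.mul_sum, charSawtooth]
  rw [E₁, K₁, K₂, hL, hsaw, tsum_negTerm_pnat χ hs hX]
  linear_combination hpos

lemma K₂_of_natCast (χ : DirichletCharacter ℂ q) (s : ℂ) (X : ℝ) {y η : ℝ} (hη : 0 < η)
    (hη1 : η < 1) {ν₀ : ℕ} (hν₀ : 1 ≤ ν₀) (hy : y = ν₀) :
    K₂ χ s X y η = -(tau χ * (starRingEnd ℂ) (χ (-(ν₀ : ZMod q)))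
      * headIntegral q ν₀ (X / q) s) := by
  subst hy
  have h1 : (Finset.Icc 1 ⌈(ν₀ : ℝ) + η⌉₊).filter
      (fun ν : ℕ => (ν₀ : ℝ) < (ν : ℝ) ∧ (ν : ℝ) < ν₀ + η) = ∅ := by
    rw [Finset.filter_eq_empty_iff]
    rintro n _ ⟨h1, h2⟩
    have h3 : ν₀ < n := by exact_mod_cast h1
    have h4 : n < ν₀ + 1 := by exact_mod_cast (h2.trans (by linarith) : (n : ℝ) < ν₀ + 1)
    omega
  have h2 : (Finset.Icc 1 ⌊(ν₀ : ℝ)⌋₊).filter (fun ν : ℕ => (ν₀ : ℝ) - η < (ν : ℝ)) = {ν₀} := by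
    ext n
    simp only [Finset.mem_filter, Finset.mem_Icc, Nat.floor_natCast, Finset.mem_singleton]
    constructor
    · rintro ⟨⟨_, h1⟩, h2⟩
      have h3 : ν₀ < n + 1 := by exact_mod_cast (by linarith : (ν₀ : ℝ) < n + 1)
      omega
    · rintro rfl
      exact ⟨⟨hν₀, le_rfl⟩, by linarith⟩
  rw [K₂, h1, h2, Finset.sum_empty, Finset.sum_singleton, headTerm]
  ring

end Identity

/-! ### The first derivative test for oscillatory integrals -/

/-- The first derivative test: integration by parts against a monotone amplitude. -/
lemma norm_integral_mul_deriv_mul_cexp_le {g g' φ φ' : ℝ → ℝ} {a b : ℝ} (hab : a ≤ b)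
    (hφ : ∀ u ∈ Icc a b, HasDerivAt φ (φ' u) u) (hg : ∀ u ∈ Icc a b, HasDerivAt g (g' u) u)
    (hφ' : ContinuousOn φ' (Icc a b)) (hg' : ContinuousOn g' (Icc a b))
    (hmono : (∀ u ∈ Icc a b, 0 ≤ g' u) ∨ ∀ u ∈ Icc a b, g' u ≤ 0) :
    ‖∫ u in a..b, ((g u * φ' u : ℝ) : ℂ) * Complex.exp (Complex.I * φ u)‖
      ≤ |g a| + |g b| + |g b - g a| := by
  have hu : uIcc a b = Icc a b := uIcc_of_le hab
  have hgint : IntervalIntegrable g' volume a b := (hu ▸ hg').intervalIntegrable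
  have hφc : ContinuousOn φ (Icc a b) := fun u hu => (hφ u hu).continuousAt.continuousWithinAt
  have hE (u : ℝ) (hu : u ∈ Icc a b) : HasDerivAt (fun v => Complex.exp (Complex.I * φ v))
      (Complex.I * φ' u * Complex.exp (Complex.I * φ u)) u := by
    refine (((hφ u hu).ofReal_comp.const_mul Complex.I).cexp).congr_deriv ?_
    ring
  have hEc : ContinuousOn (fun v => Complex.exp (Complex.I * φ v)) (Icc a b) :=
    fun u hu => (hE u hu).continuousAt.continuousWithinAt
  have hnE (u : ℝ) : ‖Complex.exp (Complex.I * φ u)‖ = 1 := by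
    rw [mul_comm]; exact Complex.norm_exp_ofReal_mul_I _
  have hparts := intervalIntegral.integral_mul_deriv_eq_deriv_mul (a := a) (b := b)
    (u := fun v => (g v : ℂ)) (u' := fun v => (g' v : ℂ))
    (v := fun v => Complex.exp (Complex.I * φ v))
    (v' := fun v => Complex.I * φ' v * Complex.exp (Complex.I * φ v))
    (fun u hx => (hg u (hu ▸ hx)).ofReal_comp) (fun u hx => hE u (hu ▸ hx))
    (by
      refine ContinuousOn.intervalIntegrable ?_
      rw [hu]; exact Complex.continuous_ofReal.comp_continuousOn hg')
    (by
      refine ContinuousOn.intervalIntegrable ?_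
      rw [hu]
      exact (continuousOn_const.mul (Complex.continuous_ofReal.comp_continuousOn hφ')).mul hEc)
  have h1 : ∫ u in a..b, ((g u * φ' u : ℝ) : ℂ) * Complex.exp (Complex.I * φ u)
      = -Complex.I * ∫ u in a..b, (g u : ℂ) * (Complex.I * φ' u * Complex.exp (Complex.I * φ u)) := by
    rw [← intervalIntegral.integral_const_mul]
    congr 1; funext u
    push_cast
    linear_combination (g u * φ' u * Complex.exp (Complex.I * φ u) : ℂ) * Complex.I_mul_I
  have h2 : ‖∫ u in a..b, (g' u : ℂ) * Complex.exp (Complex.I * φ u)‖ ≤ |g b - g a| := by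
    have hftc : ∫ u in a..b, g' u = g b - g a :=
      intervalIntegral.integral_eq_sub_of_hasDerivAt (fun u hx => hg u (hu ▸ hx)) hgint
    have hle : ‖∫ u in a..b, (g' u : ℂ) * Complex.exp (Complex.I * φ u)‖
        ≤ ∫ u in a..b, |g' u| := by
      refine (intervalIntegral.norm_integral_le_integral_norm hab).trans_eq ?_
      congr 1; funext u
      rw [norm_mul, hnE, mul_one, Complex.norm_real, Real.norm_eq_abs]
    refine hle.trans ?_
    rcases hmono with h | h
    · rw [intervalIntegral.integral_congr (g := g') fun u hx => abs_of_nonneg (h u (hu ▸ hx)), hftc]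
      exact le_abs_self _
    · rw [intervalIntegral.integral_congr (g := fun u => -g' u)
        fun u hx => abs_of_nonpos (h u (hu ▸ hx)), intervalIntegral.integral_neg, hftc]
      exact neg_le_abs _
  rw [h1, hparts, norm_mul, norm_neg, Complex.norm_I, one_mul]
  refine (norm_sub_le _ _).trans (add_le_add ((norm_sub_le _ _).trans ?_) h2)
  rw [norm_mul, norm_mul, hnE, hnE, Complex.norm_real, Complex.norm_real, Real.norm_eq_abs,
    Real.norm_eq_abs]
  linarith

/-- The phase `2πmu - t log u` of `u^(-it) e(mu)`. -/
noncomputable def phase (m t u : ℝ) : ℝ := 2 * Real.pi * m * u - t * Real.log u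

lemma hasDerivAt_phase (m t : ℝ) {u : ℝ} (hu : 0 < u) :
    HasDerivAt (phase m t) ((2 * Real.pi * m * u - t) / u) u := by
  have h := ((hasDerivAt_id u).const_mul (2 * Real.pi * m)).sub
    ((Real.hasDerivAt_log hu.ne').const_mul t)
  refine h.congr_deriv ?_
  field_simp

lemma cpow_mul_e_eq (m : ℝ) (c : ℂ) {u : ℝ} (hu : 0 < u) :
    (u : ℂ) ^ c * e (m * u)
      = ((u ^ c.re : ℝ) : ℂ) * Complex.exp (Complex.I * phase m (-c.im) u) := by
  have huC : (u : ℂ) ≠ 0 := by exact_mod_cast hu.ne'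
  rw [Complex.cpow_def_of_ne_zero huC, Real.rpow_def_of_pos hu, Complex.ofReal_exp, e,
    ← Complex.exp_add, ← Complex.exp_add, ← Complex.ofReal_log hu.le]
  congr 1
  rw [phase]
  push_cast
  have hc : c = c.re + c.im * Complex.I := (Complex.re_add_im c).symm
  conv_lhs => rw [hc]
  ring

/-- The amplitude `u^p / (2πmu - t)` of an oscillatory integral `∫ u^(p-1) e^(i phase(u)) du`
relative to the derivative of its phase. -/
lemma hasDerivAt_amplitude (p m t : ℝ) {u : ℝ} (hu : 0 < u) (hD : 2 * Real.pi * m * u - t ≠ 0) :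
    HasDerivAt (fun u : ℝ => u ^ p / (2 * Real.pi * m * u - t))
      ((p * u ^ (p - 1) * (2 * Real.pi * m * u - t) - u ^ p * (2 * Real.pi * m))
        / (2 * Real.pi * m * u - t) ^ 2) u := by
  have h1 : HasDerivAt (fun u : ℝ => u ^ p) (p * u ^ (p - 1)) u :=
    Real.hasDerivAt_rpow_const (Or.inl hu.ne')
  have h2 : HasDerivAt (fun u : ℝ => 2 * Real.pi * m * u - t) (2 * Real.pi * m) u := by
    simpa using ((hasDerivAt_id u).const_mul (2 * Real.pi * m)).sub_const t
  exact h1.div h2 hD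

/-- The first derivative test for `∫ u^(c) e(mu) du`. -/
lemma norm_integral_cpow_mul_e_le {m : ℝ} {c : ℂ} {a b : ℝ} (ha : 0 < a) (hab : a ≤ b)
    (hD : ∀ u ∈ Icc a b, 2 * Real.pi * m * u + c.im ≠ 0)
    (hmono : (∀ u ∈ Icc a b, 0 ≤ (c.re + 1) * (2 * Real.pi * m * u + c.im) - u * (2 * Real.pi * m))
      ∨ ∀ u ∈ Icc a b, (c.re + 1) * (2 * Real.pi * m * u + c.im) - u * (2 * Real.pi * m) ≤ 0) :
    ‖∫ u in a..b, (u : ℂ) ^ c * e (m * u)‖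
      ≤ |a ^ (c.re + 1) / (2 * Real.pi * m * a + c.im)|
        + |b ^ (c.re + 1) / (2 * Real.pi * m * b + c.im)|
        + |b ^ (c.re + 1) / (2 * Real.pi * m * b + c.im)
          - a ^ (c.re + 1) / (2 * Real.pi * m * a + c.im)| := by
  have hpos {u : ℝ} (hu : u ∈ Icc a b) : 0 < u := ha.trans_le hu.1
  have hD' : ∀ u ∈ Icc a b, 2 * Real.pi * m * u - -c.im ≠ 0 := by simpa using hD
  have hrpow (p : ℝ) : ContinuousOn (fun u : ℝ => u ^ p) (Icc a b) := fun u hu =>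
    (Real.continuousAt_rpow_const _ _ (Or.inl (hpos hu).ne')).continuousWithinAt
  have hlin : ContinuousOn (fun u : ℝ => 2 * Real.pi * m * u - -c.im) (Icc a b) := by fun_prop
  have hfac {u : ℝ} (hu : u ∈ Icc a b) :
      (c.re + 1) * u ^ (c.re + 1 - 1) * (2 * Real.pi * m * u - -c.im)
        - u ^ (c.re + 1) * (2 * Real.pi * m)
      = u ^ c.re * ((c.re + 1) * (2 * Real.pi * m * u + c.im) - u * (2 * Real.pi * m)) := by
    rw [add_sub_cancel_right, Real.rpow_add_one (hpos hu).ne']; ring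
  have h := norm_integral_mul_deriv_mul_cexp_le hab
    (fun u hu => hasDerivAt_phase m (-c.im) (hpos hu))
    (fun u hu => hasDerivAt_amplitude (c.re + 1) m (-c.im) (hpos hu) (hD' u hu))
    (hlin.div continuousOn_id fun u hu => (hpos hu).ne')
    (((continuousOn_const.mul (hrpow _)).mul hlin).sub ((hrpow _).mul continuousOn_const) |>.div
      (hlin.pow 2) fun u hu => pow_ne_zero 2 (hD' u hu))
    (by
      refine hmono.imp (fun h u hu => ?_) (fun h u hu => ?_)
      · rw [hfac hu]
        exact div_nonneg (mul_nonneg (Real.rpow_nonneg (hpos hu).le _) (h u hu)) (sq_nonneg _)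
      · rw [hfac hu]
        exact div_nonpos_of_nonpos_of_nonneg
          (mul_nonpos_of_nonneg_of_nonpos (Real.rpow_nonneg (hpos hu).le _) (h u hu)) (sq_nonneg _))
  have hcongr : ∫ u in a..b, (u : ℂ) ^ c * e (m * u) = ∫ u in a..b,
      ((u ^ (c.re + 1) / (2 * Real.pi * m * u - -c.im) * ((2 * Real.pi * m * u - -c.im) / u) : ℝ) : ℂ)
        * Complex.exp (Complex.I * phase m (-c.im) u) := by
    refine intervalIntegral.integral_congr fun u hu => ?_
    rw [uIcc_of_le hab] at hu
    have h0 := (hpos hu).ne'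
    have h1 := hD' u hu
    rw [cpow_mul_e_eq m c (hpos hu), Real.rpow_add_one h0]
    congr 2
    generalize 2 * Real.pi * m * u - -c.im = D at h1 ⊢
    field_simp
  rw [hcongr]
  simpa only [sub_neg_eq_add] using h

/-- The tail integral, when there is no stationary point in `[x, ∞)`: for `m > 0` it lies to the
left of `x`, for `m < 0` there is none. -/
lemma norm_integral_tail_le {m : ℝ} {s : ℂ} (hσ : 0 ≤ s.re) (ht : 0 ≤ s.im) {x R : ℝ} (hx : 0 < x)
    (hR : x ≤ R) (hm : m < 0 ∨ 0 < m ∧ s.im < 2 * Real.pi * m * x) :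
    ‖∫ u in x..R, (u : ℂ) ^ (-s - 1) * e (m * u)‖
      ≤ 2 * (x ^ (-s.re) / |2 * Real.pi * m * x - s.im|) := by
  have hpi := Real.pi_pos
  have hre : (-s - 1).re + 1 = -s.re := by simp
  have him : (-s - 1).im = -s.im := by simp
  have hR0 : 0 < R := hx.trans_le hR
  have hxp : 0 < x ^ (-s.re) := Real.rpow_pos_of_pos hx _
  have hRp : 0 < R ^ (-s.re) := Real.rpow_pos_of_pos hR0 _
  have hle : R ^ (-s.re) ≤ x ^ (-s.re) := Real.rpow_le_rpow_of_nonpos hx hR (by linarith)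
  rcases hm with hm | ⟨hm, hmt⟩
  · have hDneg {u : ℝ} (hu : x ≤ u) : 2 * Real.pi * m * u - s.im < 0 := by
      have : 2 * Real.pi * m * u < 0 := by
        have := hx.trans_le hu
        have : 0 < 2 * Real.pi * (-m) * u := by have : 0 < -m := by linarith
                                                positivity
        linarith
      linarith
    have h := norm_integral_cpow_mul_e_le (m := m) (c := -s - 1) hx hR
      (fun u hu => by rw [him]; exact (hDneg hu.1).ne)
      (Or.inl fun u hu => by
        rw [hre, him]
        have h1 := hDneg hu.1
        have h2 : 0 < u := hx.trans_le hu.1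
        have h3 : 0 ≤ u * (2 * Real.pi * -m) := by have : 0 < -m := by linarith
                                                   positivity
        nlinarith)
    rw [hre, him, ← sub_eq_add_neg, ← sub_eq_add_neg] at h
    refine h.trans ?_
    have hDx := hDneg le_rfl
    have hDR := hDneg hR
    have hDle : 2 * Real.pi * m * R - s.im ≤ 2 * Real.pi * m * x - s.im := by
      have : 2 * Real.pi * (-m) * x ≤ 2 * Real.pi * (-m) * R := by
        have : 0 < -m := by linarith
        gcongr
      linarith
    have e1 : x ^ (-s.re) / (2 * Real.pi * m * x - s.im)
        = -(x ^ (-s.re) / |2 * Real.pi * m * x - s.im|) := by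
      rw [abs_of_neg hDx, div_neg, neg_neg]
    have e2 : R ^ (-s.re) / (2 * Real.pi * m * R - s.im)
        = -(R ^ (-s.re) / |2 * Real.pi * m * R - s.im|) := by
      rw [abs_of_neg hDR, div_neg, neg_neg]
    have h5 : R ^ (-s.re) / |2 * Real.pi * m * R - s.im|
        ≤ x ^ (-s.re) / |2 * Real.pi * m * x - s.im| := by
      have : 0 < |2 * Real.pi * m * x - s.im| := abs_pos.2 hDx.ne
      rw [abs_of_neg hDx] at this ⊢
      rw [abs_of_neg hDR]
      gcongr
    have h6 : 0 ≤ R ^ (-s.re) / |2 * Real.pi * m * R - s.im| := by positivity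
    rw [e1, e2]
    generalize x ^ (-s.re) / |2 * Real.pi * m * x - s.im| = A at h5 ⊢
    generalize R ^ (-s.re) / |2 * Real.pi * m * R - s.im| = B at h5 h6 ⊢
    rw [abs_neg, abs_neg, abs_of_nonneg h6, abs_of_nonneg (h6.trans h5),
      abs_of_nonneg (by linarith)]
    linarith
  · have hDpos {u : ℝ} (hu : x ≤ u) : 0 < 2 * Real.pi * m * u - s.im := by
      have : 2 * Real.pi * m * x ≤ 2 * Real.pi * m * u := by gcongr
      linarith
    have h := norm_integral_cpow_mul_e_le (m := m) (c := -s - 1) hx hR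
      (fun u hu => by rw [him]; exact (hDpos hu.1).ne')
      (Or.inr fun u hu => by
        rw [hre, him]
        have h1 := hDpos hu.1
        have h2 : 0 < u := hx.trans_le hu.1
        have h3 : 0 ≤ u * (2 * Real.pi * m) := by positivity
        nlinarith)
    rw [hre, him, ← sub_eq_add_neg, ← sub_eq_add_neg] at h
    refine h.trans ?_
    have hDx := hDpos le_rfl
    have hDR := hDpos hR
    have h5 : R ^ (-s.re) / (2 * Real.pi * m * R - s.im)
        ≤ x ^ (-s.re) / (2 * Real.pi * m * x - s.im) := by
      gcongr
    have h6 : 0 ≤ R ^ (-s.re) / (2 * Real.pi * m * R - s.im) := by positivity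
    rw [abs_of_nonneg h6, abs_of_nonneg (h6.trans h5), abs_of_nonpos (by linarith),
      abs_of_pos hDx]
    linarith

/-- The head integral up to `b`, when the stationary point lies to the right of `b`. -/
lemma norm_integral_head_le {ν : ℝ} (hν : 0 ≤ ν) {s : ℂ} (hσ : s.re < 1) {b : ℝ} (hb : 0 < b)
    (ht : 2 * Real.pi * ν * b < s.im) :
    ‖∫ u in (0 : ℝ)..b, (u : ℂ) ^ (-s) * e (ν * u)‖
      ≤ 2 * (b ^ (1 - s.re) / (s.im - 2 * Real.pi * ν * b)) := by
  have hpi := Real.pi_pos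
  have hre : (-s).re + 1 = 1 - s.re := by simp; ring
  have him : (-s).im = -s.im := by simp
  have hcut {ε : ℝ} (hε : 0 < ε) (hεb : ε ≤ b) :
      ‖∫ u in ε..b, (u : ℂ) ^ (-s) * e (ν * u)‖
        ≤ 2 * (b ^ (1 - s.re) / (s.im - 2 * Real.pi * ν * b)) := by
    have hD {u : ℝ} (hu : u ≤ b) : 0 < s.im - 2 * Real.pi * ν * u := by
      have : 2 * Real.pi * ν * u ≤ 2 * Real.pi * ν * b := by gcongr
      linarith
    have h := norm_integral_cpow_mul_e_le (m := ν) (c := -s) hε hεb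
      (fun u hu => by rw [him]; linarith [hD hu.2])
      (Or.inr fun u hu => by
        rw [hre, him]
        have h1 := hD hu.2
        have h2 : 0 < u := hε.trans_le hu.1
        have h3 : 0 ≤ u * (2 * Real.pi * ν) := by positivity
        nlinarith)
    rw [hre, him] at h
    refine h.trans ?_
    have e1 (u : ℝ) : u ^ (1 - s.re) / (2 * Real.pi * ν * u + -s.im)
        = -(u ^ (1 - s.re) / (s.im - 2 * Real.pi * ν * u)) := by
      rw [← div_neg]; congr 1; ring
    have hDb := hD le_rfl
    have hDε := hD hεb
    have h5 : ε ^ (1 - s.re) / (s.im - 2 * Real.pi * ν * ε)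
        ≤ b ^ (1 - s.re) / (s.im - 2 * Real.pi * ν * b) := by
      have : ε ^ (1 - s.re) ≤ b ^ (1 - s.re) := Real.rpow_le_rpow hε.le hεb (by linarith)
      gcongr
    have h6 : 0 ≤ ε ^ (1 - s.re) / (s.im - 2 * Real.pi * ν * ε) := by positivity
    rw [e1, e1, abs_neg, abs_neg, abs_of_nonneg h6, abs_of_nonneg (h6.trans h5),
      abs_of_nonpos (by linarith)]
    linarith
  have hint : IntervalIntegrable (fun u : ℝ => (u : ℂ) ^ (-s) * e (ν * u)) volume 0 b :=
    (intervalIntegral.intervalIntegrable_cpow' (by simp; linarith)).mul_continuousOn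
      (continuous_e_mul ν).continuousOn
  have hlim : Tendsto (fun ε => ∫ u in ε..b, (u : ℂ) ^ (-s) * e (ν * u)) (𝓝[>] 0)
      (𝓝 (∫ u in (0 : ℝ)..b, (u : ℂ) ^ (-s) * e (ν * u))) := by
    have hc := intervalIntegral.continuousOn_primitive_interval_left (a := 0) (b := b) (μ := volume)
      (f := fun u : ℝ => (u : ℂ) ^ (-s) * e (ν * u)) (by
        rw [uIcc_of_le hb.le]
        exact (intervalIntegrable_iff_integrableOn_Icc_of_le hb.le).1 hint)
    rw [uIcc_of_le hb.le] at hc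
    exact (hc 0 ⟨le_rfl, hb.le⟩).mono_left (nhdsWithin_le_of_mem (Icc_mem_nhdsGT hb))
  refine le_of_tendsto hlim.norm ?_
  filter_upwards [Ioc_mem_nhdsGT hb] with ε hε
  exact hcut hε.1 hε.2

/-! ### Bounds for the tail and head integrals -/

lemma norm_natCast_cpow_mul_rpow {q : ℕ} (hq : 0 < q) {X : ℝ} (hX : 0 < X) (s : ℂ) :
    ‖(q : ℂ) ^ (-s)‖ * (X / q) ^ (-s.re) = X ^ (-s.re) := by
  have hq' : (0 : ℝ) < q := by exact_mod_cast hq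
  rw [Complex.norm_natCast_cpow_of_pos hq, Complex.neg_re, ← Real.mul_rpow hq'.le (by positivity),
    mul_div_cancel₀ _ hq'.ne']

lemma norm_cpow_mul_e (c : ℂ) (m : ℝ) {u : ℝ} (hu : 0 < u) :
    ‖(u : ℂ) ^ c * e (m * u)‖ = u ^ c.re := by
  rw [norm_mul, norm_e, mul_one, Complex.norm_cpow_eq_rpow_re_of_pos hu]

/-- The trivial bound for `∫ u^c e(mu) du` with a decreasing amplitude. -/
lemma norm_integral_cpow_mul_e_le_mul {c : ℂ} (hc : c.re ≤ 0) (m : ℝ) {a b : ℝ} (ha : 0 < a)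
    (hab : a ≤ b) : ‖∫ u in a..b, (u : ℂ) ^ c * e (m * u)‖ ≤ a ^ c.re * (b - a) := by
  have h := intervalIntegral.norm_integral_le_of_norm_le_const (a := a) (b := b)
    (f := fun u : ℝ => (u : ℂ) ^ c * e (m * u)) (C := a ^ c.re) (fun u hu => by
      rw [uIoc_of_le hab] at hu
      rw [norm_cpow_mul_e c m (ha.trans hu.1)]
      exact Real.rpow_le_rpow_of_nonpos ha hu.1.le hc)
  rwa [abs_of_nonneg (by linarith)] at h

lemma intervalIntegrable_cpow_mul_e (c : ℂ) (m : ℝ) {a b : ℝ} (ha : 0 < a) (hb : 0 < b) :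
    IntervalIntegrable (fun u : ℝ => (u : ℂ) ^ c * e (m * u)) volume a b := by
  refine ContinuousOn.intervalIntegrable
    (((continuousOn_ofReal_cpow c).mono fun u hu => ?_).mul (continuous_e_mul m).continuousOn)
  exact (lt_min ha hb).trans_le hu.1

lemma norm_tailIntegral_le_of_forall {q : ℕ} {m : ℤ} (hm : m ≠ 0) {x : ℝ} (hx : 0 < x) {s : ℂ}
    (hs : -1 < s.re) {B : ℝ}
    (h : ∀ R, x ≤ R → ‖∫ u in x..R, (u : ℂ) ^ (-s - 1) * e ((m : ℝ) * u)‖ ≤ B) :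
    ‖tailIntegral q m x s‖ ≤ ‖(q : ℂ) ^ (-s)‖ * B := by
  rw [tailIntegral_eq hm hx hs]
  refine le_of_tendsto (tendsto_tailTrunc hm hx hs).norm ?_
  filter_upwards [eventually_ge_atTop x] with R hR
  rw [tailTrunc_eq_mul_integral m hx hR s, norm_mul]
  exact mul_le_mul_of_nonneg_left (h R hR) (norm_nonneg _)

lemma norm_tailIntegral_le {q : ℕ} (hq : 0 < q) {m : ℤ} {s : ℂ} (hσ : 0 ≤ s.re)
    (ht : 0 ≤ s.im) {X : ℝ} (hX : 0 < X)
    (hm : (m : ℝ) < 0 ∨ 0 < (m : ℝ) ∧ s.im < 2 * Real.pi * m * (X / q)) :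
    ‖tailIntegral q m (X / q) s‖ ≤ X ^ (-s.re) * (2 / |2 * Real.pi * m * (X / q) - s.im|) := by
  have hq' : (0 : ℝ) < q := by exact_mod_cast hq
  have hx : 0 < X / q := by positivity
  have hm0 : m ≠ 0 := by rintro rfl; simp at hm
  refine (norm_tailIntegral_le_of_forall hm0 hx (by linarith)
    fun R hR => norm_integral_tail_le hσ ht hx hR hm).trans_eq ?_
  rw [← norm_natCast_cpow_mul_rpow hq hX s]
  ring

/-- The trivial bound for the tail integral; it blows up at `Re s = 0`, but not after
multiplication by `Re s`. -/
lemma re_mul_norm_tailIntegral_le {q : ℕ} (hq : 0 < q) {m : ℤ} (hm : m ≠ 0) {s : ℂ}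
    (hσ : 0 ≤ s.re) {X : ℝ} (hX : 0 < X) :
    s.re * ‖tailIntegral q m (X / q) s‖ ≤ X ^ (-s.re) := by
  have hq' : (0 : ℝ) < q := by exact_mod_cast hq
  have hx : 0 < X / q := by positivity
  rcases hσ.eq_or_lt with h0 | hpos
  · rw [← h0, zero_mul]; positivity
  have key := norm_tailIntegral_le_of_forall (q := q) hm hx (s := s) (by linarith)
    (B := (X / q) ^ (-s.re) / s.re) fun R hR => by
      have hR0 : 0 < R := hx.trans_le hR
      have h0 : (0 : ℝ) ∉ uIcc (X / q) R := by
        rw [uIcc_of_le hR]; exact fun h => absurd h.1 (not_le.2 hx)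
      have hle : ‖∫ u in (X / q)..R, (u : ℂ) ^ (-s - 1) * e ((m : ℝ) * u)‖
          ≤ ∫ u in (X / q)..R, u ^ (-s.re - 1) := by
        refine (intervalIntegral.norm_integral_le_integral_norm hR).trans_eq ?_
        refine intervalIntegral.integral_congr fun u hu => ?_
        rw [uIcc_of_le hR] at hu
        rw [norm_cpow_mul_e _ _ (hx.trans_le hu.1)]
        simp
      refine hle.trans ?_
      rw [integral_rpow (Or.inr ⟨by linarith, h0⟩), sub_add_cancel, div_neg, ← neg_div, neg_sub]
      have : 0 < R ^ (-s.re) := by positivity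
      gcongr
      linarith
  calc s.re * ‖tailIntegral q m (X / q) s‖
      ≤ s.re * (‖(q : ℂ) ^ (-s)‖ * ((X / q) ^ (-s.re) / s.re)) := by gcongr
    _ = X ^ (-s.re) := by
      rw [← norm_natCast_cpow_mul_rpow hq hX s]; field_simp

/-- The tail integral when the stationary point lies at most at `x = X/q`: an initial piece of
length `x/√t` is estimated trivially. -/
lemma norm_tailIntegral_le_sqrt {q : ℕ} (hq : 0 < q) {m : ℤ} (hm : 0 < m) {s : ℂ} (hσ : 0 ≤ s.re)
    (ht : 0 < s.im) {X : ℝ} (hX : 0 < X) (hmt : s.im ≤ 2 * Real.pi * m * (X / q)) :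
    ‖tailIntegral q m (X / q) s‖ ≤ X ^ (-s.re) * (3 / √s.im) := by
  have hq' : (0 : ℝ) < q := by exact_mod_cast hq
  have hm' : (0 : ℝ) < m := by exact_mod_cast hm
  have hpi := Real.pi_pos
  rw [← norm_natCast_cpow_mul_rpow hq hX s, mul_assoc]
  have hx : 0 < X / q := by positivity
  generalize X / q = x at hx hmt ⊢
  refine norm_tailIntegral_le_of_forall hm.ne' hx (by linarith) fun R hR => ?_
  have hr : 0 < √s.im := Real.sqrt_pos.2 ht
  have hsq : √s.im * √s.im = s.im := Real.mul_self_sqrt ht.le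
  generalize √s.im = r at hr hsq ⊢
  have hre : (-s - 1).re = -s.re - 1 := by simp
  have hre' : (-s - 1).re ≤ 0 := by rw [hre]; linarith
  have hpow : x ^ (-s - 1).re * x = x ^ (-s.re) := by
    rw [hre, ← Real.rpow_add_one hx.ne', sub_add_cancel]
  have hpos : 0 < x ^ (-s.re) := Real.rpow_pos_of_pos hx _
  have htriv {b : ℝ} (hb : x ≤ b) (hb' : b ≤ x + x / r) :
      ‖∫ u in x..b, (u : ℂ) ^ (-s - 1) * e ((m : ℝ) * u)‖ ≤ x ^ (-s.re) * (1 / r) := by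
    refine (norm_integral_cpow_mul_e_le_mul hre' _ hx hb).trans ?_
    calc x ^ (-s - 1).re * (b - x) ≤ x ^ (-s - 1).re * (x / r) := by gcongr; linarith
      _ = x ^ (-s.re) * (1 / r) := by rw [← hpow]; ring
  rcases le_total R (x + x / r) with hRx | hRx
  · refine (htriv hR hRx).trans ?_
    gcongr
    norm_num
  · have hxh : x < x + x / r := by have := div_pos hx hr; linarith
    have hxh0 : 0 < x + x / r := hx.trans hxh
    have hgap : r ≤ 2 * Real.pi * m * (x + x / r) - s.im := by
      have h1 : r ≤ 2 * Real.pi * m * x / r := by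
        rw [le_div_iff₀ hr, hsq]; exact hmt
      have h2 : 2 * Real.pi * m * (x + x / r) = 2 * Real.pi * m * x + 2 * Real.pi * m * x / r := by
        ring
      linarith
    have h2 := norm_integral_tail_le (m := (m : ℝ)) hσ ht.le hxh0 hRx (Or.inr ⟨hm', by linarith⟩)
    have h3 : (x + x / r) ^ (-s.re) / |2 * Real.pi * m * (x + x / r) - s.im|
        ≤ x ^ (-s.re) / r := by
      rw [abs_of_pos (hr.trans_le hgap)]
      have : (x + x / r) ^ (-s.re) ≤ x ^ (-s.re) :=
        Real.rpow_le_rpow_of_nonpos hx hxh.le (by linarith)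
      gcongr
    rw [← intervalIntegral.integral_add_adjacent_intervals
      (intervalIntegrable_cpow_mul_e _ _ hx hxh0)
      (intervalIntegrable_cpow_mul_e _ _ hxh0 (hxh0.trans_le hRx))]
    refine (norm_add_le _ _).trans ((add_le_add (htriv hxh.le le_rfl) (h2.trans
      (mul_le_mul_of_nonneg_left h3 two_pos.le))).trans_eq ?_)
    ring

/-- Bounds for `∫_0^x u^(-s) e(νu) du` on `Re s < 1` carry over to the head integral on
`Re s ≤ 1`. -/
lemma norm_headIntegral_le_of_forall {q ν : ℕ} (hq : 0 < q) (hν : 1 ≤ ν) {s : ℂ}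
    (hs0 : 0 ≤ s.re) (hs1 : s.re ≤ 1) (him : s.im ≠ 0) {X A : ℝ} (hX : 0 < X)
    (h : ∀ s' : ℂ, 0 ≤ s'.re → s'.re < 1 → s'.im = s.im →
      ‖∫ u in (0 : ℝ)..(X / q), (u : ℂ) ^ (-s') * e ((ν : ℝ) * u)‖ ≤ (X / q) ^ (-s'.re) * A) :
    ‖headIntegral q ν (X / q) s‖ ≤ X ^ (-s.re) * A := by
  have hq' : (0 : ℝ) < q := by exact_mod_cast hq
  have hx : 0 < X / q := by positivity
  have hlt {s' : ℂ} (h0 : 0 ≤ s'.re) (h1 : s'.re < 1) (h2 : s'.im = s.im) :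
      ‖∫ u in (0 : ℝ)..(X / q), headIntegrand q ν s' u‖ ≤ X ^ (-s'.re) * A := by
    have heq : ∫ u in (0 : ℝ)..(X / q), headIntegrand q ν s' u
        = (q : ℂ) ^ (-s') * ∫ u in (0 : ℝ)..(X / q), (u : ℂ) ^ (-s') * e ((ν : ℝ) * u) := by
      rw [← intervalIntegral.integral_const_mul]
      refine intervalIntegral.integral_congr fun u hu => ?_
      rw [uIcc_of_le hx.le] at hu
      exact headIntegrand_eq q ν s' hu.1
    rw [heq, norm_mul, ← norm_natCast_cpow_mul_rpow hq hX s', mul_assoc]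
    exact mul_le_mul_of_nonneg_left (h s' h0 h1 h2) (norm_nonneg _)
  rcases hs1.lt_or_eq with h1 | h1
  · rw [headIntegral, if_pos h1]
    exact hlt hs0 h1 rfl
  · rw [headIntegral_eq hq.ne' hν hx hs0 hs1 him]
    have hcont : Tendsto (fun δ : ℝ => X ^ (-(s.re - δ)) * A) (𝓝[>] 0) (𝓝 (X ^ (-s.re) * A)) := by
      have : Continuous fun δ : ℝ => X ^ (-(s.re - δ)) * A := by
        refine Continuous.mul (Continuous.rpow continuous_const (by fun_prop)
          fun _ => Or.inl hX.ne') continuous_const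
      have h := (this.tendsto 0).mono_left (nhdsWithin_le_nhds (s := Ioi 0))
      simpa using h
    refine le_of_tendsto_of_tendsto
      (tendsto_integral_headIntegrand hq.ne' hν hx hs0 hs1 him).norm hcont ?_
    filter_upwards [Ioo_mem_nhdsGT (zero_lt_one' ℝ)] with δ hδ
    have hre : (s - (δ : ℂ)).re = s.re - δ := by simp
    have := hlt (s' := s - (δ : ℂ)) (by rw [hre]; linarith [hδ.2]) (by rw [hre]; linarith [hδ.1])
      (by simp)
    rwa [hre] at this

lemma norm_headIntegral_le {q ν : ℕ} (hq : 0 < q) (hν : 1 ≤ ν) {s : ℂ} (hs0 : 0 ≤ s.re)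
    (hs1 : s.re ≤ 1) {X : ℝ} (hX : 0 < X) (ht : 2 * Real.pi * ν * (X / q) < s.im) :
    ‖headIntegral q ν (X / q) s‖
      ≤ X ^ (-s.re) * (2 * (X / q) / (s.im - 2 * Real.pi * ν * (X / q))) := by
  have hq' : (0 : ℝ) < q := by exact_mod_cast hq
  have hpi := Real.pi_pos
  have hx : 0 < X / q := by positivity
  have him : s.im ≠ 0 := (lt_of_le_of_lt (by positivity) ht).ne'
  refine norm_headIntegral_le_of_forall hq hν hs0 hs1 him hX fun s' _ h1 h2 => ?_
  refine (norm_integral_head_le (by positivity) h1 hx (by rwa [h2])).trans_eq ?_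
  rw [h2, sub_eq_neg_add, Real.rpow_add_one hx.ne']
  ring

/-- The head integral when the stationary point lies at least at `x = X/q`: a final piece of
length about `x/√t` is estimated trivially. -/
lemma norm_headIntegral_le_sqrt {q ν : ℕ} (hq : 0 < q) (hν : 1 ≤ ν) {s : ℂ} (hs0 : 0 ≤ s.re)
    (hs1 : s.re ≤ 1) {X : ℝ} (hX : 0 < X) (ht : 0 < s.im)
    (hνt : 2 * Real.pi * ν * (X / q) ≤ s.im) :
    ‖headIntegral q ν (X / q) s‖ ≤ X ^ (-s.re) * ((X / q) * ((4 + 4 / √s.im) / √s.im)) := by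
  have hq' : (0 : ℝ) < q := by exact_mod_cast hq
  have hν' : (1 : ℝ) ≤ ν := by exact_mod_cast hν
  have hpi := Real.pi_pos
  refine norm_headIntegral_le_of_forall hq hν hs0 hs1 ht.ne' hX fun s' h0 h1 h2 => ?_
  rw [← h2] at ht hνt ⊢
  have hx : 0 < X / q := by positivity
  generalize X / q = x at hx hνt ⊢
  have hr : 0 < √s'.im := Real.sqrt_pos.2 ht
  have hsq : √s'.im * √s'.im = s'.im := Real.mul_self_sqrt ht.le
  generalize √s'.im = r at hr hsq ⊢
  -- the cut `b = x - x/(2 + √t)` stays above `x/2`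
  obtain ⟨b, hb⟩ : ∃ b, b = x - x / (2 + r) := ⟨_, rfl⟩
  have hh : 0 < x / (2 + r) := by positivity
  have hh2 : x / (2 + r) ≤ x / 2 := by gcongr; linarith
  have hbx : b ≤ x := by linarith
  have hb2 : x / 2 ≤ b := by linarith
  have hb0 : 0 < b := by linarith
  have hgap : s'.im / (2 + r) ≤ s'.im - 2 * Real.pi * ν * b := by
    have h3 : 2 * Real.pi * ν ≤ s'.im / x := by rw [le_div_iff₀ hx]; exact hνt
    have h4 : 2 * Real.pi * ν * b ≤ s'.im / x * b := by gcongr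
    have h5 : s'.im / x * b = s'.im - s'.im / (2 + r) := by
      rw [hb]; field_simp
    linarith
  have hgap0 : 0 < s'.im / (2 + r) := by positivity
  have hfirst : ‖∫ u in (0 : ℝ)..b, (u : ℂ) ^ (-s') * e ((ν : ℝ) * u)‖
      ≤ x ^ (-s'.re) * (x * (2 * (2 + r) / s'.im)) := by
    refine (norm_integral_head_le (by positivity) h1 hb0 (by linarith)).trans ?_
    have h3 : b ^ (1 - s'.re) ≤ x ^ (1 - s'.re) := Real.rpow_le_rpow hb0.le hbx (by linarith)
    calc 2 * (b ^ (1 - s'.re) / (s'.im - 2 * Real.pi * ν * b))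
        ≤ 2 * (x ^ (1 - s'.re) / (s'.im / (2 + r))) := by gcongr
      _ = x ^ (-s'.re) * (x * (2 * (2 + r) / s'.im)) := by
        rw [sub_eq_neg_add, Real.rpow_add_one hx.ne']; field_simp
  have hsecond : ‖∫ u in b..x, (u : ℂ) ^ (-s') * e ((ν : ℝ) * u)‖
      ≤ x ^ (-s'.re) * (x * (2 / r)) := by
    refine (norm_integral_cpow_mul_e_le_mul (by simpa using h0) _ hb0 hbx).trans ?_
    have h3 : b ^ (-s'.re) ≤ 2 * x ^ (-s'.re) := by
      calc b ^ (-s'.re) ≤ (x / 2) ^ (-s'.re) :=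
            Real.rpow_le_rpow_of_nonpos (by positivity) hb2 (by linarith)
        _ = 2 ^ s'.re * x ^ (-s'.re) := by
          rw [Real.div_rpow hx.le two_pos.le, Real.rpow_neg two_pos.le, div_inv_eq_mul, mul_comm]
        _ ≤ 2 ^ (1 : ℝ) * x ^ (-s'.re) := by
          have : (2 : ℝ) ^ s'.re ≤ 2 ^ (1 : ℝ) :=
            Real.rpow_le_rpow_of_exponent_le one_le_two h1.le
          gcongr
        _ = 2 * x ^ (-s'.re) := by rw [Real.rpow_one]
    have h4 : x - b ≤ x / r := by
      rw [hb, sub_sub_cancel]; gcongr; linarith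
    rw [Complex.neg_re]
    calc b ^ (-s'.re) * (x - b) ≤ (2 * x ^ (-s'.re)) * (x / r) := by
          gcongr
      _ = x ^ (-s'.re) * (x * (2 / r)) := by ring
  have hint : IntervalIntegrable (fun u : ℝ => (u : ℂ) ^ (-s') * e ((ν : ℝ) * u)) volume 0 b :=
    (intervalIntegral.intervalIntegrable_cpow' (by simp; linarith)).mul_continuousOn
      (continuous_e_mul ν).continuousOn
  rw [← intervalIntegral.integral_add_adjacent_intervals hint
    (intervalIntegrable_cpow_mul_e _ _ hb0 hx)]
  refine (norm_add_le _ _).trans ((add_le_add hfirst hsecond).trans_eq ?_)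
  rw [← hsq]
  field_simp
  ring

/-! ### The estimate of `K₂` -/

lemma norm_weight_mul_le {a T s : ℂ} (ha : ‖a‖ ≤ 1) (ν : ℕ) :
    ‖a * (s / (2 * (Real.pi : ℂ) * Complex.I * (ν : ℂ))) * T‖
      ≤ ‖s‖ * ‖T‖ / (2 * Real.pi * ν) := by
  have h : ‖s / (2 * (Real.pi : ℂ) * Complex.I * (ν : ℂ))‖ = ‖s‖ / (2 * Real.pi * ν) := by
    simp [abs_of_pos Real.pi_pos]
  rw [norm_mul, norm_mul, h]
  have h0 : 0 ≤ ‖s‖ / (2 * Real.pi * ν) := by have := Real.pi_pos; positivity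
  calc ‖a‖ * (‖s‖ / (2 * Real.pi * ν)) * ‖T‖ ≤ 1 * (‖s‖ / (2 * Real.pi * ν)) * ‖T‖ := by gcongr
    _ = ‖s‖ * ‖T‖ / (2 * Real.pi * ν) := by ring

lemma norm_le_re_add_im {s : ℂ} (hσ : 0 ≤ s.re) (ht : 0 ≤ s.im) : ‖s‖ ≤ s.re + s.im := by
  have := Complex.norm_le_abs_re_add_abs_im s
  rwa [abs_of_nonneg hσ, abs_of_nonneg ht] at this

lemma norm_sum_le_of_subsingleton {S : Finset ℕ} {f : ℕ → ℂ} {B : ℝ} (hB : 0 ≤ B)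
    (hS : ∀ a ∈ S, ∀ b ∈ S, a = b) (hf : ∀ a ∈ S, ‖f a‖ ≤ B) : ‖∑ a ∈ S, f a‖ ≤ B := by
  have h1 : S.card ≤ 1 := Finset.card_le_one.2 hS
  have h2 : (S.card : ℝ) ≤ 1 := by exact_mod_cast h1
  refine (norm_sum_le_of_le S hf).trans ?_
  rw [Finset.sum_const, nsmul_eq_mul]
  exact mul_le_of_le_one_left hB h2

lemma natCast_eq_of_mem_interval {z η : ℝ} (hη : η < 1) {a b : ℕ} (ha : z < a) (ha' : (a : ℝ) < z + η)
    (hb : z < b) (hb' : (b : ℝ) < z + η) : a = b := by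
  have h1 : a < b + 1 := by exact_mod_cast (by linarith : (a : ℝ) < b + 1)
  have h2 : b < a + 1 := by exact_mod_cast (by linarith : (b : ℝ) < a + 1)
  omega

section Estimates

variable {q : ℕ} [NeZero q]

/-- Both sums in `K₂` have at most one term, and `q(1 + t)/(2πy) = X(1 + 1/t)`. -/
lemma norm_K₂_le {χ : DirichletCharacter ℂ q} (hχ : χ.IsPrimitive) {s : ℂ} {X y η c : ℝ}
    (hs0 : 0 ≤ s.re) (hs1 : s.re ≤ 1) (hX : 0 < X) (hy : 0 < y)
    (ht : 2 * Real.pi * (X / q) * y = s.im) (hη1 : η < 1) (hc : 0 < c) (hct : c ≤ s.im) :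
    ‖K₂ χ s X y η‖
      ≤ (3 * (1 + 1 / c) + (4 + 4 / √c)) * (X ^ (1 - s.re) / √(q * s.im)) := by
  have hq : 0 < q := NeZero.pos q
  have hq' : (0 : ℝ) < q := by exact_mod_cast hq
  have hpi := Real.pi_pos
  have ht0 : 0 < s.im := hc.trans_le hct
  have hr : 0 < √s.im := Real.sqrt_pos.2 ht0
  have hQ : 0 < √(q : ℝ) := Real.sqrt_pos.2 hq'
  have hQ2 : √(q : ℝ) * √(q : ℝ) = q := Real.mul_self_sqrt hq'.le
  have hW : 0 < X ^ (-s.re) := Real.rpow_pos_of_pos hX _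
  have hx : 0 < X / q := by positivity
  have hmain : X ^ (1 - s.re) / √(q * s.im) = X ^ (-s.re) * (X / (√q * √s.im)) := by
    rw [Real.sqrt_mul hq'.le, sub_eq_neg_add, Real.rpow_add_one hX.ne']; ring
  have hpos (ν : ℕ) (hν : y < ν) : ‖posTerm χ s X ν‖
      ≤ X ^ (-s.re) * (3 * (1 + s.im) / (2 * Real.pi * y * √s.im)) := by
    have hν0 : (0 : ℝ) < ν := hy.trans hν
    have hνZ : (0 : ℤ) < (ν : ℤ) := by exact_mod_cast hν0
    have h1 := norm_tailIntegral_le_sqrt hq hνZ hs0 ht0 hX (by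
      rw [← ht]
      push_cast
      calc 2 * Real.pi * (X / q) * y = 2 * Real.pi * y * (X / q) := by ring
        _ ≤ 2 * Real.pi * ν * (X / q) := by gcongr)
    refine (norm_weight_mul_le (norm_conj_char_le χ _) ν).trans ?_
    have h2 : ‖s‖ ≤ 1 + s.im := (norm_le_re_add_im hs0 ht0.le).trans (by linarith)
    calc ‖s‖ * ‖tailIntegral q (ν : ℤ) (X / q) s‖ / (2 * Real.pi * ν)
        ≤ (1 + s.im) * (X ^ (-s.re) * (3 / √s.im)) / (2 * Real.pi * y) := by gcongr
      _ = X ^ (-s.re) * (3 * (1 + s.im) / (2 * Real.pi * y * √s.im)) := by field_simp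
  have hhead (ν : ℕ) (hν1 : 1 ≤ ν) (hν : (ν : ℝ) ≤ y) : ‖headTerm χ s X ν‖
      ≤ X ^ (-s.re) * ((X / q) * ((4 + 4 / √c) / √s.im)) := by
    have h1 := norm_headIntegral_le_sqrt hq hν1 hs0 hs1 hX ht0 (by
      rw [← ht]
      calc 2 * Real.pi * ν * (X / q) ≤ 2 * Real.pi * y * (X / q) := by gcongr
        _ = 2 * Real.pi * (X / q) * y := by ring)
    have h2 : √c ≤ √s.im := Real.sqrt_le_sqrt hct
    have h3 : 0 < √c := Real.sqrt_pos.2 hc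
    rw [headTerm, norm_mul]
    refine (mul_le_of_le_one_left (norm_nonneg _) (norm_conj_char_le χ _)).trans (h1.trans ?_)
    gcongr
  have hS1 : ‖∑ ν ∈ (Finset.Icc 1 ⌈y + η⌉₊).filter
      (fun ν : ℕ => y < (ν : ℝ) ∧ (ν : ℝ) < y + η), posTerm χ s X ν‖
      ≤ X ^ (-s.re) * (3 * (1 + s.im) / (2 * Real.pi * y * √s.im)) := by
    refine norm_sum_le_of_subsingleton (by positivity) (fun a ha b hb => ?_) fun a ha =>
      hpos a (Finset.mem_filter.1 ha).2.1
    rw [Finset.mem_filter] at ha hb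
    exact natCast_eq_of_mem_interval hη1 ha.2.1 ha.2.2 hb.2.1 hb.2.2
  have hS2 : ‖∑ ν ∈ (Finset.Icc 1 ⌊y⌋₊).filter (fun ν : ℕ => y - η < (ν : ℝ)), headTerm χ s X ν‖
      ≤ X ^ (-s.re) * ((X / q) * ((4 + 4 / √c) / √s.im)) := by
    have hmem (a : ℕ)
        (ha : a ∈ (Finset.Icc 1 ⌊y⌋₊).filter (fun ν : ℕ => y - η < (ν : ℝ))) :
        1 ≤ a ∧ (a : ℝ) ≤ y ∧ y - η < a := by
      rw [Finset.mem_filter, Finset.mem_Icc] at ha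
      exact ⟨ha.1.1, (Nat.le_floor_iff hy.le).1 ha.1.2, ha.2⟩
    refine norm_sum_le_of_subsingleton (by positivity) (fun a ha b hb => ?_) fun a ha =>
      hhead a (hmem a ha).1 (hmem a ha).2.1
    have ha' := hmem a ha
    have hb' := hmem b hb
    have h1 : a < b + 1 := by exact_mod_cast (by linarith : (a : ℝ) < b + 1)
    have h2 : b < a + 1 := by exact_mod_cast (by linarith : (b : ℝ) < a + 1)
    omega
  have hA : √q * (X ^ (-s.re) * (3 * (1 + s.im) / (2 * Real.pi * y * √s.im)))
      ≤ 3 * (1 + 1 / c) * (X ^ (-s.re) * (X / (√q * √s.im))) := by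
    -- `2πXy = qt`
    have hqt : 2 * Real.pi * y = q * s.im / X := by rw [← ht]; field_simp
    have h1 : √q * (X ^ (-s.re) * (3 * (1 + s.im) / (2 * Real.pi * y * √s.im)))
        = 3 * (1 + 1 / s.im) * (X ^ (-s.re) * (X / (√q * √s.im))) := by
      rw [hqt]
      generalize √(q : ℝ) = Q at hQ hQ2 ⊢
      rw [← hQ2]; field_simp; ring
    rw [h1]
    gcongr
  have hB : √q * (X ^ (-s.re) * ((X / q) * ((4 + 4 / √c) / √s.im)))
      = (4 + 4 / √c) * (X ^ (-s.re) * (X / (√q * √s.im))) := by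
    have : X / q = X / (√q * √q) := by rw [hQ2]
    rw [this]; field_simp
  rw [K₂, hmain, add_mul]
  refine (norm_sub_le _ _).trans ?_
  rw [norm_mul, norm_mul, norm_tau hχ]
  exact add_le_add ((mul_le_mul_of_nonneg_left hS1 hQ.le).trans hA)
    ((mul_le_mul_of_nonneg_left hS2 hQ.le).trans_eq hB)

end Estimates

/-! ### The estimate of `K₁` -/

lemma norm_tsum_subtype_le {p : ℕ → Prop} {f : ℕ → ℂ} {B : ℝ}
    (h : ∀ T : Finset ℕ, (∀ ν ∈ T, p ν) → ∑ ν ∈ T, ‖f ν‖ ≤ B) :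
    ‖∑' ν : {ν : ℕ // p ν}, f ν‖ ≤ B := by
  have hfin (T : Finset {ν : ℕ // p ν}) : ∑ ν ∈ T, ‖f ν‖ ≤ B := by
    have := h (T.map (Function.Embedding.subtype p)) (by simp +contextual)
    rwa [Finset.sum_map] at this
  have hsum : Summable fun ν : {ν : ℕ // p ν} => ‖f ν‖ :=
    summable_of_sum_le (fun _ => norm_nonneg _) hfin
  exact (norm_tsum_le_tsum_norm hsum).trans (hsum.tsum_le_of_sum_le hfin)

lemma sum_inv_le_of_injOn {T : Finset ℕ} {i : ℕ → ℕ} {N : ℕ} (hi : InjOn i T)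
    (h : ∀ ν ∈ T, i ν ∈ Finset.Icc 1 N) : ∑ ν ∈ T, ((i ν : ℝ))⁻¹ ≤ 1 + Real.log N := by
  rw [← Finset.sum_image (f := fun n : ℕ => ((n : ℝ))⁻¹) hi]
  refine (Finset.sum_le_sum_of_subset_of_nonneg ?_ fun _ _ _ => by positivity).trans
    (sum_Icc_inv_le N)
  intro n hn
  obtain ⟨ν, hν, rfl⟩ := Finset.mem_image.1 hn
  exact h ν hν

/-- A sum is at most its part up to `N ≥ D` and `1`, when its terms beyond `N` are at most
`D/ν²`. -/
lemma sum_le_add_one_of_le_div_sq {T : Finset ℕ} {f : ℕ → ℝ} {N : ℕ} {D : ℝ} (hN : N ≠ 0)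
    (hD0 : 0 ≤ D) (hD : D ≤ N) (h : ∀ ν ∈ T, N < ν → f ν ≤ D * ((ν : ℝ) ^ 2)⁻¹) :
    ∑ ν ∈ T, f ν ≤ ∑ ν ∈ T.filter (· ≤ N), f ν + 1 := by
  rw [← Finset.sum_filter_add_sum_filter_not T (· ≤ N)]
  gcongr
  have hN0 : (0 : ℝ) < N := by exact_mod_cast Nat.pos_of_ne_zero hN
  have hsub : T.filter (fun ν => ¬ ν ≤ N) ⊆ Finset.Ioc N (max N (T.sup id)) := by
    intro ν hν
    rw [Finset.mem_filter] at hν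
    exact Finset.mem_Ioc.2 ⟨not_le.1 hν.2, le_max_of_le_right (Finset.le_sup (f := id) hν.1)⟩
  calc ∑ ν ∈ T.filter (fun ν => ¬ ν ≤ N), f ν
      ≤ ∑ ν ∈ T.filter (fun ν => ¬ ν ≤ N), D * ((ν : ℝ) ^ 2)⁻¹ :=
        Finset.sum_le_sum fun ν hν =>
          h ν (Finset.mem_filter.1 hν).1 (not_le.1 (Finset.mem_filter.1 hν).2)
    _ ≤ ∑ ν ∈ Finset.Ioc N (max N (T.sup id)), D * ((ν : ℝ) ^ 2)⁻¹ :=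
        Finset.sum_le_sum_of_subset_of_nonneg hsub fun _ _ _ => by positivity
    _ ≤ D * (N : ℝ)⁻¹ := by
        rw [← Finset.mul_sum]
        refine mul_le_mul_of_nonneg_left
          ((sum_Ioc_inv_sq_le_sub hN (le_max_left _ _)).trans (sub_le_self _ ?_)) hD0
        positivity
    _ ≤ 1 := by rw [← div_eq_mul_inv]; exact (div_le_one hN0).2 hD

/-- The points `ν ≥ y + η` have distance at least `η(ν - n₀ + 1)` to `y`, for the first such
`n₀`. -/
lemma sum_inv_sub_le {T : Finset ℕ} {y η : ℝ} {N : ℕ} (hy : 0 ≤ y) (hη : 0 < η) (hη1 : η ≤ 1)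
    (h : ∀ ν ∈ T, y + η ≤ ν ∧ ν ≤ N) :
    ∑ ν ∈ T, ((ν : ℝ) - y)⁻¹ ≤ (1 + Real.log N) / η := by
  obtain ⟨n₀, hn₀⟩ : ∃ n₀, n₀ = ⌈y + η⌉₊ := ⟨_, rfl⟩
  have hn₀1 : 1 ≤ n₀ := hn₀ ▸ Nat.ceil_pos.2 (by linarith)
  have hn₀y : y + η ≤ n₀ := hn₀ ▸ Nat.le_ceil _
  have hle (ν : ℕ) (hν : ν ∈ T) : n₀ ≤ ν := hn₀ ▸ Nat.ceil_le.2 (h ν hν).1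
  have hterm : ∀ ν ∈ T, ((ν : ℝ) - y)⁻¹ ≤ η⁻¹ * (((ν + 1 - n₀ : ℕ) : ℝ))⁻¹ := fun ν hν => by
    have h1 : (n₀ : ℝ) ≤ ν := by exact_mod_cast hle ν hν
    rw [← mul_inv, Nat.cast_sub (by have := hle ν hν; omega)]
    push_cast
    have h2 : 0 < η * (ν + 1 - n₀ : ℝ) := mul_pos hη (by linarith)
    have h3 : η * (ν - n₀ : ℝ) ≤ 1 * (ν - n₀) := by gcongr
    exact inv_anti₀ h2 (by linarith)
  refine (Finset.sum_le_sum hterm).trans ?_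
  rw [← Finset.mul_sum, div_eq_inv_mul]
  refine mul_le_mul_of_nonneg_left (sum_inv_le_of_injOn (i := fun ν => ν + 1 - n₀) ?_ ?_)
    (by positivity)
  · intro a ha b hb hab
    have h1 := hle a ha
    have h2 := hle b hb
    simp only at hab
    omega
  · intro ν hν
    have h1 := hle ν hν
    have h2 := (h ν hν).2
    rw [Finset.mem_Icc]
    omega

/-- The points `ν ≤ y - η` have distance at least `η(n₁ - ν + 1)` to `y`, for the last such
`n₁`. -/
lemma sum_inv_sub_le' {y η : ℝ} {N : ℕ} (hη : 0 < η) (hη1 : η ≤ 1) (hN : ⌊y - η⌋₊ ≤ N) :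
    ∑ ν ∈ Finset.Icc 1 ⌊y - η⌋₊, (y - (ν : ℝ))⁻¹ ≤ (1 + Real.log N) / η := by
  have hterm : ∀ ν ∈ Finset.Icc 1 ⌊y - η⌋₊,
      (y - (ν : ℝ))⁻¹ ≤ η⁻¹ * (((⌊y - η⌋₊ + 1 - ν : ℕ) : ℝ))⁻¹ := fun ν hν => by
    rw [Finset.mem_Icc] at hν
    have h0 : (⌊y - η⌋₊ : ℝ) ≤ y - η := (Nat.le_floor_iff' (by omega)).1 le_rfl
    have h1 : (ν : ℝ) ≤ ⌊y - η⌋₊ := by exact_mod_cast hν.2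
    rw [← mul_inv, Nat.cast_sub (by omega)]
    push_cast
    have h2 : 0 < η * (⌊y - η⌋₊ + 1 - ν : ℝ) := mul_pos hη (by linarith)
    have h3 : η * (⌊y - η⌋₊ - ν : ℝ) ≤ 1 * (⌊y - η⌋₊ - ν) := by gcongr
    exact inv_anti₀ h2 (by linarith)
  refine (Finset.sum_le_sum hterm).trans ?_
  rw [← Finset.mul_sum, div_eq_inv_mul]
  refine mul_le_mul_of_nonneg_left
    (sum_inv_le_of_injOn (i := fun ν => ⌊y - η⌋₊ + 1 - ν) ?_ ?_) (by positivity)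
  · intro a ha b hb hab
    simp only [Finset.coe_Icc, mem_Icc] at ha hb hab
    omega
  · intro ν hν
    rw [Finset.mem_Icc] at hν ⊢
    omega

section Estimates

variable {q : ℕ} [NeZero q]

lemma norm_tailIntegral_le_dist {m : ℤ} {s : ℂ} {X y d : ℝ} (hσ : 0 ≤ s.re) (ht0 : 0 ≤ s.im)
    (hX : 0 < X) (ht : 2 * Real.pi * (X / q) * y = s.im)
    (hm : (m : ℝ) < 0 ∨ 0 < (m : ℝ) ∧ y < m) (hd : |(m : ℝ) - y| = d) :
    ‖tailIntegral q m (X / q) s‖ ≤ X ^ (-s.re) * (1 / (Real.pi * (X / q) * d)) := by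
  have hq : 0 < q := NeZero.pos q
  have hq' : (0 : ℝ) < q := by exact_mod_cast hq
  have hpi := Real.pi_pos
  have hx : 0 < X / q := by positivity
  refine (norm_tailIntegral_le hq hσ ht0 hX (hm.imp_right fun h => ⟨h.1, ?_⟩)).trans_eq ?_
  · rw [← ht]
    calc 2 * Real.pi * (X / q) * y < 2 * Real.pi * (X / q) * m := by
          have := h.2; gcongr
      _ = 2 * Real.pi * m * (X / q) := by ring
  · have h1 : 2 * Real.pi * m * (X / q) - s.im = 2 * (Real.pi * (X / q)) * (m - y) := by
      rw [← ht]; ring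
    rw [h1, abs_mul, hd, abs_of_pos (by positivity), mul_assoc 2, ← div_div, div_self two_ne_zero]

/-- Near `y` the factor `s ~ t` is compensated by the length of the range of integration: with
`d = |m - y|`, the integral is both `≪ 1/σ` and `≪ 1/(xd)`, and `t = 2πxy`. -/
lemma norm_mul_norm_tailIntegral_le {m : ℤ} {s : ℂ} {X y d : ℝ} (hσ : 0 ≤ s.re) (ht0 : 0 ≤ s.im)
    (hX : 0 < X) (ht : 2 * Real.pi * (X / q) * y = s.im)
    (hm : (m : ℝ) < 0 ∨ 0 < (m : ℝ) ∧ y < m) (hd : |(m : ℝ) - y| = d) (hd0 : 0 < d) :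
    ‖s‖ * ‖tailIntegral q m (X / q) s‖ ≤ X ^ (-s.re) * (1 + 2 * y / d) := by
  have hq : 0 < q := NeZero.pos q
  have hq' : (0 : ℝ) < q := by exact_mod_cast hq
  have hpi := Real.pi_pos
  have hm0 : m ≠ 0 := by rintro rfl; simp at hm
  have h1 := re_mul_norm_tailIntegral_le hq hm0 hσ hX
  have h2 := norm_tailIntegral_le_dist hσ ht0 hX ht hm hd
  have h3 : s.im * ‖tailIntegral q m (X / q) s‖
      ≤ s.im * (X ^ (-s.re) * (1 / (Real.pi * (X / q) * d))) := by gcongr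
  have h4 : s.im * (X ^ (-s.re) * (1 / (Real.pi * (X / q) * d))) = X ^ (-s.re) * (2 * y / d) := by
    rw [← ht]; field_simp
  have h5 : ‖s‖ * ‖tailIntegral q m (X / q) s‖
      ≤ (s.re + s.im) * ‖tailIntegral q m (X / q) s‖ := by
    gcongr; exact norm_le_re_add_im hσ ht0
  linarith

/-- The terms of the two series decay quadratically away from `y`. -/
lemma norm_mul_norm_tailIntegral_div_le {m : ℤ} {s : ℂ} {X y d n : ℝ} (hσ : 0 ≤ s.re)
    (hσ1 : s.re ≤ 1) (ht0 : 0 ≤ s.im) (hX : 0 < X) (hy : 0 ≤ y)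
    (ht : 2 * Real.pi * (X / q) * y = s.im) (hm : (m : ℝ) < 0 ∨ 0 < (m : ℝ) ∧ y < m)
    (hd : |(m : ℝ) - y| = d) (hn : 0 < n) (hnd : n / 2 ≤ d) :
    ‖s‖ * ‖tailIntegral q m (X / q) s‖ / (2 * Real.pi * n)
      ≤ X ^ (-s.re) * ((q / X + y) * (n ^ 2)⁻¹) := by
  have hq : 0 < q := NeZero.pos q
  have hq' : (0 : ℝ) < q := by exact_mod_cast hq
  have hpi := Real.pi_pos
  have hpi3 := Real.pi_gt_three
  have h2 := norm_tailIntegral_le_dist hσ ht0 hX ht hm hd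
  have h5 : ‖s‖ ≤ 1 + s.im := (norm_le_re_add_im hσ ht0).trans (by linarith)
  have hW : 0 < X ^ (-s.re) := Real.rpow_pos_of_pos hX _
  have hd0 : 0 < d := by linarith
  calc ‖s‖ * ‖tailIntegral q m (X / q) s‖ / (2 * Real.pi * n)
      ≤ (1 + s.im) * (X ^ (-s.re) * (1 / (Real.pi * (X / q) * (n / 2)))) / (2 * Real.pi * n) := by
        refine div_le_div_of_nonneg_right (mul_le_mul h5 (h2.trans ?_) (norm_nonneg _)
          (by linarith)) (by positivity)
        gcongr
    _ = X ^ (-s.re) * ((q / X * (1 / Real.pi ^ 2) + y * (2 / Real.pi)) * (n ^ 2)⁻¹) := by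
        rw [← ht]; field_simp
    _ ≤ X ^ (-s.re) * ((q / X * 1 + y * 1) * (n ^ 2)⁻¹) := by
        have h6 : 1 / Real.pi ^ 2 ≤ 1 := by
          rw [div_le_one (by positivity)]; nlinarith
        have h7 : 2 / Real.pi ≤ 1 := by rw [div_le_one hpi]; linarith
        gcongr
    _ = X ^ (-s.re) * ((q / X + y) * (n ^ 2)⁻¹) := by rw [mul_one, mul_one]

lemma norm_posTerm_le_inv_sub (χ : DirichletCharacter ℂ q) {s : ℂ} {X y : ℝ} (hσ : 0 ≤ s.re)
    (ht0 : 0 ≤ s.im) (hX : 0 < X) (hy : 0 ≤ y) (ht : 2 * Real.pi * (X / q) * y = s.im) {ν : ℕ}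
    (hν : y < ν) : ‖posTerm χ s X ν‖ ≤ X ^ (-s.re) * ((ν : ℝ) - y)⁻¹ := by
  have hpi := Real.pi_gt_three
  have hW : 0 < X ^ (-s.re) := Real.rpow_pos_of_pos hX _
  have hν0 : (0 : ℝ) < ν := hy.trans_lt hν
  have hd0 : 0 < (ν : ℝ) - y := by linarith
  refine (norm_weight_mul_le (norm_conj_char_le χ _) ν).trans ?_
  have h := norm_mul_norm_tailIntegral_le (m := (ν : ℤ)) hσ ht0 hX ht
    (Or.inr ⟨by exact_mod_cast hν0, by exact_mod_cast hν⟩) (d := ν - y)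
    (by rw [Int.cast_natCast, abs_of_pos hd0]) hd0
  calc ‖s‖ * ‖tailIntegral q (ν : ℤ) (X / q) s‖ / (2 * Real.pi * ν)
      ≤ X ^ (-s.re) * (1 + 2 * y / (ν - y)) / (2 * Real.pi * ν) := by gcongr
    _ = X ^ (-s.re) * ((ν - y)⁻¹ * ((ν + y) / (2 * Real.pi * ν))) := by field_simp; ring
    _ ≤ X ^ (-s.re) * ((ν - y)⁻¹ * 1) := by
        gcongr
        rw [div_le_one (by positivity)]
        nlinarith
    _ = X ^ (-s.re) * ((ν : ℝ) - y)⁻¹ := by rw [mul_one]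

lemma norm_negTerm_le_inv (χ : DirichletCharacter ℂ q) {s : ℂ} {X y : ℝ} (hσ : 0 ≤ s.re)
    (ht0 : 0 ≤ s.im) (hX : 0 < X) (hy : 0 ≤ y) (ht : 2 * Real.pi * (X / q) * y = s.im) {ν : ℕ}
    (hν : 0 < ν) : ‖negTerm χ s X ν‖ ≤ X ^ (-s.re) * ((ν : ℝ))⁻¹ := by
  have hpi := Real.pi_gt_three
  have hW : 0 < X ^ (-s.re) := Real.rpow_pos_of_pos hX _
  have hν0 : (0 : ℝ) < ν := by exact_mod_cast hν
  have hd0 : 0 < (ν : ℝ) + y := by linarith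
  refine (norm_weight_mul_le (norm_conj_char_le χ _) ν).trans ?_
  have h := norm_mul_norm_tailIntegral_le (m := -(ν : ℤ)) hσ ht0 hX ht
    (Or.inl (by push_cast; linarith)) (d := ν + y)
    (by push_cast; rw [abs_of_neg (by linarith)]; ring) hd0
  have h2 : 2 * y / (ν + y) ≤ 2 := by rw [div_le_iff₀ hd0]; linarith
  calc ‖s‖ * ‖tailIntegral q (-(ν : ℤ)) (X / q) s‖ / (2 * Real.pi * ν)
      ≤ X ^ (-s.re) * (1 + 2) / (2 * Real.pi * ν) := by
        refine div_le_div_of_nonneg_right (h.trans ?_) (by positivity)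
        gcongr
    _ = X ^ (-s.re) * ((ν : ℝ)⁻¹ * (3 / (2 * Real.pi))) := by field_simp; ring
    _ ≤ X ^ (-s.re) * ((ν : ℝ)⁻¹ * 1) := by
        gcongr
        rw [div_le_one (by positivity)]
        linarith
    _ = X ^ (-s.re) * ((ν : ℝ))⁻¹ := by rw [mul_one]

lemma norm_headTerm_le_inv_sub (χ : DirichletCharacter ℂ q) {s : ℂ} {X y : ℝ} (hσ : 0 ≤ s.re)
    (hσ1 : s.re ≤ 1) (hX : 0 < X) (ht : 2 * Real.pi * (X / q) * y = s.im) {ν : ℕ} (hν : 1 ≤ ν)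
    (hνy : ν < y) : ‖headTerm χ s X ν‖ ≤ X ^ (-s.re) * (y - ν)⁻¹ := by
  have hq : 0 < q := NeZero.pos q
  have hq' : (0 : ℝ) < q := by exact_mod_cast hq
  have hpi := Real.pi_gt_three
  have hW : 0 < X ^ (-s.re) := Real.rpow_pos_of_pos hX _
  have hd0 : 0 < y - ν := by linarith
  have hgap : s.im - 2 * Real.pi * ν * (X / q) = 2 * (X / q) * (Real.pi * (y - ν)) := by
    rw [← ht]; ring
  have hgap0 : 0 < 2 * (X / q) * (Real.pi * (y - ν)) := by positivity
  have h := norm_headIntegral_le hq hν hσ hσ1 hX (by linarith)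
  rw [headTerm, norm_mul]
  refine (mul_le_of_le_one_left (norm_nonneg _) (norm_conj_char_le χ _)).trans (h.trans ?_)
  rw [hgap, ← div_div, div_self (by positivity), one_div]
  have : (1 : ℝ) * (y - ν) ≤ Real.pi * (y - ν) := by gcongr; linarith
  gcongr
  linarith

lemma norm_tsum_posTerm_le (χ : DirichletCharacter ℂ q) {s : ℂ} {X y η : ℝ} {N : ℕ}
    (hσ : 0 ≤ s.re) (hσ1 : s.re ≤ 1) (ht0 : 0 ≤ s.im) (hX : 0 < X) (hy : 0 ≤ y)
    (ht : 2 * Real.pi * (X / q) * y = s.im) (hη : 0 < η) (hη1 : η ≤ 1)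
    (hN : 2 * y + q / X ≤ N) :
    ‖∑' ν : {ν : ℕ // y + η ≤ (ν : ℝ)}, posTerm χ s X ν‖
      ≤ X ^ (-s.re) * ((1 + Real.log N) / η + 1) := by
  have hq' : (0 : ℝ) < q := by exact_mod_cast NeZero.pos q
  have hW : 0 < X ^ (-s.re) := Real.rpow_pos_of_pos hX _
  have hqX : 0 < q / X := by positivity
  have hN0 : N ≠ 0 := by rintro rfl; rw [Nat.cast_zero] at hN; linarith
  refine norm_tsum_subtype_le (p := fun ν : ℕ => y + η ≤ (ν : ℝ)) fun T hT => ?_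
  have hsum := sum_le_add_one_of_le_div_sq (T := T) (f := fun ν => ‖posTerm χ s X ν‖ / X ^ (-s.re))
    hN0 (D := q / X + y) (by positivity) (by linarith) fun ν hν hνN => by
      have hνN' : (N : ℝ) < ν := by exact_mod_cast hνN
      have hν0 : (0 : ℝ) < ν := (Nat.cast_nonneg N).trans_lt hνN'
      rw [div_le_iff₀' hW]
      refine (norm_weight_mul_le (norm_conj_char_le χ _) ν).trans ?_
      exact norm_mul_norm_tailIntegral_div_le (m := (ν : ℤ)) hσ hσ1 ht0 hX hy ht
        (Or.inr ⟨by exact_mod_cast hν0, by push_cast; linarith [hT ν hν]⟩) (d := ν - y)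
        (by rw [Int.cast_natCast, abs_of_pos (by linarith [hT ν hν])]) hν0 (by linarith)
  have hnear : ∑ ν ∈ T.filter (· ≤ N), ‖posTerm χ s X ν‖ / X ^ (-s.re)
      ≤ (1 + Real.log N) / η := by
    refine (Finset.sum_le_sum fun ν hν => ?_).trans (sum_inv_sub_le (T := T.filter (· ≤ N)) hy hη
      hη1 fun ν hν => ⟨hT ν (Finset.mem_filter.1 hν).1, (Finset.mem_filter.1 hν).2⟩)
    rw [div_le_iff₀' hW]
    have := hT ν (Finset.mem_filter.1 hν).1
    exact norm_posTerm_le_inv_sub χ hσ ht0 hX hy ht (by linarith)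
  rw [← div_le_iff₀' hW, Finset.sum_div]
  linarith

lemma norm_tsum_negTerm_le (χ : DirichletCharacter ℂ q) {s : ℂ} {X y : ℝ} {N : ℕ}
    (hσ : 0 ≤ s.re) (hσ1 : s.re ≤ 1) (ht0 : 0 ≤ s.im) (hX : 0 < X) (hy : 0 ≤ y)
    (ht : 2 * Real.pi * (X / q) * y = s.im) (hN : 2 * y + q / X ≤ N) :
    ‖∑' ν : ℕ+, negTerm χ s X ν‖ ≤ X ^ (-s.re) * ((1 + Real.log N) + 1) := by
  have hq' : (0 : ℝ) < q := by exact_mod_cast NeZero.pos q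
  have hW : 0 < X ^ (-s.re) := Real.rpow_pos_of_pos hX _
  have hqX : 0 < q / X := by positivity
  have hN0 : N ≠ 0 := by rintro rfl; rw [Nat.cast_zero] at hN; linarith
  refine norm_tsum_subtype_le (p := fun ν : ℕ => 0 < ν) (f := negTerm χ s X) fun T hT => ?_
  have hsum := sum_le_add_one_of_le_div_sq (T := T) (f := fun ν => ‖negTerm χ s X ν‖ / X ^ (-s.re))
    hN0 (D := q / X + y) (by positivity) (by linarith) fun ν hν hνN => by
      have hν0 : (0 : ℝ) < ν := by exact_mod_cast hT ν hν
      rw [div_le_iff₀' hW]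
      refine (norm_weight_mul_le (norm_conj_char_le χ _) ν).trans ?_
      exact norm_mul_norm_tailIntegral_div_le (m := -(ν : ℤ)) hσ hσ1 ht0 hX hy ht
        (Or.inl (by push_cast; linarith)) (d := ν + y)
        (by push_cast; rw [abs_of_neg (by linarith)]; ring) hν0 (by linarith)
  have hnear : ∑ ν ∈ T.filter (· ≤ N), ‖negTerm χ s X ν‖ / X ^ (-s.re) ≤ 1 + Real.log N := by
    refine (Finset.sum_le_sum fun ν hν => ?_).trans (sum_inv_le_of_injOn (T := T.filter (· ≤ N))
      (i := id) (injOn_id _) fun ν hν => Finset.mem_Icc.2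
        ⟨hT ν (Finset.mem_filter.1 hν).1, (Finset.mem_filter.1 hν).2⟩)
    rw [div_le_iff₀' hW]
    exact norm_negTerm_le_inv χ hσ ht0 hX hy ht (hT ν (Finset.mem_filter.1 hν).1)
  rw [← div_le_iff₀' hW, Finset.sum_div]
  linarith

lemma norm_sum_headTerm_le (χ : DirichletCharacter ℂ q) {s : ℂ} {X y η : ℝ} {N : ℕ}
    (hσ : 0 ≤ s.re) (hσ1 : s.re ≤ 1) (hX : 0 < X) (ht : 2 * Real.pi * (X / q) * y = s.im)
    (hη : 0 < η) (hη1 : η ≤ 1) (hN : ⌊y - η⌋₊ ≤ N) :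
    ‖∑ ν ∈ Finset.Icc 1 ⌊y - η⌋₊, headTerm χ s X ν‖
      ≤ X ^ (-s.re) * ((1 + Real.log N) / η) := by
  have hW : 0 < X ^ (-s.re) := Real.rpow_pos_of_pos hX _
  have hterm : ∀ ν ∈ Finset.Icc 1 ⌊y - η⌋₊,
      ‖headTerm χ s X ν‖ ≤ X ^ (-s.re) * (y - (ν : ℝ))⁻¹ := fun ν hν => by
    rw [Finset.mem_Icc] at hν
    have h1 := (Nat.le_floor_iff' (by omega)).1 hν.2
    exact norm_headTerm_le_inv_sub χ hσ hσ1 hX ht hν.1 (by linarith)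
  refine (norm_sum_le_of_le _ hterm).trans ?_
  rw [← Finset.mul_sum]
  exact mul_le_mul_of_nonneg_left (sum_inv_sub_le' hη hη1 hN) hW.le

/-- The truncated Fourier series of the sawtooth functions, twisted by `χ`. -/
lemma norm_sum_char_mul_sawtooth_add_le {χ : DirichletCharacter ℂ q} (hχ : χ.IsPrimitive)
    {X : ℝ} (hX : 0 ≤ X) {M N : ℕ} (hM : M ≤ N) :
    ‖∑ a ∈ Finset.Icc 1 q, χ (a : ZMod q) * ((sawtooth ((X - a) / q) : ℂ)
        + ∑ ν ∈ Finset.Icc 1 M, e ((ν : ℝ) * ((X - a) / q)) / (2 * (Real.pi : ℂ) * Complex.I * ν))‖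
      ≤ √q * (2 * (1 + Real.log q) + (1 + Real.log N)) := by
  have hpi := Real.pi_gt_three
  have hsplit : ∑ a ∈ Finset.Icc 1 q, χ (a : ZMod q) * ((sawtooth ((X - a) / q) : ℂ)
        + ∑ ν ∈ Finset.Icc 1 M, e ((ν : ℝ) * ((X - a) / q)) / (2 * (Real.pi : ℂ) * Complex.I * ν))
      = charSawtooth χ X + ∑ ν ∈ Finset.Icc 1 M,
          (starRingEnd ℂ) (χ (-(ν : ZMod q))) * tau χ * e (ν * (X / q))
            / (2 * (Real.pi : ℂ) * Complex.I * ν) := by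
    simp only [mul_add, Finset.sum_add_distrib, Finset.mul_sum, charSawtooth]
    congr 1
    rw [Finset.sum_comm]
    refine Finset.sum_congr rfl fun ν _ => ?_
    have h := sum_char_mul_e_sub hχ (ν : ℤ) (X / q)
    push_cast at h
    rw [← h, Finset.sum_div]
    refine Finset.sum_congr rfl fun a _ => ?_
    rw [sub_div, mul_div_assoc]
  have hterm (ν : ℕ) : ‖(starRingEnd ℂ) (χ (-(ν : ZMod q))) * tau χ * e (ν * (X / q))
      / (2 * (Real.pi : ℂ) * Complex.I * ν)‖ ≤ √q * ((ν : ℝ))⁻¹ := by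
    have h1 : ‖2 * (Real.pi : ℂ) * Complex.I * ν‖ = 2 * Real.pi * ν := by
      simp [abs_of_pos Real.pi_pos]
    rw [norm_div, norm_mul, norm_mul, norm_e, norm_tau hχ, h1, mul_one, ← div_div, div_eq_mul_inv]
    gcongr
    rw [div_le_iff₀ (by positivity)]
    have h2 : ‖(starRingEnd ℂ) (χ (-(ν : ZMod q)))‖ * √q ≤ 1 * √q := by
      gcongr; exact norm_conj_char_le χ _
    have h3 : √(q : ℝ) * 1 ≤ √q * (2 * Real.pi) := by gcongr; linarith
    linarith
  rw [hsplit]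
  refine (norm_add_le _ _).trans ?_
  have h1 := norm_charSawtooth_le hχ hX
  have h2 : ‖∑ ν ∈ Finset.Icc 1 M, (starRingEnd ℂ) (χ (-(ν : ZMod q))) * tau χ * e (ν * (X / q))
      / (2 * (Real.pi : ℂ) * Complex.I * ν)‖ ≤ √q * (1 + Real.log N) := by
    refine (norm_sum_le_of_le _ fun ν _ => hterm ν).trans ?_
    rw [← Finset.mul_sum]
    refine mul_le_mul_of_nonneg_left (sum_inv_le_of_injOn (i := id) (injOn_id _) fun ν hν => ?_)
      (Real.sqrt_nonneg _)
    rw [Finset.mem_Icc] at hν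
    exact Finset.mem_Icc.2 ⟨hν.1, hν.2.trans hM⟩
  linarith

lemma norm_K₁_le {χ : DirichletCharacter ℂ q} (hχ : χ.IsPrimitive) {s : ℂ} {X y η : ℝ} {N : ℕ}
    (hσ : 0 ≤ s.re) (hσ1 : s.re ≤ 1) (ht0 : 0 ≤ s.im) (hX : 0 < X) (hy : 0 ≤ y)
    (ht : 2 * Real.pi * (X / q) * y = s.im) (hη : 0 < η) (hη1 : η ≤ 1) (hN : 2 * y + q / X ≤ N) :
    ‖K₁ χ s X y η‖ ≤ √q * X ^ (-s.re)
      * (2 * (1 + Real.log q) + 2 + (2 + 2 / η) * (1 + Real.log N)) := by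
  have hq' : (0 : ℝ) < q := by exact_mod_cast NeZero.pos q
  have hqX : 0 < q / X := by positivity
  have hW : 0 < X ^ (-s.re) := Real.rpow_pos_of_pos hX _
  have hyN : ⌊y⌋₊ ≤ N := Nat.floor_le_of_le (by linarith)
  have hyN' : ⌊y - η⌋₊ ≤ N := Nat.floor_le_of_le (by linarith)
  have h1 := norm_sum_char_mul_sawtooth_add_le hχ hX.le hyN
  have h2 := norm_tsum_posTerm_le χ hσ hσ1 ht0 hX hy ht hη hη1 hN
  have h3 := norm_sum_headTerm_le χ hσ hσ1 hX ht hη hη1 hyN'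
  have h4 := norm_tsum_negTerm_le χ hσ hσ1 ht0 hX hy ht hN
  rw [K₁]
  refine (norm_sub_le _ _).trans ((add_le_add ((norm_sub_le _ _).trans (add_le_add
    (norm_add_le _ _) le_rfl)) le_rfl).trans ?_)
  rw [norm_mul, norm_mul, norm_mul, norm_mul, norm_tau hχ,
    Complex.norm_cpow_eq_rpow_re_of_pos hX, Complex.neg_re]
  refine (add_le_add (add_le_add (add_le_add (mul_le_mul_of_nonneg_left h1 hW.le)
    (mul_le_mul_of_nonneg_left h2 (Real.sqrt_nonneg _)))
    (mul_le_mul_of_nonneg_left h3 (Real.sqrt_nonneg _)))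
    (mul_le_mul_of_nonneg_left h4 (Real.sqrt_nonneg _))).trans_eq ?_
  ring

/-- With `N` of size `y + q/X`, all logarithms are `≪ log(q(t + 2))`. -/
lemma norm_K₁_le_log {χ : DirichletCharacter ℂ q} (hχ : χ.IsPrimitive) {s : ℂ} {X y η c : ℝ}
    (hσ : 0 ≤ s.re) (hσ1 : s.re ≤ 1) (ht0 : 0 ≤ s.im) (hc : 0 < c) (hX : c ≤ X) (hy : 0 ≤ y)
    (ht : 2 * Real.pi * (X / q) * y = s.im) (hη : 0 < η) (hη1 : η ≤ 1) :
    ‖K₁ χ s X y η‖ ≤ (10 + (2 + 2 / η) * (3 + 2 * Real.log (1 / c + 1)))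
      * (√q * X ^ (-s.re) * Real.log (q * (s.im + 2))) := by
  have hq1 : (1 : ℝ) ≤ q := by exact_mod_cast NeZero.one_le
  have hq' : (0 : ℝ) < q := by linarith
  have hpi := Real.pi_gt_three
  have hX0 : 0 < X := hc.trans_le hX
  have hW : 0 < X ^ (-s.re) := Real.rpow_pos_of_pos hX0 _
  have hqX : 0 < q / X := by positivity
  have hN := Nat.le_ceil (2 * y + q / X)
  have hNlt := Nat.ceil_lt_add_one (by positivity : 0 ≤ 2 * y + q / X)
  have hN0 : (0 : ℝ) < ⌈2 * y + q / X⌉₊ := by linarith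
  refine (norm_K₁_le hχ hσ hσ1 ht0 hX0 hy ht hη hη1 hN).trans ?_
  have hNle : (⌈2 * y + q / X⌉₊ : ℝ) ≤ q * (s.im + 2) * (1 / c + 1) := by
    have hqc : q / X ≤ q / c := by gcongr
    have h1 : 2 * y ≤ s.im * (q / c) := by
      have h2 : y = s.im * (q / X) / (2 * Real.pi) := by rw [← ht]; field_simp
      have h3 : s.im * (q / X) / (2 * Real.pi) ≤ s.im * (q / X) / 2 := by gcongr; linarith
      have h4 : s.im * (q / X) ≤ s.im * (q / c) := by gcongr
      linarith
    have h5 : (q : ℝ) * (s.im + 2) * (1 / c + 1)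
        = s.im * (q / c) + q / c + q / c + q * (s.im + 2) := by ring
    have h6 : 0 < q / c := by positivity
    have h7 : 1 * (0 + 2) ≤ q * (s.im + 2) := by gcongr
    linarith
  have hqt : 0 < q * (s.im + 2) := by positivity
  have hc1 : 0 < 1 / c + 1 := by positivity
  have hlogN : Real.log ⌈2 * y + q / X⌉₊ ≤ Real.log (q * (s.im + 2)) + Real.log (1 / c + 1) := by
    rw [← Real.log_mul hqt.ne' hc1.ne']
    exact Real.log_le_log hN0 hNle
  have hlogq : Real.log q ≤ Real.log (q * (s.im + 2)) :=
    Real.log_le_log hq' (le_mul_of_one_le_right hq'.le (by linarith))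
  have hlog2 : 1 / 2 ≤ Real.log (q * (s.im + 2)) := by
    have h1 : Real.log 2 ≤ Real.log (q * (s.im + 2)) := by
      refine Real.log_le_log two_pos ?_
      have h7 : 1 * (0 + 2) ≤ q * (s.im + 2) := by gcongr
      linarith
    have := Real.log_two_gt_d9
    linarith
  have hlogc : 0 ≤ Real.log (1 / c + 1) := Real.log_nonneg (by have : 0 < 1 / c := by positivity
                                                               linarith)
  generalize Real.log (q * (s.im + 2)) = L at hlogN hlogq hlog2 ⊢
  generalize Real.log (1 / c + 1) = l at hlogN hlogc ⊢
  have hA : 1 + Real.log ⌈2 * y + q / X⌉₊ ≤ (3 + 2 * l) * L := by nlinarith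
  have hB : 2 * (1 + Real.log q) + 2 ≤ 10 * L := by linarith
  calc √q * X ^ (-s.re)
        * (2 * (1 + Real.log q) + 2 + (2 + 2 / η) * (1 + Real.log ⌈2 * y + q / X⌉₊))
      ≤ √q * X ^ (-s.re) * (10 * L + (2 + 2 / η) * ((3 + 2 * l) * L)) := by gcongr
    _ = (10 + (2 + 2 / η) * (3 + 2 * l)) * (√q * X ^ (-s.re) * L) := by ring

end Estimates

end LApprox

theorem proposition2 :
    -- the formula for the remainder, with the convergence of all integrals and series in it
    (∀ (q : ℕ) [NeZero q] (χ : DirichletCharacter ℂ q), χ.IsPrimitive →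
      ∀ (s : ℂ) (X y η : ℝ), 0 ≤ s.re → s.re ≤ 1 → 0 ≤ s.im → 0 < X →
        2 * Real.pi * (X / q) * y = s.im → 0 < η → η < 1 →
        (∀ m : ℤ, m ≠ 0 →
          Filter.Tendsto (LApprox.tailTrunc q m (X / q) s) Filter.atTop
            (nhds (LApprox.tailIntegral q m (X / q) s))) ∧
        (∀ ν : ℕ, 1 ≤ ν → (ν : ℝ) ≤ y →
          (s.re < 1 → IntervalIntegrable (LApprox.headIntegrand q ν s)
            MeasureTheory.volume 0 (X / q)) ∧
          (∀ δ : ℝ, 0 < δ → δ < 1 →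
            IntervalIntegrable (LApprox.headIntegrand q ν (s - (δ : ℂ)))
              MeasureTheory.volume 0 (X / q)) ∧
          Filter.Tendsto
            (fun δ : ℝ => ∫ u in (0 : ℝ)..(X / q), LApprox.headIntegrand q ν (s - (δ : ℂ)) u)
            (nhdsWithin (0 : ℝ) (Set.Ioi 0))
            (nhds (LApprox.headIntegral q ν (X / q) s))) ∧
        Summable (fun ν : {ν : ℕ // y + η ≤ (ν : ℝ)} => LApprox.posTerm χ s X ν) ∧
        Summable (fun ν : ℕ+ => LApprox.negTerm χ s X ν) ∧
        (q ≠ 1 →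
          LApprox.E₁ χ s X y = LApprox.K₁ χ s X y η + LApprox.K₂ χ s X y η) ∧
        (q = 1 → s ≠ 1 →
          LApprox.E₁ χ s X y - (X : ℂ) ^ (1 - s) / (s - 1)
            = LApprox.K₁ χ s X y η + LApprox.K₂ χ s X y η) ∧
        (∀ ν₀ : ℕ, 1 ≤ ν₀ → y = (ν₀ : ℝ) →
          LApprox.K₂ χ s X y η = -(LApprox.tau χ * (starRingEnd ℂ) (χ (-(ν₀ : ZMod q)))
            * LApprox.headIntegral q ν₀ (X / q) s))) ∧
    -- the estimates; `c` is the lower bound behind `≫ 1`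
    (∀ c : ℝ, 0 < c →
      (∀ η : ℝ, 0 < η → η < 1 →
        ∃ C : ℝ, ∀ (q : ℕ) [NeZero q] (χ : DirichletCharacter ℂ q), χ.IsPrimitive →
          ∀ (s : ℂ) (X y : ℝ), 0 ≤ s.re → s.re ≤ 1 → 0 ≤ s.im →
            2 * Real.pi * (X / q) * y = s.im → c ≤ X → c ≤ y →
            ‖LApprox.K₁ χ s X y η‖
              ≤ C * (Real.sqrt q * X ^ (-s.re) * Real.log (q * (s.im + 2)))) ∧
      (∃ C : ℝ, ∀ (q : ℕ) [NeZero q] (χ : DirichletCharacter ℂ q), χ.IsPrimitive →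
        ∀ (s : ℂ) (X y η : ℝ), 0 ≤ s.re → s.re ≤ 1 → 0 ≤ s.im →
          2 * Real.pi * (X / q) * y = s.im → 0 < η → η < 1 → c ≤ X → c ≤ y → c ≤ s.im →
          ‖LApprox.K₂ χ s X y η‖
            ≤ C * (X ^ (1 - s.re) / Real.sqrt (q * s.im)))) := by
  refine ⟨fun q _ χ hχ s X y η hs0 hs1 ht0 hX ht hη hη1 => ?_, fun c hc => ⟨fun η hη hη1 => ?_, ?_⟩⟩
  · have hq : (0 : ℝ) < q := by exact_mod_cast NeZero.pos q
    have hx : 0 < X / q := by positivity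
    have hs : -1 < s.re := by linarith
    have hy : 0 ≤ y := by
      have : 0 < 2 * Real.pi * (X / q) := by have := Real.pi_pos; positivity
      by_contra! h
      linarith [mul_neg_of_pos_of_neg this h]
    refine ⟨fun m hm => ?_, fun ν hν hνy => ⟨fun h => ?_, fun δ hδ _ => ?_, ?_⟩, ?_, ?_,
      fun hq1 => ?_, fun hq1 hs1' => ?_, fun ν₀ hν₀ hyν => ?_⟩
    · rw [LApprox.tailIntegral_eq hm hx hs]
      exact LApprox.tendsto_tailTrunc hm hx hs
    · exact LApprox.intervalIntegrable_headIntegrand q ν hx h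
    · exact LApprox.intervalIntegrable_headIntegrand q ν hx (by simp; linarith)
    · have hν' : (1 : ℝ) ≤ ν := by exact_mod_cast hν
      have him := (LApprox.im_pos_of_one_le hX ht (by linarith)).ne'
      rw [LApprox.headIntegral_eq (NeZero.ne q) hν hx hs0 hs1 him]
      exact LApprox.tendsto_integral_headIntegrand (NeZero.ne q) hν hx hs0 hs1 him
    · exact (LApprox.summable_posTerm χ hs hX).comp_injective Subtype.val_injective
    · exact (LApprox.summable_negTerm χ hs hX).comp_injective PNat.coe_injective
    · rw [LApprox.remainder_eq hχ hs0 hs1 (fun h => absurd h hq1) hX hy ht hη, if_neg hq1, zero_add]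
    · rw [LApprox.remainder_eq hχ hs0 hs1 (fun _ => hs1') hX hy ht hη, if_pos hq1,
        add_sub_cancel_left]
    · exact LApprox.K₂_of_natCast χ s X hη hη1 hν₀ hyν
  · exact ⟨_, fun q _ χ hχ s X y hs0 hs1 ht0 ht hX hy =>
      LApprox.norm_K₁_le_log hχ hs0 hs1 ht0 hc hX (hc.le.trans hy) ht hη hη1.le⟩
  · exact ⟨_, fun q _ χ hχ s X y η hs0 hs1 ht0 ht hη hη1 hX hy hct =>
      LApprox.norm_K₂_le hχ hs0 hs1 (hc.trans_le hX) (hc.trans_le hy) ht hη1 hc hct⟩
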